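/- Let $m,n\ge 2$ be integers, $N:=m+n-1$, and let $\mathbb S^N\subset\mathbb R^{m}\times\mathbb R^{n}$ be the unit sphere with its round metric $g$ and volume measure $dV_g$. Let $G:=O(m)\times O(n)$ act on $\mathbb S^N$ by $(A,B)(x,y)=(Ax,By)$, and let $f:\mathbb S^N\to[-1,1]$, $f(x,y)=|x|^2-|y|^2$. The superscript $G$ denotes the subspace of those functions $u$ with $u\circ\gamma=u$ a.e. for all $\gamma\in G$. Put $\alpha:=\frac n2-1$, $\beta:=\frac m2-1$ and, with $|\mathbb S^{k-1}|=2\pi^{k/2}/\Gamma(k/2)$, $$h(t):=C(1-t)^\alpha(1+t)^\beta,\qquad C:=\frac{|\mathbb S^{m-1}||\mathbb S^{n-1}|}{2^{(m+n)/2}},\qquad t\in[-1,1].$$ Let $L^2_h([-1,1])$ be the real $L^2$-space of the measure $h\,dt$, with norm $\|w\|_h^2=\int_{-1}^1w^2h\,dt$. For $i\ge0$ let $P_i=P_i^{(\alpha,\beta)}$ be the $i$-th Jacobi polynomial, i.e. the unique monic polynomial solution of $(1-t^2)x''+[\beta-\alpha-(\alpha+\beta+2)t]x'+i(i+\alpha+\beta+1)x=0$;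 let $p_i:=P_i/\|P_i\|_h$ and $\langle w,p_i\rangle_h:=\int_{-1}^1w\,p_i\,h\,dt$. For $s\in(0,1)$ let $H^s_g(\mathbb S^N)$ be the closure of $C^\infty(\mathbb S^N)$ in $L^2_g(\mathbb S^N)$ with respect to the norm $$\|u\|_{H^s_g}^2:=\frac{c_{N,s}}2\int_{\mathbb S^N}\!\int_{\mathbb S^N}\frac{|u(z)-u(\zeta)|^2}{|z-\zeta|^{N+2s}}\,dV_g(z)\,dV_g(\zeta)+A_{N,s}\int_{\mathbb S^N}u^2\,dV_g,$$ $$c_{N,s}:=4^s\pi^{-N/2}\frac{\Gamma(\frac N2+s)}{\Gamma(2-s)}s(1-s),\qquad A_{N,s}:=\frac{\Gamma(\frac N2+s)}{\Gamma(\frac N2-s)},$$ and let $H^s_h([-1,1])$ be the closure of $C^\infty([-1,1])$ in $L^2_h([-1,1])$ with respect to the norm $$\|w\|_{H^s_h}^2:=\sum_{i=0}^\infty\langle w,p_i\rangle_h^2\,\varphi_{N,s}(\lambda_i),\qquad \lambda_i:=2i(N-1+2i),\qquad \varphi_{N,s}(\lambda):=\frac{\Gamma\Big(\frac12+s+\sqrt{\lambda+(\frac{N-1}2)^2}\Big)}{\Gamma\Big(\frac12-s+\sqrt{\lambda+(\frac{N-1}2)^2}\Big)}.$$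 Then every $u\in L^2_g(\mathbb S^N)^G$ can be written as $u=w\circ f$ a.e. in $\mathbb S^N$ with a function $w$ on $[-1,1]$ that is unique up to null sets, and the map $j(u)=j(w\circ f):=w$ is an isometric isomorphism (a linear, norm-preserving bijection) from $L^2_g(\mathbb S^N)^G$ onto $L^2_h([-1,1])$. Moreover, for every $s\in(0,1)$, $j$ restricts to an isometric isomorphism from $H^s_g(\mathbb S^N)^G$ onto $H^s_h([-1,1])$. -/

import Mathlib

open MeasureTheory Filter Topology Set
open scoped ENNReal ContDiff Manifold Pointwise Polynomial

noncomputable section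

namespace SymSphere

/-! ### The sphere, the group `O(m) × O(n)` and the function `f` -/

/-- `ℝ^m × ℝ^n` with its Euclidean norm. -/
abbrev Ambient (m n : ℕ) : Type :=
  WithLp 2 (EuclideanSpace ℝ (Fin m) × EuclideanSpace ℝ (Fin n))

/-- The unit sphere `𝕊^N`, `N = m + n - 1`, of `ℝ^m × ℝ^n`. -/
abbrev Sph (m n : ℕ) : Type := Metric.sphere (0 : Ambient m n) 1

theorem finrank_ambient (m n : ℕ) : Module.finrank ℝ (Ambient m n) = m + n := by
  rw [(WithLp.linearEquiv 2 ℝ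
    (EuclideanSpace ℝ (Fin m) × EuclideanSpace ℝ (Fin n))).finrank_eq]
  simp

instance instFactFinrank {N m n : ℕ} [h : Fact (m + n = N + 1)] :
    Fact (Module.finrank ℝ (Ambient m n) = N + 1) :=
  ⟨(finrank_ambient m n).trans h.out⟩

/-- The Riemannian volume measure of the round sphere (the surface measure that appears in the
polar decomposition of Lebesgue measure). -/
def surf (m n : ℕ) : Measure (Sph m n) := (volume : Measure (Ambient m n)).toSphere

instance (m n : ℕ) : IsFiniteMeasure (surf m n) := by unfold surf; infer_instance

/-- The orthogonal group `O(k)`, as the group of linear isometries of `ℝ^k`. -/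
abbrev OrthGroup (k : ℕ) : Type := EuclideanSpace ℝ (Fin k) ≃ₗᵢ[ℝ] EuclideanSpace ℝ (Fin k)

/-- The map `(x, y) ↦ (A x, B y)` of `ℝ^m × ℝ^n`. -/
def blockIsometry {m n : ℕ} (A : OrthGroup m) (B : OrthGroup n) :
    Ambient m n ≃ₗᵢ[ℝ] Ambient m n :=
  LinearIsometryEquiv.withLpProdCongr 2 A B

/-- The action of `(A, B) ∈ O(m) × O(n)` on the sphere. -/
def act {m n : ℕ} (A : OrthGroup m) (B : OrthGroup n) (z : Sph m n) : Sph m n :=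
  ⟨blockIsometry A B z, by simp⟩

/-- `f (x, y) = |x|² - |y|²`. -/
def f {m n : ℕ} (z : Sph m n) : ℝ := ‖(z : Ambient m n).fst‖ ^ 2 - ‖(z : Ambient m n).snd‖ ^ 2

theorem measurable_act {m n : ℕ} (A : OrthGroup m) (B : OrthGroup n) :
    Measurable (act A B) :=
  ((blockIsometry A B).continuous.comp continuous_subtype_val).subtype_mk _ |>.measurable

theorem measurePreserving_act {m n : ℕ} (A : OrthGroup m) (B : OrthGroup n) :
    MeasurePreserving (act A B) (surf m n) (surf m n) := by
  refine ⟨measurable_act A B, ?_⟩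
  ext s hs
  have hs' := measurable_act A B hs
  rw [Measure.map_apply (measurable_act A B) hs, surf, Measure.toSphere_apply' _ hs,
    Measure.toSphere_apply' _ hs']
  congr 1
  have hpre : (blockIsometry A B) ⁻¹' (Ioo (0 : ℝ) 1 • ((↑) '' s : Set (Ambient m n)))
      = Ioo (0 : ℝ) 1 • ((↑) '' (act A B ⁻¹' s) : Set (Ambient m n)) := by
    ext x
    simp only [mem_preimage, Set.mem_smul, mem_image]
    constructor
    · rintro ⟨r, hr, _, ⟨z, hz, rfl⟩, h⟩
      have hmem : (blockIsometry A B).symm z ∈ Metric.sphere (0 : Ambient m n) 1 := by simp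
      have hact : act A B ⟨_, hmem⟩ = z := by ext1; simp [act]
      refine ⟨r, hr, _, ⟨⟨_, hmem⟩, by rwa [hact], rfl⟩, ?_⟩
      apply (blockIsometry A B).injective
      simpa using h
    · rintro ⟨r, hr, _, ⟨z, hz, rfl⟩, rfl⟩
      exact ⟨r, hr, _, ⟨act A B z, hz, rfl⟩, by simp [act]⟩
  rw [← hpre]
  exact ((blockIsometry A B).measurePreserving).measure_preimage_equiv
    (f := (blockIsometry A B).toMeasurableEquiv) _

/-! ### Function spaces on the sphere -/

/-- `L²(𝕊^N)^G`, `G = O(m) × O(n)`: the classes `u` with `u ∘ γ = u` a.e. for every `γ ∈ G`. -/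
def L2G (m n : ℕ) : Submodule ℝ (Lp ℝ 2 (surf m n)) where
  carrier := {u | ∀ (A : OrthGroup m) (B : OrthGroup n), (fun z => u (act A B z)) =ᵐ[surf m n] u}
  zero_mem' A B := by
    have h0 := Lp.coeFn_zero ℝ 2 (surf m n)
    filter_upwards [h0, (measurePreserving_act A B).quasiMeasurePreserving.ae h0] with z h1 h2
    rw [h1, h2]; rfl
  add_mem' {u v} hu hv A B := by
    have h0 := Lp.coeFn_add u v
    filter_upwards [h0, (measurePreserving_act A B).quasiMeasurePreserving.ae h0, hu A B, hv A B]
      with z h1 h2 h3 h4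
    rw [h1, h2, Pi.add_apply, Pi.add_apply, h3, h4]
  smul_mem' c u hu A B := by
    have h0 := Lp.coeFn_smul c u
    filter_upwards [h0, (measurePreserving_act A B).quasiMeasurePreserving.ae h0, hu A B]
      with z h1 h2 h3
    rw [h1, h2, Pi.smul_apply, Pi.smul_apply, h3]

/-- `c_{N,s}`, the normalization of the fractional Laplacian. -/
def cConst (N : ℕ) (s : ℝ) : ℝ :=
  4 ^ s * Real.pi ^ (-(N : ℝ) / 2) * (Real.Gamma (N / 2 + s) / Real.Gamma (2 - s)) * s * (1 - s)

/-- `A_{N,s}`. -/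
def aConst (N : ℕ) (s : ℝ) : ℝ := Real.Gamma (N / 2 + s) / Real.Gamma (N / 2 - s)

/-- The square of the `H^s_g` norm of a function on the sphere, as an extended real. -/
def sphereEnergy (N m n : ℕ) (s : ℝ) (u : Sph m n → ℝ) : ℝ≥0∞ :=
  ENNReal.ofReal (cConst N s / 2) *
      ∫⁻ z, ∫⁻ ζ, ENNReal.ofReal (|u z - u ζ| ^ 2 / dist z ζ ^ ((N : ℝ) + 2 * s))
        ∂(surf m n) ∂(surf m n)
    + ENNReal.ofReal (aConst N s) * ∫⁻ z, ENNReal.ofReal (u z ^ 2) ∂(surf m n)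

/-- The norm of `H^s_g(𝕊^N)`. -/
def sphereNorm (N m n : ℕ) (s : ℝ) (u : Sph m n → ℝ) : ℝ≥0∞ :=
  sphereEnergy N m n s u ^ (1 / 2 : ℝ)

theorem sphereEnergy_congr (N m n : ℕ) (s : ℝ) {u v : Sph m n → ℝ} (h : u =ᵐ[surf m n] v) :
    sphereEnergy N m n s u = sphereEnergy N m n s v := by
  unfold sphereEnergy
  congr 2
  · refine lintegral_congr_ae ?_
    filter_upwards [h] with z hz
    refine lintegral_congr_ae ?_
    filter_upwards [h] with ζ hζ
    rw [hz, hζ]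
  · refine lintegral_congr_ae ?_
    filter_upwards [h] with z hz
    rw [hz]

theorem sphereEnergy_smul (N m n : ℕ) (s : ℝ) (c : ℝ) (u : Sph m n → ℝ) :
    sphereEnergy N m n s (fun z => c * u z)
      = ENNReal.ofReal (c ^ 2) * sphereEnergy N m n s u := by
  unfold sphereEnergy
  have h1 : ∀ z ζ : Sph m n,
      ENNReal.ofReal (|c * u z - c * u ζ| ^ 2 / dist z ζ ^ ((N : ℝ) + 2 * s))
      = ENNReal.ofReal (c ^ 2) *
        ENNReal.ofReal (|u z - u ζ| ^ 2 / dist z ζ ^ ((N : ℝ) + 2 * s)) := by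
    intro z ζ
    rw [← ENNReal.ofReal_mul (sq_nonneg c), ← mul_sub, abs_mul, mul_pow, sq_abs c, mul_div_assoc]
  have h2 : ∀ z : Sph m n, ENNReal.ofReal ((c * u z) ^ 2)
      = ENNReal.ofReal (c ^ 2) * ENNReal.ofReal (u z ^ 2) := by
    intro z
    rw [← ENNReal.ofReal_mul (sq_nonneg c), mul_pow]
  simp only [h1, h2, lintegral_const_mul' _ _ ENNReal.ofReal_ne_top]
  ring

theorem measurable_kernel {m n : ℕ} (p : ℝ) {u : Sph m n → ℝ} (hu : Measurable u) :
    Measurable (fun q : Sph m n × Sph m n =>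
      ENNReal.ofReal (|u q.1 - u q.2| ^ 2 / dist q.1 q.2 ^ p)) := by
  have h1 : Measurable (fun q : Sph m n × Sph m n => u q.1 - u q.2) :=
    (hu.comp measurable_fst).sub (hu.comp measurable_snd)
  have h2 : Measurable (fun q : Sph m n × Sph m n => dist q.1 q.2) := continuous_dist.measurable
  have h3 : Measurable (fun q : Sph m n × Sph m n => |u q.1 - u q.2| ^ 2) := by
    simpa only [sq_abs] using h1.pow_const 2
  exact (h3.div (h2.pow_const p)).ennreal_ofReal

theorem ofReal_sq_add_le (a b d : ℝ) (hd : 0 ≤ d) :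
    ENNReal.ofReal (|a + b| ^ 2 / d)
      ≤ 2 * ENNReal.ofReal (|a| ^ 2 / d) + 2 * ENNReal.ofReal (|b| ^ 2 / d) := by
  rw [show (2 : ℝ≥0∞) = ENNReal.ofReal 2 by simp, ← ENNReal.ofReal_mul (by norm_num),
    ← ENNReal.ofReal_mul (by norm_num), ← ENNReal.ofReal_add (by positivity) (by positivity)]
  refine ENNReal.ofReal_le_ofReal ?_
  rw [← mul_div_assoc, ← mul_div_assoc, ← add_div]
  refine div_le_div_of_nonneg_right ?_ hd
  simp only [sq_abs]
  nlinarith [sq_nonneg (a - b)]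

theorem sphereEnergy_add_le (N m n : ℕ) (s : ℝ) {u v : Sph m n → ℝ}
    (hu : Measurable u) :
    sphereEnergy N m n s (fun z => u z + v z)
      ≤ 2 * sphereEnergy N m n s u + 2 * sphereEnergy N m n s v := by
  have hk : ∀ {w : Sph m n → ℝ}, Measurable w → ∀ z, Measurable (fun ζ =>
      2 * ENNReal.ofReal (|w z - w ζ| ^ 2 / dist z ζ ^ ((N : ℝ) + 2 * s))) := fun hw z =>
    ((measurable_kernel _ hw).comp measurable_prodMk_left).const_mul 2
  have h1 : ∫⁻ z, ∫⁻ ζ, ENNReal.ofReal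
        (|(u z + v z) - (u ζ + v ζ)| ^ 2 / dist z ζ ^ ((N : ℝ) + 2 * s)) ∂(surf m n) ∂(surf m n)
      ≤ 2 * (∫⁻ z, ∫⁻ ζ, ENNReal.ofReal
          (|u z - u ζ| ^ 2 / dist z ζ ^ ((N : ℝ) + 2 * s)) ∂(surf m n) ∂(surf m n))
        + 2 * (∫⁻ z, ∫⁻ ζ, ENNReal.ofReal
          (|v z - v ζ| ^ 2 / dist z ζ ^ ((N : ℝ) + 2 * s)) ∂(surf m n) ∂(surf m n)) := by
    rw [← lintegral_const_mul' _ _ (by simp), ← lintegral_const_mul' _ _ (by simp),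
      ← lintegral_add_left ((measurable_kernel _ hu).lintegral_prod_right'.const_mul 2)]
    refine lintegral_mono fun z => ?_
    rw [← lintegral_const_mul' _ _ (by simp), ← lintegral_const_mul' _ _ (by simp),
      ← lintegral_add_left (hk hu z)]
    refine lintegral_mono fun ζ => ?_
    have := ofReal_sq_add_le (u z - u ζ) (v z - v ζ) (dist z ζ ^ ((N : ℝ) + 2 * s))
      (by positivity)
    rwa [show u z - u ζ + (v z - v ζ) = (u z + v z) - (u ζ + v ζ) by ring] at this
  have h2 : ∫⁻ z, ENNReal.ofReal ((u z + v z) ^ 2) ∂(surf m n)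
      ≤ 2 * ∫⁻ z, ENNReal.ofReal (u z ^ 2) ∂(surf m n)
        + 2 * ∫⁻ z, ENNReal.ofReal (v z ^ 2) ∂(surf m n) := by
    rw [← lintegral_const_mul' _ _ (by simp), ← lintegral_const_mul' _ _ (by simp),
      ← lintegral_add_left ((hu.pow_const 2).ennreal_ofReal.const_mul 2)]
    refine lintegral_mono fun z => ?_
    have := ofReal_sq_add_le (u z) (v z) 1 zero_le_one
    simpa only [sq_abs, div_one] using this
  unfold sphereEnergy
  refine (add_le_add (mul_le_mul_right h1 _) (mul_le_mul_right h2 _)).trans (le_of_eq ?_)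
  ring

theorem tendsto_rpow_half_iff {E : ℕ → ℝ≥0∞} :
    Tendsto (fun k => E k ^ (1 / 2 : ℝ)) atTop (𝓝 0) ↔ Tendsto E atTop (𝓝 0) := by
  constructor
  · intro h
    have h2 := (ENNReal.continuous_rpow_const (y := 2)).tendsto (0 : ℝ≥0∞) |>.comp h
    simp only [Function.comp_def, ← ENNReal.rpow_mul] at h2
    norm_num at h2
    exact h2
  · intro h
    have h2 := (ENNReal.continuous_rpow_const (y := 1 / 2)).tendsto (0 : ℝ≥0∞) |>.comp h
    simpa [Function.comp_def] using h2

/-- `H^s_g(𝕊^N)`: the closure of `C^∞(𝕊^N)` in `L²(𝕊^N)` with respect to the norm `sphereNorm`. -/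
def Hs (N m n : ℕ) [Fact (m + n = N + 1)] (s : ℝ) : Submodule ℝ (Lp ℝ 2 (surf m n)) where
  carrier := {u | ∃ v : ℕ → Sph m n → ℝ, (∀ k, ContMDiff (𝓡 N) 𝓘(ℝ, ℝ) ∞ (v k)) ∧
    Tendsto (fun k => sphereNorm N m n s (fun z => u z - v k z)) atTop (𝓝 0)}
  zero_mem' := by
    refine ⟨fun _ _ => 0, fun _ => contMDiff_const, tendsto_rpow_half_iff.2 ?_⟩
    have h : sphereEnergy N m n s (fun z => (0 : Lp ℝ 2 (surf m n)) z - 0) = 0 := by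
      rw [sphereEnergy_congr (v := fun _ => 0 * 0), sphereEnergy_smul]
      · simp
      · filter_upwards [Lp.coeFn_zero ℝ 2 (surf m n)] with z hz
        rw [hz, Pi.zero_apply, sub_zero, mul_zero]
    simp only [h, tendsto_const_nhds]
  add_mem' {u v} := by
    rintro ⟨a, ha, hua⟩ ⟨b, hb, hvb⟩
    refine ⟨fun k z => a k z + b k z, fun k => (ha k).add (hb k), ?_⟩
    unfold sphereNorm at hua hvb ⊢
    rw [tendsto_rpow_half_iff] at hua hvb ⊢
    have hlim := (ENNReal.Tendsto.const_mul (a := 2) hua (by simp)).add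
      (ENNReal.Tendsto.const_mul (a := 2) hvb (by simp))
    simp only [mul_zero, add_zero] at hlim
    refine tendsto_of_tendsto_of_tendsto_of_le_of_le tendsto_const_nhds hlim
      (fun _ => zero_le) fun k => ?_
    refine (sphereEnergy_congr (v := fun z => (u z - a k z) + (v z - b k z)) N m n s ?_).trans_le
      (sphereEnergy_add_le N m n s
        ((Lp.stronglyMeasurable u).measurable.sub (ha k).continuous.measurable))
    filter_upwards [Lp.coeFn_add u v] with z hz
    rw [hz, Pi.add_apply]
    ring
  smul_mem' c u := by
    rintro ⟨a, ha, hua⟩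
    refine ⟨fun k z => c * a k z, fun k => contMDiff_const.mul (ha k), ?_⟩
    unfold sphereNorm at hua ⊢
    rw [tendsto_rpow_half_iff] at hua ⊢
    have hlim := ENNReal.Tendsto.const_mul (a := ENNReal.ofReal (c ^ 2)) hua (by simp)
    rw [mul_zero] at hlim
    refine hlim.congr fun k => ?_
    rw [← sphereEnergy_smul]
    refine sphereEnergy_congr N m n s ?_
    filter_upwards [Lp.coeFn_smul c u] with z hz
    rw [hz, Pi.smul_apply, smul_eq_mul]
    ring

/-- `H^s_g(𝕊^N)^G`. -/
def HsG (N m n : ℕ) [Fact (m + n = N + 1)] (s : ℝ) : Submodule ℝ (Lp ℝ 2 (surf m n)) :=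
  Hs N m n s ⊓ L2G m n

/-! ### Jacobi polynomials -/

/-- The monic Jacobi polynomial `P_i^{(α,β)}`, written in powers of `t - 1`. -/
def jacobi (α β : ℝ) (i : ℕ) : ℝ[X] :=
  ∑ k ∈ Finset.range (i + 1),
    Polynomial.C ((i.choose k : ℝ) * 2 ^ (i - k) *
      ∏ j ∈ Finset.Ico k i, ((α + j + 1) / (α + β + i + j + 1))) * (Polynomial.X - 1) ^ k

/-- The Jacobi equation
`(1 - t²) x'' + [β - α - (α + β + 2) t] x' + i (i + α + β + 1) x = 0`. -/
def JacobiEquation (α β : ℝ) (i : ℕ) (P : ℝ[X]) : Prop :=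
  ∀ t : ℝ, (1 - t ^ 2) * P.derivative.derivative.eval t
    + (β - α - (α + β + 2) * t) * P.derivative.eval t
    + i * (i + α + β + 1) * P.eval t = 0

theorem jacobi_aux (α β : ℝ) (hα : -1 < α) (hβ : -1 < β) (i : ℕ) (a : ℕ → ℝ)
    (ha : ∀ k, a k = if k < i + 1 then (i.choose k : ℝ) * 2 ^ (i - k) *
      ∏ j ∈ Finset.Ico k i, ((α + j + 1) / (α + β + i + j + 1)) else 0) (k : ℕ) :
    ((i : ℝ) - k) * (i + k + α + β + 1) * a k = 2 * (k + 1) * (k + 1 + α) * a (k + 1) := by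
  rcases lt_trichotomy k i with h | h | h
  · have hi : (1 : ℝ) ≤ i := by exact_mod_cast (by omega : 1 ≤ i)
    have hk : (0 : ℝ) ≤ k := k.cast_nonneg
    have hc : (i.choose (k + 1) : ℝ) * (k + 1) = i.choose k * (i - k) := by
      have := Nat.choose_succ_right_eq i k
      have h2 : ((i - k : ℕ) : ℝ) = i - k := Nat.cast_sub h.le
      rw [← h2]; exact_mod_cast this
    have hd : α + β + i + k + 1 ≠ 0 := by linarith
    rw [ha k, ha (k + 1), if_pos (by omega), if_pos (by omega),
      Finset.prod_eq_prod_Ico_succ_bot h, show i - k = (i - (k + 1)) + 1 by omega, pow_succ]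
    set Q := ∏ j ∈ Finset.Ico (k + 1) i, ((α + j + 1) / (α + β + i + j + 1))
    have : ((i : ℝ) + k + α + β + 1) * ((α + k + 1) / (α + β + i + k + 1)) = α + k + 1 := by
      field_simp
      ring
    linear_combination (2 * 2 ^ (i - (k + 1)) * Q * ((i : ℝ) - k) * i.choose k) * this
      - 2 * 2 ^ (i - (k + 1)) * Q * (k + 1 + α) * hc
  · rw [ha (k + 1), if_neg (by omega), h]; ring
  · rw [ha k, ha (k + 1), if_neg (by omega), if_neg (by omega)]; ring

theorem jacobi_monic (α β : ℝ) (i : ℕ) : (jacobi α β i).Monic ∧ (jacobi α β i).natDegree = i := by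
  have hm : ((Polynomial.X - 1 : ℝ[X]) ^ i).Monic := by
    simpa using (Polynomial.monic_X_sub_C (1 : ℝ)).pow i
  have hdeg : ∀ k : ℕ, ((Polynomial.X - 1 : ℝ[X]) ^ k).degree = k := fun k => by
    have h := Polynomial.degree_pow (Polynomial.X - Polynomial.C (1 : ℝ)) k
    rw [Polynomial.degree_X_sub_C] at h
    simpa using h
  have hlt : (∑ k ∈ Finset.range i, Polynomial.C ((i.choose k : ℝ) * 2 ^ (i - k) *
      ∏ j ∈ Finset.Ico k i, ((α + j + 1) / (α + β + i + j + 1))) *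
        (Polynomial.X - 1 : ℝ[X]) ^ k).degree < ((Polynomial.X - 1 : ℝ[X]) ^ i).degree := by
    rw [hdeg]
    refine (Polynomial.degree_sum_le _ _).trans_lt ?_
    refine (Finset.sup_lt_iff (WithBot.bot_lt_coe i)).2 fun k hk => ?_
    refine (Polynomial.degree_mul_le _ _).trans_lt ?_
    rw [hdeg]
    refine (add_le_add_left Polynomial.degree_C_le _).trans_lt ?_
    rw [zero_add]
    exact WithBot.coe_lt_coe.2 (Finset.mem_range.1 hk)
  have hj : jacobi α β i = (∑ k ∈ Finset.range i, Polynomial.C ((i.choose k : ℝ) * 2 ^ (i - k) *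
      ∏ j ∈ Finset.Ico k i, ((α + j + 1) / (α + β + i + j + 1))) *
        (Polynomial.X - 1 : ℝ[X]) ^ k) + (Polynomial.X - 1 : ℝ[X]) ^ i := by
    rw [jacobi, Finset.sum_range_succ]
    simp
  refine ⟨hj ▸ hm.add_of_right hlt, ?_⟩
  apply Polynomial.natDegree_eq_of_degree_eq_some
  rw [hj, Polynomial.degree_add_eq_right_of_degree_lt hlt, hdeg]

theorem jacobi_equation (α β : ℝ) (hα : -1 < α) (hβ : -1 < β) (i : ℕ) :
    JacobiEquation α β i (jacobi α β i) := by
  obtain ⟨a, ha⟩ : ∃ a : ℕ → ℝ, ∀ k, a k = if k < i + 1 then (i.choose k : ℝ) * 2 ^ (i - k) *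
      ∏ j ∈ Finset.Ico k i, ((α + j + 1) / (α + β + i + j + 1)) else 0 := ⟨_, fun _ => rfl⟩
  have key := jacobi_aux α β hα hβ i a ha
  obtain ⟨Q, hQ⟩ : ∃ Q : ℝ[X], Q = ∑ k ∈ Finset.range (i + 1), Polynomial.C (a k) *
      Polynomial.X ^ k := ⟨_, rfl⟩
  have hcoef : ∀ k, Q.coeff k = a k := fun k => by
    rw [hQ]
    simp only [Polynomial.finsetSum_coeff, Polynomial.coeff_C_mul_X_pow, Finset.sum_ite_eq,
      Finset.mem_range]
    rw [ite_eq_left_iff]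
    intro h
    rw [ha, if_neg h]
  have hj : jacobi α β i = Q.comp (Polynomial.X - Polynomial.C 1) := by
    rw [hQ, jacobi, Polynomial.sum_comp]
    refine Finset.sum_congr rfl fun k hk => ?_
    rw [ha k, if_pos (Finset.mem_range.1 hk)]
    simp
  have hd : ∀ R : ℝ[X], (R.comp (Polynomial.X - Polynomial.C 1)).derivative
      = R.derivative.comp (Polynomial.X - Polynomial.C 1) := fun R => by
    simp [Polynomial.derivative_comp]
  have hode : -(Polynomial.X * (Polynomial.X * Q.derivative.derivative))
      - 2 * (Polynomial.X * Q.derivative.derivative)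
      - Polynomial.C (2 * α + 2) * Q.derivative
      - Polynomial.C (α + β + 2) * (Polynomial.X * Q.derivative)
      + Polynomial.C (i * (i + α + β + 1)) * Q = 0 := by
    rw [show (2 : ℝ[X]) = Polynomial.C 2 from (map_ofNat Polynomial.C 2).symm]
    ext k
    simp only [Polynomial.coeff_add, Polynomial.coeff_sub, Polynomial.coeff_neg,
      Polynomial.coeff_C_mul, Polynomial.coeff_zero]
    rcases k with _ | _ | k
    · have := key 0
      simp [Polynomial.coeff_derivative, hcoef] at this ⊢
      linear_combination this
    · have := key 1
      simp [Polynomial.coeff_derivative, hcoef, Polynomial.coeff_X_mul] at this ⊢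
      linear_combination this
    · have := key (k + 2)
      simp [Polynomial.coeff_derivative, hcoef, Polynomial.coeff_X_mul] at this ⊢
      linear_combination this
  intro t
  rw [hj, hd, hd]
  have := congrArg (Polynomial.eval (t - 1)) hode
  simp only [Polynomial.eval_add, Polynomial.eval_sub, Polynomial.eval_neg, Polynomial.eval_mul,
    Polynomial.eval_X, Polynomial.eval_C, Polynomial.eval_ofNat, Polynomial.eval_zero,
    Polynomial.eval_comp] at this ⊢
  linear_combination this

theorem natDegree_of_jacobiEquation {α β : ℝ} (hα : -1 < α) (hβ : -1 < β) {i : ℕ} {P : ℝ[X]}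
    (hP : JacobiEquation α β i P) (h0 : P ≠ 0) : P.natDegree = i := by
  have hode : P.derivative.derivative - Polynomial.X * (Polynomial.X * P.derivative.derivative)
      + Polynomial.C (β - α) * P.derivative
      - Polynomial.C (α + β + 2) * (Polynomial.X * P.derivative)
      + Polynomial.C (i * (i + α + β + 1)) * P = 0 := by
    refine Polynomial.funext fun t => ?_
    have := hP t
    simp only [Polynomial.eval_add, Polynomial.eval_sub, Polynomial.eval_mul, Polynomial.eval_X,
      Polynomial.eval_C, Polynomial.eval_zero]
    linear_combination this
  obtain ⟨d, hd⟩ : ∃ d, d = P.natDegree := ⟨_, rfl⟩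
  have hlead : P.coeff d ≠ 0 := by rw [hd]; simpa using h0
  have h1 : P.coeff (d + 1) = 0 := Polynomial.coeff_eq_zero_of_natDegree_lt (by omega)
  have h2 : P.coeff (d + 2) = 0 := Polynomial.coeff_eq_zero_of_natDegree_lt (by omega)
  have hc := congrArg (fun R => Polynomial.coeff R d) hode
  simp only [Polynomial.coeff_add, Polynomial.coeff_sub, Polynomial.coeff_C_mul,
    Polynomial.coeff_zero] at hc
  have hmul : ((i : ℝ) - d) * (i + d + α + β + 1) * P.coeff d = 0 := by
    rcases d with _ | _ | d
    · simp only [Polynomial.coeff_derivative, Polynomial.coeff_X_mul_zero, zero_add, h1, h2] at hc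
      push_cast at hc ⊢
      linear_combination hc
    · simp only [Polynomial.coeff_derivative, Polynomial.coeff_X_mul, Polynomial.coeff_X_mul_zero,
        zero_add, Nat.reduceAdd] at hc h1 h2 ⊢
      push_cast at hc ⊢
      linear_combination hc - (6 : ℝ) * h2 - 2 * (β - α) * h1
    · simp only [Polynomial.coeff_derivative, Polynomial.coeff_X_mul, h1, h2] at hc
      push_cast at hc h1 h2 ⊢
      simp only [add_assoc] at hc h1 h2 ⊢
      linear_combination hc
  rw [← hd]
  by_contra hne
  have hid : (1 : ℝ) ≤ i + d := by exact_mod_cast (by omega : 1 ≤ i + d)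
  have hne' : (i : ℝ) - d ≠ 0 := sub_ne_zero.2 (fun h => hne (by exact_mod_cast h.symm))
  exact mul_ne_zero (mul_ne_zero hne' (by linarith)) hlead hmul

/-- `jacobi α β i` is the unique monic polynomial that solves the Jacobi equation. -/
theorem eq_jacobi_iff {α β : ℝ} (hα : -1 < α) (hβ : -1 < β) (i : ℕ) (P : ℝ[X]) :
    P = jacobi α β i ↔ P.Monic ∧ JacobiEquation α β i P := by
  obtain ⟨hm, hdeg⟩ := jacobi_monic α β i
  have hj := jacobi_equation α β hα hβ i
  constructor
  · rintro rfl
    exact ⟨hm, hj⟩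
  · rintro ⟨hPm, hP⟩
    by_contra hne
    have hPd := natDegree_of_jacobiEquation hα hβ hP hPm.ne_zero
    have hD : JacobiEquation α β i (P - jacobi α β i) := fun t => by
      have h1 := hP t
      have h2 := hj t
      simp only [Polynomial.derivative_sub, Polynomial.eval_sub]
      linear_combination h1 - h2
    have hDd := natDegree_of_jacobiEquation hα hβ hD (sub_ne_zero.2 hne)
    have hlt : (P - jacobi α β i).degree < P.degree := Polynomial.degree_sub_lt_left
      (by rw [Polynomial.degree_eq_natDegree hPm.ne_zero,
            Polynomial.degree_eq_natDegree hm.ne_zero, hPd, hdeg]) hPm.ne_zero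
      (by rw [hPm.leadingCoeff, hm.leadingCoeff])
    rw [Polynomial.degree_eq_natDegree (sub_ne_zero.2 hne),
      Polynomial.degree_eq_natDegree hPm.ne_zero, hPd, hDd] at hlt
    exact lt_irrefl _ hlt

/-! ### Weighted spaces on `[-1, 1]` -/

/-- `α = n / 2 - 1`, the exponent at `t = 1`, that is at the orbit `y = 0`. -/
def alpha (n : ℕ) : ℝ := n / 2 - 1

/-- `β = m / 2 - 1`, the exponent at `t = -1`, that is at the orbit `x = 0`. -/
def beta (m : ℕ) : ℝ := m / 2 - 1

/-- `|𝕊^{k-1}| = 2 π^{k/2} / Γ(k/2)`. -/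
def sphereArea (k : ℕ) : ℝ := 2 * Real.pi ^ ((k : ℝ) / 2) / Real.Gamma (k / 2)

/-- The weight `h(t) = C (1 - t)^α (1 + t)^β`, `C = |𝕊^{m-1}| |𝕊^{n-1}| / 2^{(m+n)/2}`. -/
def weight (m n : ℕ) (t : ℝ) : ℝ :=
  sphereArea m * sphereArea n / 2 ^ (((m : ℝ) + n) / 2) * (1 - t) ^ alpha n * (1 + t) ^ beta m

/-- The measure `h(t) dt` on `[-1, 1]`; the space `L²_h([-1, 1])` is `Lp ℝ 2 (hMeasure m n)`. -/
def hMeasure (m n : ℕ) : Measure ℝ :=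
  (volume.restrict (Icc (-1) 1)).withDensity fun t => ENNReal.ofReal (weight m n t)

/-- The `L²_h`-normalized Jacobi polynomial `p_i = P_i / ‖P_i‖_h`. -/
def pJac (m n i : ℕ) (t : ℝ) : ℝ :=
  (jacobi (alpha n) (beta m) i).eval t /
    √(∫ x, (jacobi (alpha n) (beta m) i).eval x ^ 2 ∂(hMeasure m n))

/-- `⟨w, p_i⟩_h = ∫_{-1}^1 w p_i h dt`. -/
def hCoeff (m n : ℕ) (w : ℝ → ℝ) (i : ℕ) : ℝ := ∫ t, w t * pJac m n i t ∂(hMeasure m n)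

/-- The eigenvalues `λ_i = 2 i (N - 1 + 2 i)`. -/
def eigenval (N i : ℕ) : ℝ := 2 * i * (N - 1 + 2 * i)

/-- The Fourier symbol `φ_{N,s}` of the conformal fractional Laplacian on `𝕊^N`. -/
def symbol (N : ℕ) (s lam : ℝ) : ℝ :=
  Real.Gamma (1 / 2 + s + √(lam + (((N : ℝ) - 1) / 2) ^ 2)) /
    Real.Gamma (1 / 2 - s + √(lam + (((N : ℝ) - 1) / 2) ^ 2))

/-- The square of the `H^s_h` norm of a function on `[-1, 1]`, as an extended real. -/
def hEnergy (N m n : ℕ) (s : ℝ) (w : ℝ → ℝ) : ℝ≥0∞ :=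
  ∑' i : ℕ, ENNReal.ofReal (hCoeff m n w i ^ 2 * symbol N s (eigenval N i))

/-- The norm of `H^s_h([-1, 1])`. -/
def hNorm (N m n : ℕ) (s : ℝ) (w : ℝ → ℝ) : ℝ≥0∞ := hEnergy N m n s w ^ (1 / 2 : ℝ)

theorem ae_mem_Icc (m n : ℕ) : ∀ᵐ t ∂(hMeasure m n), t ∈ Icc (-1 : ℝ) 1 :=
  (withDensity_absolutelyContinuous _ _).ae_le (ae_restrict_mem measurableSet_Icc)

theorem continuous_weight {m n : ℕ} (hm : 2 ≤ m) (hn : 2 ≤ n) : Continuous (weight m n) := by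
  have hm' : (2 : ℝ) ≤ m := by exact_mod_cast hm
  have hn' : (2 : ℝ) ≤ n := by exact_mod_cast hn
  have ha : 0 ≤ alpha n := by unfold alpha; linarith
  have hb : 0 ≤ beta m := by unfold beta; linarith
  exact (continuous_const.mul ((Real.continuous_rpow_const ha).comp
    (continuous_const.sub continuous_id))).mul ((Real.continuous_rpow_const hb).comp
    (continuous_const.add continuous_id))

theorem isFiniteMeasure_hMeasure {m n : ℕ} (hm : 2 ≤ m) (hn : 2 ≤ n) :
    IsFiniteMeasure (hMeasure m n) :=
  isFiniteMeasure_withDensity_ofReal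
    ((continuous_weight hm hn).continuousOn.integrableOn_compact isCompact_Icc).2

theorem memLp_of_continuousOn {m n : ℕ} (hm : 2 ≤ m) (hn : 2 ≤ n) {g : ℝ → ℝ}
    (hg : ContinuousOn g (Icc (-1) 1)) : MemLp g 2 (hMeasure m n) := by
  have := isFiniteMeasure_hMeasure hm hn
  obtain ⟨K, hK⟩ := isCompact_Icc.exists_bound_of_continuousOn hg
  refine MemLp.of_bound ((hg.aestronglyMeasurable measurableSet_Icc).mono_ac
    (withDensity_absolutelyContinuous _ _)) K ?_
  filter_upwards [ae_mem_Icc m n] with t ht using hK t ht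

theorem hCoeff_add {m n : ℕ} (hm : 2 ≤ m) (hn : 2 ≤ n) {w v : ℝ → ℝ}
    (hw : MemLp w 2 (hMeasure m n)) (hv : MemLp v 2 (hMeasure m n)) (i : ℕ) :
    hCoeff m n (fun t => w t + v t) i = hCoeff m n w i + hCoeff m n v i := by
  have hp : MemLp (pJac m n i) 2 (hMeasure m n) :=
    memLp_of_continuousOn hm hn ((Polynomial.continuous _).div_const _).continuousOn
  simp only [hCoeff, add_mul]
  exact integral_add (hw.integrable_mul hp) (hv.integrable_mul hp)

theorem hEnergy_congr (N m n : ℕ) (s : ℝ) {w v : ℝ → ℝ} (h : w =ᵐ[hMeasure m n] v) :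
    hEnergy N m n s w = hEnergy N m n s v := by
  have hc : hCoeff m n w = hCoeff m n v := by
    ext i
    refine integral_congr_ae ?_
    filter_upwards [h] with t ht
    rw [ht]
  simp only [hEnergy, hc]

theorem hEnergy_smul (N m n : ℕ) (s c : ℝ) (w : ℝ → ℝ) :
    hEnergy N m n s (fun t => c * w t) = ENNReal.ofReal (c ^ 2) * hEnergy N m n s w := by
  have hc : ∀ i, hCoeff m n (fun t => c * w t) i = c * hCoeff m n w i := fun i => by
    simp only [hCoeff, mul_assoc, integral_const_mul]
  simp only [hEnergy, hc, ← ENNReal.tsum_mul_left]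
  refine tsum_congr fun i => ?_
  rw [← ENNReal.ofReal_mul (sq_nonneg c), mul_pow, mul_assoc]

theorem hEnergy_add_le (N : ℕ) {m n : ℕ} (hm : 2 ≤ m) (hn : 2 ≤ n) (s : ℝ) {w v : ℝ → ℝ}
    (hw : MemLp w 2 (hMeasure m n)) (hv : MemLp v 2 (hMeasure m n)) :
    hEnergy N m n s (fun t => w t + v t) ≤ 2 * hEnergy N m n s w + 2 * hEnergy N m n s v := by
  simp only [hEnergy, hCoeff_add hm hn hw hv, ← ENNReal.tsum_mul_left, ← ENNReal.tsum_add]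
  refine ENNReal.tsum_le_tsum fun i => ?_
  have h := ofReal_sq_add_le (hCoeff m n w i) (hCoeff m n v i) 1 zero_le_one
  simp only [sq_abs, div_one] at h
  simp only [ENNReal.ofReal_mul (sq_nonneg _), ← mul_assoc, ← add_mul]
  exact mul_le_mul_left h _

/-- `H^s_h([-1, 1])`: the closure of `C^∞([-1, 1])` in `L²_h([-1, 1])` with respect to the norm
`hNorm`. -/
def Hsh (N : ℕ) {m n : ℕ} (hm : 2 ≤ m) (hn : 2 ≤ n) (s : ℝ) :
    Submodule ℝ (Lp ℝ 2 (hMeasure m n)) where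
  carrier := {w | ∃ v : ℕ → ℝ → ℝ, (∀ k, ContDiffOn ℝ ∞ (v k) (Icc (-1) 1)) ∧
    Tendsto (fun k => hNorm N m n s (fun t => w t - v k t)) atTop (𝓝 0)}
  zero_mem' := by
    refine ⟨fun _ _ => 0, fun _ => contDiffOn_const, tendsto_rpow_half_iff.2 ?_⟩
    have h : hEnergy N m n s (fun t => (0 : Lp ℝ 2 (hMeasure m n)) t - 0) = 0 := by
      rw [hEnergy_congr (v := fun _ => 0 * 0), hEnergy_smul]
      · simp
      · filter_upwards [Lp.coeFn_zero ℝ 2 (hMeasure m n)] with z hz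
        rw [hz, Pi.zero_apply, sub_zero, mul_zero]
    simp only [h, tendsto_const_nhds]
  add_mem' {u v} := by
    rintro ⟨a, ha, hua⟩ ⟨b, hb, hvb⟩
    refine ⟨fun k z => a k z + b k z, fun k => (ha k).add (hb k), ?_⟩
    unfold hNorm at hua hvb ⊢
    rw [tendsto_rpow_half_iff] at hua hvb ⊢
    have hlim := (ENNReal.Tendsto.const_mul (a := 2) hua (by simp)).add
      (ENNReal.Tendsto.const_mul (a := 2) hvb (by simp))
    simp only [mul_zero, add_zero] at hlim
    refine tendsto_of_tendsto_of_tendsto_of_le_of_le tendsto_const_nhds hlim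
      (fun _ => zero_le) fun k => ?_
    refine (hEnergy_congr (v := fun z => (u z - a k z) + (v z - b k z)) N m n s ?_).trans_le
      (hEnergy_add_le N hm hn s
        ((Lp.memLp u).sub (memLp_of_continuousOn hm hn (ha k).continuousOn))
        ((Lp.memLp v).sub (memLp_of_continuousOn hm hn (hb k).continuousOn)))
    filter_upwards [Lp.coeFn_add u v] with z hz
    rw [hz, Pi.add_apply]
    ring
  smul_mem' c u := by
    rintro ⟨a, ha, hua⟩
    refine ⟨fun k z => c * a k z, fun k => contDiffOn_const.mul (ha k), ?_⟩
    unfold hNorm at hua ⊢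
    rw [tendsto_rpow_half_iff] at hua ⊢
    have hlim := ENNReal.Tendsto.const_mul (a := ENNReal.ofReal (c ^ 2)) hua (by simp)
    rw [mul_zero] at hlim
    refine hlim.congr fun k => ?_
    rw [← hEnergy_smul]
    refine hEnergy_congr N m n s ?_
    filter_upwards [Lp.coeFn_smul c u] with z hz
    rw [hz, Pi.smul_apply, smul_eq_mul]
    ring

end SymSphere

end

/-! Everything rests on two facts about `f`: its level sets are exactly the orbits of `O(m) × O(n)`,
and it pushes the surface measure forward to `h dt` (`measurePreserving_f`, by polar coordinates in
both factors). Composition with `f` is therefore an isometry of `L²_h` into the invariant functions.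

For surjectivity, let an invariant `v` be orthogonal to all continuous functions of `f`. The
polynomial `T(x) = ∫ ⟨x, z⟩^d v(z) dz` is invariant, hence on the sphere a function of `f`, so `∫ T
v = 0`. Expanding `⟨x, z⟩^d` in coordinates turns this integral into the sum of the squares of all
moments of `v` of degree `d`. All moments vanish, and Stone–Weierstrass gives `v = 0`
(`eq_zero_of_mem_L2G_of_orthogonal`). No average over the group is needed.

For the Sobolev norms the point is that the two energies of `w ∘ f` and `w` agree as extended reals
(`sphereEnergy_comp_f`). A bounded zonal kernel `k(⟨z, ζ⟩)` maps polynomials in `f` to polynomials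
in `f` without raising the degree (`exists_polynomial_zonal`). Being also symmetric, it has the
orthogonal polynomials of `h`, that is the Jacobi polynomials, as eigenfunctions. Hence the double
integral of `k(⟨z, ζ⟩) |w(f z) - w(f ζ)|²` is diagonal in the Jacobi basis, with entries twice the
spectral gaps `zonalGap` (`lintegral_kernel_eq_tsum`). Monotone convergence along truncations
extends this to the singular kernel `|z - ζ|^{-N-2s}` (`lintegral_rieszKernel_eq_tsum`).

The gaps of that kernel are computed at a pole, where `f = 1`. There the Jacobi polynomial is a
terminating hypergeometric sum in `(1 - f)/2 = |y|²`, the moments of the kernel against `|y|^{2k}`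
are Beta integrals, and the resulting sum is of Saalschütz type. It evaluates to the Gamma quotient
`symbol` (`zonalGap_rieszKernel`). Spherical harmonics do not enter.

Finally, on invariant functions both closures consist of the functions of finite energy
(`mem_Hsh_iff`, `mem_Hs_iff`). Smooth functions are Lipschitz and so have finite energy; conversely
the partial sums of the Jacobi expansion, smooth on the interval and on the sphere, converge in
energy. -/

noncomputable section

namespace SymSphere

/-! ### Polar coordinates in a normed space, the half plane and the quadrant -/

section Polar

/-- Integration in polar coordinates. -/
theorem lintegral_polar {E : Type*} [NormedAddCommGroup E] [NormedSpace ℝ E] [Nontrivial E]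
    [FiniteDimensional ℝ E] [MeasurableSpace E] [BorelSpace E] (μ : Measure E) [μ.IsAddHaarMeasure]
    {F : E → ℝ≥0∞} (hF : Measurable F) :
    ∫⁻ x, F x ∂μ = ∫⁻ w, ∫⁻ r in Ioi (0 : ℝ),
      ENNReal.ofReal (r ^ (Module.finrank ℝ E - 1)) * F (r • (w : E)) ∂volume ∂μ.toSphere := by
  have hmp := μ.measurePreserving_homeomorphUnitSphereProd
  have h1 : ∫⁻ x, F x ∂μ = ∫⁻ x : ({(0)}ᶜ : Set E), F x.1 ∂(μ.comap (↑)) := by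
    rw [lintegral_subtype_comap (measurableSet_singleton _).compl, restrict_compl_singleton]
  have h2 : ∀ x : ({(0)}ᶜ : Set E), F x.1 = (fun p : Metric.sphere (0 : E) 1 × Ioi (0 : ℝ) =>
      F (p.2.1 • p.1.1)) (homeomorphUnitSphereProd E x) := by
    intro x
    have hx : ‖x.1‖ ≠ 0 := norm_ne_zero_iff.2 x.2
    simp [smul_smul, hx]
  have hm : Measurable (fun p : Metric.sphere (0 : E) 1 × Ioi (0 : ℝ) => F (p.2.1 • p.1.1)) :=
    hF.comp (by fun_prop)
  rw [h1]
  simp_rw [h2]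
  rw [hmp.lintegral_comp hm, lintegral_prod _ hm.aemeasurable]
  refine lintegral_congr fun w => ?_
  have hm' : Measurable (fun r : ℝ => F (r • w.1)) := hF.comp (by fun_prop)
  rw [Measure.volumeIoiPow]
  refine (lintegral_withDensity_eq_lintegral_mul _ (by fun_prop)
    (hm'.comp measurable_subtype_coe)).trans ?_
  exact lintegral_subtype_comap measurableSet_Ioi
    (fun r : ℝ => ENNReal.ofReal (r ^ (Module.finrank ℝ E - 1)) * F (r • (w : E)))

/-- Polar coordinates on the upper half plane. -/
theorem lintegral_half_plane {H : ℝ → ℝ → ℝ≥0∞} (hH : Measurable (Function.uncurry H)) :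
    ∫⁻ x, ∫⁻ ρ in Ioi (0 : ℝ), H x ρ = ∫⁻ ψ in Ioo 0 Real.pi, ∫⁻ R in Ioi (0 : ℝ),
      ENNReal.ofReal R * H (R * Real.cos ψ) (R * Real.sin ψ) := by
  have hS : MeasurableSet {p : ℝ × ℝ | 0 < p.2} := measurableSet_lt measurable_const measurable_snd
  have h0 : ∫⁻ x, ∫⁻ ρ in Ioi (0 : ℝ), H x ρ
      = ∫⁻ p : ℝ × ℝ, {p : ℝ × ℝ | 0 < p.2}.indicator (Function.uncurry H) p := by
    rw [Measure.volume_eq_prod, lintegral_prod _ (hH.indicator hS).aemeasurable]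
    refine lintegral_congr fun x => ?_
    rw [← lintegral_indicator measurableSet_Ioi]
    rfl
  rw [h0, ← lintegral_comp_polarCoord_symm]
  have hT : MeasurableSet polarCoord.target := polarCoord.open_target.measurableSet
  have hpi := Real.pi_pos
  have hm : Measurable (fun p : ℝ × ℝ => ENNReal.ofReal p.1 *
      H (p.1 * Real.cos p.2) (p.1 * Real.sin p.2)) := by
    refine (by fun_prop : Measurable fun p : ℝ × ℝ => ENNReal.ofReal p.1).mul ?_
    exact hH.comp (by fun_prop : Measurable fun p : ℝ × ℝ =>
      (p.1 * Real.cos p.2, p.1 * Real.sin p.2))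
  have h1 : ∀ p ∈ polarCoord.target, ENNReal.ofReal p.1 •
      {p : ℝ × ℝ | 0 < p.2}.indicator (Function.uncurry H) (polarCoord.symm p)
      = (Ioi (0 : ℝ) ×ˢ Ioo 0 Real.pi).indicator (fun p : ℝ × ℝ => ENNReal.ofReal p.1 *
      H (p.1 * Real.cos p.2) (p.1 * Real.sin p.2)) p := by
    rintro ⟨r, ψ⟩ ⟨hr, hψ1, hψ2⟩
    simp only [mem_Ioi] at hr hψ1 hψ2
    by_cases h : 0 < ψ
    · have : 0 < Real.sin ψ := Real.sin_pos_of_pos_of_lt_pi h hψ2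
      rw [indicator_of_mem (s := Ioi (0 : ℝ) ×ˢ Ioo 0 Real.pi) (by exact ⟨hr, h, hψ2⟩),
        indicator_of_mem (by simpa using mul_pos hr this)]
      simp
    · have : Real.sin ψ ≤ 0 := Real.sin_nonpos_of_nonpos_of_neg_pi_le (not_lt.1 h) hψ1.le
      rw [indicator_of_notMem (s := Ioi (0 : ℝ) ×ˢ Ioo 0 Real.pi) (by
        rintro ⟨-, h', -⟩; exact h h'), indicator_of_notMem (by
        simpa using mul_nonpos_of_nonneg_of_nonpos hr.le this), smul_zero]
  rw [setLIntegral_congr_fun hT h1, lintegral_indicator (measurableSet_Ioi.prod measurableSet_Ioo),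
    Measure.restrict_restrict (measurableSet_Ioi.prod measurableSet_Ioo)]
  have h2 : (Ioi (0 : ℝ) ×ˢ Ioo 0 Real.pi) ∩ polarCoord.target = Ioi (0 : ℝ) ×ˢ Ioo 0 Real.pi := by
    refine inter_eq_left.2 (prod_mono subset_rfl (Ioo_subset_Ioo_left (by linarith)))
  rw [h2, Measure.volume_eq_prod, ← Measure.prod_restrict, lintegral_prod_symm _ hm.aemeasurable]

/-- Polar coordinates on the first quadrant. -/
theorem lintegral_quadrant {H : ℝ → ℝ → ℝ≥0∞} (hH : Measurable (Function.uncurry H)) :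
    ∫⁻ r in Ioi (0 : ℝ), ∫⁻ ρ in Ioi (0 : ℝ), H r ρ
      = ∫⁻ ψ in Ioo 0 (Real.pi / 2), ∫⁻ R in Ioi (0 : ℝ),
      ENNReal.ofReal R * H (R * Real.cos ψ) (R * Real.sin ψ) := by
  have hS : MeasurableSet {p : ℝ × ℝ | 0 < p.1} := measurableSet_lt measurable_const measurable_fst
  have hpi := Real.pi_pos
  have key := lintegral_half_plane (H := fun r ρ => (Ioi (0 : ℝ)).indicator (fun r => H r ρ) r)
    (hH.indicator hS)
  have h1 : ∀ r, ∫⁻ ρ in Ioi (0 : ℝ), (Ioi (0 : ℝ)).indicator (fun r => H r ρ) r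
      = (Ioi (0 : ℝ)).indicator (fun r => ∫⁻ ρ in Ioi (0 : ℝ), H r ρ) r := by
    intro r
    by_cases h : r ∈ Ioi (0 : ℝ) <;> simp [h]
  rw [← lintegral_indicator measurableSet_Ioi, ← lintegral_congr h1]
  refine key.trans ?_
  have h2 : ∀ ψ ∈ Ioo 0 Real.pi, ∫⁻ R in Ioi (0 : ℝ), ENNReal.ofReal R *
      (Ioi (0 : ℝ)).indicator (fun r => H r (R * Real.sin ψ)) (R * Real.cos ψ)
      = (Iio (Real.pi / 2)).indicator (fun ψ => ∫⁻ R in Ioi (0 : ℝ),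
      ENNReal.ofReal R * H (R * Real.cos ψ) (R * Real.sin ψ)) ψ := by
    intro ψ hψ
    by_cases h : ψ < Real.pi / 2
    · rw [indicator_of_mem (by exact h)]
      refine setLIntegral_congr_fun measurableSet_Ioi fun R hR => ?_
      have : 0 < Real.cos ψ := Real.cos_pos_of_mem_Ioo ⟨by linarith [hψ.1], h⟩
      rw [indicator_of_mem (by exact mul_pos hR this)]
    · rw [indicator_of_notMem (by exact h)]
      rw [setLIntegral_congr_fun (g := fun _ => 0) measurableSet_Ioi, lintegral_zero]
      intro R hR
      have : Real.cos ψ ≤ 0 := Real.cos_nonpos_of_pi_div_two_le_of_le (not_lt.1 h)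
        (by linarith [hψ.2])
      simp only
      rw [indicator_of_notMem, mul_zero]
      simpa using mul_nonpos_of_nonneg_of_nonpos (le_of_lt hR) this
  rw [setLIntegral_congr_fun measurableSet_Ioo h2, lintegral_indicator measurableSet_Iio,
    Measure.restrict_restrict measurableSet_Iio]
  congr 2
  ext ψ
  simp only [mem_inter_iff, mem_Iio, mem_Ioo]
  constructor
  · rintro ⟨h, h', -⟩; exact ⟨h', h⟩
  · rintro ⟨h, h'⟩; exact ⟨h', h, by linarith⟩

/-- The total mass of `r ^ d dr` on `(0, 1)`. -/
def radialMass (d : ℕ) : ℝ≥0∞ :=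
  ∫⁻ r in Ioi (0 : ℝ), ENNReal.ofReal (r ^ d) * (Iio (1 : ℝ)).indicator 1 r

theorem radialMass_ne_top (d : ℕ) : radialMass d ≠ ⊤ := by
  have : radialMass d ≤ ∫⁻ r in Ioo (0 : ℝ) 1, 1 := by
    rw [radialMass, ← lintegral_indicator measurableSet_Ioi, ← lintegral_indicator measurableSet_Ioo]
    refine lintegral_mono fun r => ?_
    by_cases h1 : 0 < r <;> by_cases h2 : r < 1 <;> simp [indicator, h1, h2]
    exact pow_le_one₀ h1.le h2.le
  refine ne_top_of_le_ne_top ?_ this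
  simp

theorem radialMass_ne_zero (d : ℕ) : radialMass d ≠ 0 := by
  rw [radialMass, ← pos_iff_ne_zero, setLIntegral_pos_iff (by
    refine Measurable.mul (by fun_prop) (measurable_one.indicator measurableSet_Iio))]
  have : Ioo (0 : ℝ) 1 ⊆ (Function.support fun r : ℝ => ENNReal.ofReal (r ^ d) *
      (Iio (1 : ℝ)).indicator 1 r) ∩ Ioi 0 := by
    intro r hr
    refine ⟨?_, hr.1⟩
    simp [hr.2, hr.1]
  exact lt_of_lt_of_le (by simp) (measure_mono this)

variable {E : Type*} [NormedAddCommGroup E] [NormedSpace ℝ E] [Nontrivial E]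
    [FiniteDimensional ℝ E] [MeasurableSpace E] [BorelSpace E] (μ : Measure E) [μ.IsAddHaarMeasure]

theorem lintegral_norm_polar {F : ℝ → ℝ≥0∞} (hF : Measurable F) :
    ∫⁻ x, F ‖x‖ ∂μ = μ.toSphere univ *
      ∫⁻ r in Ioi (0 : ℝ), ENNReal.ofReal (r ^ (Module.finrank ℝ E - 1)) * F r := by
  rw [lintegral_polar μ (F := fun x => F ‖x‖) (hF.comp measurable_norm)]
  have h : ∀ w : Metric.sphere (0 : E) 1, ∫⁻ r in Ioi (0 : ℝ),
      ENNReal.ofReal (r ^ (Module.finrank ℝ E - 1)) * F ‖r • (w : E)‖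
      = ∫⁻ r in Ioi (0 : ℝ), ENNReal.ofReal (r ^ (Module.finrank ℝ E - 1)) * F r := by
    intro w
    refine setLIntegral_congr_fun measurableSet_Ioi fun r hr => ?_
    rw [norm_smul, norm_eq_of_mem_sphere, mul_one, Real.norm_of_nonneg (le_of_lt hr)]
  simp_rw [h, lintegral_const, mul_comm]

/-- The integral of a `p`-homogeneous function over the unit ball, in polar coordinates. -/
theorem lintegral_homogeneous_polar {Φ : E → ℝ≥0∞} (hΦ : Measurable Φ) (p : ℕ)
    (hom : ∀ r : ℝ, 0 < r → ∀ x, Φ (r • x) = ENNReal.ofReal (r ^ p) * Φ x)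
    {F : ℝ → ℝ≥0∞} (hF : Measurable F) :
    ∫⁻ x, Φ x * F ‖x‖ ∂μ = (∫⁻ w, Φ (w : E) ∂μ.toSphere) *
      ∫⁻ r in Ioi (0 : ℝ), ENNReal.ofReal (r ^ (p + (Module.finrank ℝ E - 1))) * F r := by
  rw [lintegral_polar μ (F := fun x => Φ x * F ‖x‖) (hΦ.mul (hF.comp measurable_norm))]
  have h : ∀ w : Metric.sphere (0 : E) 1, ∫⁻ r in Ioi (0 : ℝ),
      ENNReal.ofReal (r ^ (Module.finrank ℝ E - 1)) * (Φ (r • (w : E)) * F ‖r • (w : E)‖)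
      = Φ w * ∫⁻ r in Ioi (0 : ℝ),
        ENNReal.ofReal (r ^ (p + (Module.finrank ℝ E - 1))) * F r := by
    intro w
    rw [← lintegral_const_mul _ (by fun_prop)]
    refine setLIntegral_congr_fun measurableSet_Ioi fun r hr => ?_
    rw [hom r hr, norm_smul, norm_eq_of_mem_sphere, mul_one, Real.norm_of_nonneg (le_of_lt hr),
      pow_add, ENNReal.ofReal_mul (pow_nonneg (le_of_lt hr) _)]
    ring
  simp_rw [h]
  rw [lintegral_mul_const _ (by fun_prop)]

theorem measurable_unitIndicator : Measurable ((Iio (1 : ℝ)).indicator (1 : ℝ → ℝ≥0∞)) :=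
  measurable_one.indicator measurableSet_Iio

/-- Extending an integrand homogeneously of degree 0 trades an integral over the sphere for one over
the unit ball, which can be evaluated in other coordinates. The factor `radialMass` is finite and
nonzero and is cancelled afterwards. -/
theorem lintegral_toSphere_mul_radialMass {Φ : E → ℝ≥0∞} (hΦ : Measurable Φ)
    (hom : ∀ r : ℝ, 0 < r → ∀ x, Φ (r • x) = Φ x) :
    (∫⁻ w, Φ (w : E) ∂μ.toSphere) * radialMass (Module.finrank ℝ E - 1)
      = ∫⁻ x, Φ x * (Iio (1 : ℝ)).indicator 1 ‖x‖ ∂μ := by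
  rw [lintegral_homogeneous_polar μ hΦ 0 (by simpa using hom) measurable_unitIndicator, zero_add,
    radialMass]

end Polar

/-! ### The push-forward of the surface measure under `f` -/

theorem toSphere_euclidean_univ {k : ℕ} (hk : 1 ≤ k) :
    (volume : Measure (EuclideanSpace ℝ (Fin k))).toSphere univ = ENNReal.ofReal (sphereArea k) := by
  have : Nonempty (Fin k) := ⟨⟨0, hk⟩⟩
  have hk0 : (0 : ℝ) < k := by exact_mod_cast hk
  rw [Measure.toSphere_apply_univ, EuclideanSpace.volume_ball]
  simp only [finrank_euclideanSpace, Fintype.card_fin, ENNReal.ofReal_one, one_pow, one_mul]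
  rw [← ENNReal.ofReal_natCast, ← ENNReal.ofReal_mul hk0.le, sphereArea,
    Real.Gamma_add_one (by positivity)]
  congr 1
  have hG : Real.Gamma (k / 2) ≠ 0 := (Real.Gamma_pos_of_pos (by positivity)).ne'
  rw [Real.sqrt_eq_rpow, ← Real.rpow_natCast, ← Real.rpow_mul Real.pi_pos.le]
  field_simp

theorem sphereArea_pos {k : ℕ} (hk : 1 ≤ k) : 0 < sphereArea k := by
  have hk0 : (0 : ℝ) < k := by exact_mod_cast hk
  have := Real.pi_pos
  have hG : 0 < Real.Gamma (k / 2) := Real.Gamma_pos_of_pos (by positivity)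
  unfold sphereArea
  positivity

theorem measurable_f {m n : ℕ} : Measurable (f : Sph m n → ℝ) := by
  unfold f
  fun_prop

theorem lintegral_comp_norms {m n : ℕ} (hm : 1 ≤ m) (hn : 1 ≤ n) {H : ℝ → ℝ → ℝ≥0∞}
    (hHm : Measurable (Function.uncurry H)) :
    ∫⁻ z : Ambient m n, H ‖z.fst‖ ‖z.snd‖ = ENNReal.ofReal (sphereArea m) *
      ∫⁻ r in Ioi (0 : ℝ), ENNReal.ofReal (r ^ (m - 1)) * (ENNReal.ofReal (sphereArea n) *
        ∫⁻ ρ in Ioi (0 : ℝ), ENNReal.ofReal (ρ ^ (n - 1)) * H r ρ) := by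
  have : Nonempty (Fin m) := ⟨⟨0, hm⟩⟩
  have : Nonempty (Fin n) := ⟨⟨0, hn⟩⟩
  have hH1 : ∀ r, Measurable (H r) := fun r => hHm.comp measurable_prodMk_left
  have hF : ∀ x : EuclideanSpace ℝ (Fin m), ∫⁻ y : EuclideanSpace ℝ (Fin n), H ‖x‖ ‖y‖
      = ENNReal.ofReal (sphereArea n) *
        ∫⁻ ρ in Ioi (0 : ℝ), ENNReal.ofReal (ρ ^ (n - 1)) * H ‖x‖ ρ := by
    intro x
    rw [lintegral_norm_polar volume (hH1 ‖x‖), toSphere_euclidean_univ hn, finrank_euclideanSpace,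
      Fintype.card_fin]
  have hG : Measurable fun r => ENNReal.ofReal (sphereArea n) *
      ∫⁻ ρ in Ioi (0 : ℝ), ENNReal.ofReal (ρ ^ (n - 1)) * H r ρ := by
    refine Measurable.const_mul ?_ _
    refine Measurable.lintegral_prod_right' (f := fun p : ℝ × ℝ => ENNReal.ofReal
      (p.2 ^ (n - 1)) * H p.1 p.2) ?_
    exact Measurable.mul (by fun_prop) hHm
  have hm2 : Measurable (fun p : EuclideanSpace ℝ (Fin m) × EuclideanSpace ℝ (Fin n) =>
      H ‖p.1‖ ‖p.2‖) :=
    hHm.comp (by fun_prop : Measurable fun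
      p : EuclideanSpace ℝ (Fin m) × EuclideanSpace ℝ (Fin n) => (‖p.1‖, ‖p.2‖))
  have hm3 : Measurable (fun z : Ambient m n => H ‖z.fst‖ ‖z.snd‖) :=
    hHm.comp (by fun_prop : Measurable fun z : Ambient m n => (‖z.fst‖, ‖z.snd‖))
  have h1 := (WithLp.volume_preserving_toLp (U := EuclideanSpace ℝ (Fin m))
      (V := EuclideanSpace ℝ (Fin n))).lintegral_comp hm3
  rw [← h1, Measure.volume_eq_prod, lintegral_prod _ (by exact hm2.aemeasurable)]
  refine (lintegral_congr hF).trans ?_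
  rw [lintegral_norm_polar (volume : Measure (EuclideanSpace ℝ (Fin m))) hG,
    toSphere_euclidean_univ hm, finrank_euclideanSpace, Fintype.card_fin]

/-- The degree 0 extension of `G ∘ f` depends only on `r = |x|` and `ρ = |y|`. Writing `(r, ρ) = R
(cos ψ, sin ψ)` in the ball integral separates `R` from `ψ`, and the `R`-integral is exactly the
radial mass to be cancelled. -/
theorem lintegral_comp_f {m n : ℕ} (hm : 1 ≤ m) (hn : 1 ≤ n) {G : ℝ → ℝ≥0∞} (hG : Measurable G) :
    ∫⁻ z, G (f z) ∂(surf m n) = ENNReal.ofReal (sphereArea m * sphereArea n) *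
      ∫⁻ ψ in Ioo 0 (Real.pi / 2), ENNReal.ofReal (Real.cos ψ ^ (m - 1) * Real.sin ψ ^ (n - 1)) *
        G (Real.cos ψ ^ 2 - Real.sin ψ ^ 2) := by
  have : Nonempty (Fin m) := ⟨⟨0, hm⟩⟩
  have : Nonempty (Fin n) := ⟨⟨0, hn⟩⟩
  have : Nontrivial (Ambient m n) := Module.nontrivial_of_finrank_pos (R := ℝ) (by
    rw [finrank_ambient]; omega)
  set χ : ℝ → ℝ≥0∞ := (Iio (1 : ℝ)).indicator 1 with hχ
  have hχm : Measurable χ := measurable_unitIndicator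
  set Φ : Ambient m n → ℝ≥0∞ := fun z => G ((‖z.fst‖ ^ 2 - ‖z.snd‖ ^ 2) / ‖z‖ ^ 2) with hΦ
  have hΦm : Measurable Φ := hG.comp (by fun_prop)
  have hom : ∀ r : ℝ, 0 < r → ∀ x, Φ (r • x) = Φ x := by
    intro r hr z
    simp only [hΦ, WithLp.smul_fst, WithLp.smul_snd, norm_smul, mul_pow, ← mul_sub]
    rw [mul_div_mul_left]
    have : ‖r‖ ≠ 0 := norm_ne_zero_iff.2 hr.ne'
    positivity
  have key := lintegral_toSphere_mul_radialMass (volume : Measure (Ambient m n)) hΦm hom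
  rw [finrank_ambient] at key
  have h1 : ∫⁻ w : Sph m n, Φ (w : Ambient m n) ∂(volume : Measure (Ambient m n)).toSphere
      = ∫⁻ z, G (f z) ∂(surf m n) := by
    refine lintegral_congr fun w => ?_
    simp only [hΦ, norm_eq_of_mem_sphere, one_pow, div_one]
    rfl
  have hnorm : ∀ z : Ambient m n, ‖z‖ = √(‖z.fst‖ ^ 2 + ‖z.snd‖ ^ 2) :=
    fun z => WithLp.prod_norm_eq_of_L2 z
  set H : ℝ → ℝ → ℝ≥0∞ := fun r ρ => G ((r ^ 2 - ρ ^ 2) / (r ^ 2 + ρ ^ 2)) * χ √(r ^ 2 + ρ ^ 2)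
    with hH
  have hHm : Measurable (Function.uncurry H) := by
    refine Measurable.mul (hG.comp ?_) (hχm.comp ?_)
    · fun_prop
    · fun_prop
  have hH1 : ∀ r, Measurable (H r) := fun r => hHm.comp measurable_prodMk_left
  have h2 : ∫⁻ z : Ambient m n, Φ z * χ ‖z‖ = ENNReal.ofReal (sphereArea m) *
      ∫⁻ r in Ioi (0 : ℝ), ENNReal.ofReal (r ^ (m - 1)) * (ENNReal.ofReal (sphereArea n) *
        ∫⁻ ρ in Ioi (0 : ℝ), ENNReal.ofReal (ρ ^ (n - 1)) * H r ρ) := by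
    rw [← lintegral_comp_norms hm hn hHm]
    refine lintegral_congr fun z => ?_
    simp only [hΦ, hH, hnorm z]
    rw [Real.sq_sqrt (by positivity)]
  have h3 : ∫⁻ r in Ioi (0 : ℝ), ENNReal.ofReal (r ^ (m - 1)) * (ENNReal.ofReal (sphereArea n) *
        ∫⁻ ρ in Ioi (0 : ℝ), ENNReal.ofReal (ρ ^ (n - 1)) * H r ρ)
      = ENNReal.ofReal (sphereArea n) * ∫⁻ r in Ioi (0 : ℝ), ∫⁻ ρ in Ioi (0 : ℝ),
        ENNReal.ofReal (r ^ (m - 1)) * (ENNReal.ofReal (ρ ^ (n - 1)) * H r ρ) := by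
    rw [← lintegral_const_mul' _ _ ENNReal.ofReal_ne_top]
    refine lintegral_congr fun r => ?_
    rw [lintegral_const_mul' _ _ ENNReal.ofReal_ne_top]
    ring
  have hHm' : Measurable (Function.uncurry fun r ρ : ℝ =>
      ENNReal.ofReal (r ^ (m - 1)) * (ENNReal.ofReal (ρ ^ (n - 1)) * H r ρ)) :=
    Measurable.mul (by fun_prop) (Measurable.mul (by fun_prop) hHm)
  have h4 : ∀ ψ ∈ Ioo 0 (Real.pi / 2), ∫⁻ R in Ioi (0 : ℝ), ENNReal.ofReal R *
      (ENNReal.ofReal ((R * Real.cos ψ) ^ (m - 1)) * (ENNReal.ofReal ((R * Real.sin ψ) ^ (n - 1)) *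
        H (R * Real.cos ψ) (R * Real.sin ψ))) = radialMass (m + n - 1) *
      (ENNReal.ofReal (Real.cos ψ ^ (m - 1) * Real.sin ψ ^ (n - 1)) *
        G (Real.cos ψ ^ 2 - Real.sin ψ ^ 2)) := by
    intro ψ hψ
    have hpi := Real.pi_pos
    have hc : 0 < Real.cos ψ := Real.cos_pos_of_mem_Ioo ⟨by linarith [hψ.1], hψ.2⟩
    have hs : 0 < Real.sin ψ := Real.sin_pos_of_pos_of_lt_pi hψ.1 (by linarith [hψ.2])
    rw [radialMass, ← lintegral_mul_const _ (by
      exact Measurable.mul (by fun_prop) measurable_unitIndicator)]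
    refine setLIntegral_congr_fun measurableSet_Ioi fun R hR => ?_
    have hR' : 0 < R := hR
    have e : (R * Real.cos ψ) ^ 2 + (R * Real.sin ψ) ^ 2 = R ^ 2 := by
      rw [mul_pow, mul_pow, ← mul_add, Real.cos_sq_add_sin_sq, mul_one]
    have e' : ((R * Real.cos ψ) ^ 2 - (R * Real.sin ψ) ^ 2) / R ^ 2
        = Real.cos ψ ^ 2 - Real.sin ψ ^ 2 := by
      field_simp
    simp only [hH, e, e', Real.sqrt_sq hR'.le]
    -- The power of `R` collects 1 from the planar Jacobian, `m - 1` from `r` and `n - 1` from `ρ`.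
    rw [show m + n - 1 = 1 + (m - 1) + (n - 1) by omega, ← hχ]
    rw [show ∀ a b c g x : ℝ≥0∞, a * (b * (c * (g * x))) = (a * b * c) * g * x by intros; ring,
      show ∀ a b g x : ℝ≥0∞, a * x * (b * g) = (a * b) * g * x by intros; ring,
      ← ENNReal.ofReal_mul (by positivity), ← ENNReal.ofReal_mul (by positivity),
      ← ENNReal.ofReal_mul (by positivity)]
    congr 3
    ring
  rw [h1, h2, h3, lintegral_quadrant hHm', setLIntegral_congr_fun measurableSet_Ioo h4,
    lintegral_const_mul' _ _ (radialMass_ne_top _)] at key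
  refine (ENNReal.mul_left_inj (radialMass_ne_zero (m + n - 1)) (radialMass_ne_top _)).1 ?_
  rw [key, ENNReal.ofReal_mul (sphereArea_pos hm).le]
  ring

/-- The push-forward of the surface measure under `f` is the measure `h dt`. -/
theorem measurePreserving_f {m n : ℕ} (hm : 2 ≤ m) (hn : 2 ≤ n) :
    MeasurePreserving f (surf m n) (hMeasure m n) := by
  refine ⟨measurable_f, Measure.ext_of_lintegral _ fun G hG => ?_⟩
  have hpi := Real.pi_pos
  have hm0 := sphereArea_pos (show 1 ≤ m by omega)
  have hn0 := sphereArea_pos (show 1 ≤ n by omega)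
  rw [lintegral_map hG measurable_f, lintegral_comp_f (by omega) (by omega) hG, hMeasure,
    lintegral_withDensity_eq_lintegral_mul _
      (continuous_weight hm hn).measurable.ennreal_ofReal hG]
  -- The substitution is `t = cos (2ψ) = cos² ψ - sin² ψ`.
  have himg : (fun ψ => Real.cos (2 * ψ)) '' Ioo 0 (Real.pi / 2) = Ioo (-1) 1 := by
    ext t
    simp only [mem_image, mem_Ioo]
    constructor
    · rintro ⟨ψ, ⟨h1, h2⟩, rfl⟩
      constructor
      · rw [← Real.cos_pi]
        exact Real.cos_lt_cos_of_nonneg_of_le_pi (by linarith) le_rfl (by linarith)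
      · rw [← Real.cos_zero]
        exact Real.cos_lt_cos_of_nonneg_of_le_pi le_rfl (by linarith) (by linarith)
    · rintro ⟨h1, h2⟩
      refine ⟨Real.arccos t / 2, ⟨?_, ?_⟩, ?_⟩
      · have := Real.arccos_pos.2 h2; linarith
      · have := Real.arccos_lt_pi.2 h1; linarith
      · rw [mul_div_cancel₀ _ two_ne_zero, Real.cos_arccos h1.le h2.le]
  rw [Measure.restrict_congr_set Ioo_ae_eq_Icc.symm, ← himg,
    lintegral_image_eq_lintegral_abs_deriv_mul measurableSet_Ioo
      (f' := fun ψ => -(2 * Real.sin (2 * ψ))) (fun ψ _ => by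
        have := ((Real.hasDerivAt_cos (2 * ψ)).comp ψ
          ((hasDerivAt_id ψ).const_mul 2)).hasDerivWithinAt (s := Ioo 0 (Real.pi / 2))
        convert! this using 1
        simp; ring)
      (fun a ha b hb h => by
        have := Real.injOn_cos (x₁ := 2 * a) (x₂ := 2 * b) ⟨by linarith [ha.1], by linarith [ha.2]⟩
          ⟨by linarith [hb.1], by linarith [hb.2]⟩ h
        linarith),
    ← lintegral_const_mul' _ _ ENNReal.ofReal_ne_top]
  refine setLIntegral_congr_fun measurableSet_Ioo fun ψ hψ => ?_
  have hc : 0 < Real.cos ψ := Real.cos_pos_of_mem_Ioo ⟨by linarith [hψ.1], hψ.2⟩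
  have hs : 0 < Real.sin ψ := Real.sin_pos_of_pos_of_lt_pi hψ.1 (by linarith [hψ.2])
  have h1 : 1 - Real.cos (2 * ψ) = 2 * Real.sin ψ ^ 2 := by
    rw [Real.cos_two_mul, Real.sin_sq]; ring
  have h2 : 1 + Real.cos (2 * ψ) = 2 * Real.cos ψ ^ 2 := by
    rw [Real.cos_two_mul]; ring
  have e2 : Real.cos ψ ^ 2 - Real.sin ψ ^ 2 = Real.cos (2 * ψ) := (Real.cos_two_mul' ψ).symm
  have e3 : |(-(2 * Real.sin (2 * ψ)))| = 4 * Real.sin ψ * Real.cos ψ := by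
    rw [abs_neg, Real.sin_two_mul, abs_of_pos (by positivity)]; ring
  simp only [Pi.mul_apply, e2, e3]
  rw [← mul_assoc, ← mul_assoc, ← ENNReal.ofReal_mul (by positivity),
    ← ENNReal.ofReal_mul (by positivity)]
  congr 2
  -- Since `1 - t = 2 sin² ψ` and `1 + t = 2 cos² ψ`, each factor of the weight absorbs one `sin ψ`
  -- or `cos ψ` of the Jacobian `4 sin ψ cos ψ`; used with `x = sin ψ, k = n` and `x = cos ψ, k =
  -- m`.
  have hp : ∀ (x : ℝ), 0 < x → ∀ k : ℕ, 2 ≤ k → (2 * x ^ 2) ^ ((k : ℝ) / 2 - 1) * x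
      = 2 ^ ((k : ℝ) / 2 - 1) * x ^ (k - 1) := by
    intro x hx k hk
    rw [Real.mul_rpow two_pos.le (by positivity), ← Real.rpow_natCast x 2,
      ← Real.rpow_mul hx.le, mul_assoc]
    congr 1
    rw [← Real.rpow_add_one hx.ne', ← Real.rpow_natCast x (k - 1), Nat.cast_sub (by omega)]
    congr 1
    push_cast
    ring
  have h2pow : (2 : ℝ) ^ (((m : ℝ) + n) / 2) = 2 ^ ((m : ℝ) / 2 - 1) * 2 ^ ((n : ℝ) / 2 - 1) * 4 := by
    rw [← Real.rpow_add two_pos, show (4 : ℝ) = 2 ^ (2 : ℝ) by norm_num, ← Real.rpow_add two_pos]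
    congr 1
    ring
  rw [weight, alpha, beta, h1, h2, h2pow]
  have A := hp _ hs n hn
  have B := hp _ hc m hm
  have p1 : (0 : ℝ) < 2 ^ ((m : ℝ) / 2 - 1) := by positivity
  have p2 : (0 : ℝ) < 2 ^ ((n : ℝ) / 2 - 1) := by positivity
  rw [show 4 * Real.sin ψ * Real.cos ψ * (sphereArea m * sphereArea n /
      (2 ^ ((m : ℝ) / 2 - 1) * 2 ^ ((n : ℝ) / 2 - 1) * 4) *
      (2 * Real.sin ψ ^ 2) ^ ((n : ℝ) / 2 - 1) * (2 * Real.cos ψ ^ 2) ^ ((m : ℝ) / 2 - 1))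
    = 4 * (sphereArea m * sphereArea n /
      (2 ^ ((m : ℝ) / 2 - 1) * 2 ^ ((n : ℝ) / 2 - 1) * 4)) *
      ((2 * Real.sin ψ ^ 2) ^ ((n : ℝ) / 2 - 1) * Real.sin ψ) *
      ((2 * Real.cos ψ ^ 2) ^ ((m : ℝ) / 2 - 1) * Real.cos ψ) by ring, A, B]
  field_simp

/-! ### Slicing the sphere by parallel hyperplanes -/

section Slice

variable {E : Type*} [NormedAddCommGroup E] [InnerProductSpace ℝ E]
  [FiniteDimensional ℝ E] [MeasurableSpace E] [BorelSpace E]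

theorem lintegral_orthogonal_split {e : E} (he : ‖e‖ = 1) {F : E → ℝ≥0∞} (hF : Measurable F) :
    ∫⁻ z, F z = ∫⁻ t : ℝ, ∫⁻ v : (Submodule.span ℝ {e})ᗮ, F (t • e + (v : E)) := by
  set K := Submodule.span ℝ {e} with hK
  have h1 := (K.orthogonalDecomposition.symm).measurePreserving
  have h2 := WithLp.volume_preserving_toLp (U := K) (V := Kᗮ)
  have h3 := (LinearIsometryEquiv.toSpanUnitSingleton (𝕜 := ℝ) e he).measurePreserving
  have h4 : MeasurePreserving (fun p : ℝ × Kᗮ =>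
      ((LinearIsometryEquiv.toSpanUnitSingleton (𝕜 := ℝ) e he p.1 : K), p.2)) :=
    h3.prod (MeasurePreserving.id volume)
  have h5 := h1.comp (h2.comp h4)
  rw [← h5.lintegral_comp hF, Measure.volume_eq_prod,
    lintegral_prod _ (by exact (hF.comp h5.measurable).aemeasurable)]
  simp [Submodule.orthogonalDecomposition_symm_apply]

/-- Slicing the unit sphere by hyperplanes orthogonal to `e`. -/
theorem exists_lintegral_slice_angle (hd : 2 ≤ Module.finrank ℝ E) {e : E} (he : ‖e‖ = 1) (p : ℕ)
    {Φ : E → ℝ≥0∞} (hΦ : Measurable Φ)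
    (hom : ∀ r : ℝ, 0 < r → ∀ x, Φ (r • x) = ENNReal.ofReal (r ^ p) * Φ x)
    (hinv : ∀ (t : ℝ) (x : E), Φ (t • e + x) = Φ x) :
    ∃ C : ℝ≥0∞, ∀ g : ℝ → ℝ≥0∞, Measurable g →
      ∫⁻ w, Φ (w : E) * g (inner ℝ e (w : E)) ∂(volume : Measure E).toSphere
        = C * ∫⁻ ψ in Ioo 0 Real.pi, ENNReal.ofReal (Real.sin ψ ^ (p + Module.finrank ℝ E - 2)) *
          g (Real.cos ψ) := by
  have hnt : Nontrivial E := Module.nontrivial_of_finrank_pos (R := ℝ) (by omega)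
  have hfr : Module.finrank ℝ (Submodule.span ℝ {e})ᗮ = Module.finrank ℝ E - 1 := by
    have : Fact (Module.finrank ℝ E = (Module.finrank ℝ E - 1) + 1) := ⟨by omega⟩
    exact Submodule.finrank_orthogonal_span_singleton (norm_ne_zero_iff.1 (by rw [he]; exact one_ne_zero))
  have hnt' : Nontrivial (Submodule.span ℝ {e})ᗮ :=
    Module.nontrivial_of_finrank_pos (R := ℝ) (by omega)
  -- The constant is the integral of `Φ` over the equator. Its value is not needed here: in the
  -- application it is recovered by testing with `g = 1`.
  refine ⟨∫⁻ v : Metric.sphere (0 : (Submodule.span ℝ {e})ᗮ) 1,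
    Φ (v : (Submodule.span ℝ {e})ᗮ) ∂(volume : Measure (Submodule.span ℝ {e})ᗮ).toSphere,
    fun g hg => ?_⟩
  obtain ⟨C, hC⟩ : ∃ C, C = ∫⁻ v : Metric.sphere (0 : (Submodule.span ℝ {e})ᗮ) 1,
    Φ (v : (Submodule.span ℝ {e})ᗮ) ∂(volume : Measure (Submodule.span ℝ {e})ᗮ).toSphere := ⟨_, rfl⟩
  rw [← hC]
  obtain ⟨d, hd'⟩ : ∃ d, Module.finrank ℝ E = d + 2 := ⟨_, (Nat.sub_add_cancel hd).symm⟩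
  set χ : ℝ → ℝ≥0∞ := (Iio (1 : ℝ)).indicator 1 with hχ
  have hχm : Measurable χ := measurable_unitIndicator
  have hΨm : Measurable fun z : E => Φ z * g (inner ℝ e z / ‖z‖) := hΦ.mul (hg.comp (by fun_prop))
  have key := lintegral_homogeneous_polar (volume : Measure E) hΨm p
    (fun r hr x => by
      rw [hom r hr, inner_smul_right, norm_smul, Real.norm_of_nonneg hr.le,
        mul_div_mul_left _ _ hr.ne', mul_assoc]) hχm
  have hleft : ∫⁻ w : Metric.sphere (0 : E) 1, Φ (w : E) * g (inner ℝ e (w : E) / ‖(w : E)‖)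
      ∂(volume : Measure E).toSphere
      = ∫⁻ w, Φ (w : E) * g (inner ℝ e (w : E)) ∂(volume : Measure E).toSphere := by
    refine lintegral_congr fun w => ?_
    rw [norm_eq_of_mem_sphere, div_one]
  rw [hleft, hd', lintegral_orthogonal_split he
    (F := fun z => Φ z * g (inner ℝ e z / ‖z‖) * χ ‖z‖) (hΨm.mul (hχm.comp measurable_norm))] at key
  have hinner : ∀ (t : ℝ) (v : (Submodule.span ℝ {e})ᗮ), inner ℝ e (t • e + (v : E)) = t := by
    intro t v
    rw [inner_add_right, inner_smul_right, real_inner_self_eq_norm_sq, he,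
      (Submodule.mem_orthogonal_singleton_iff_inner_right).1 v.2]
    simp
  have hnorm : ∀ (t : ℝ) (v : (Submodule.span ℝ {e})ᗮ),
      ‖t • e + (v : E)‖ = √(t ^ 2 + ‖v‖ ^ 2) := by
    intro t v
    rw [← Real.sqrt_sq (norm_nonneg (t • e + (v : E))), norm_add_sq_real, norm_smul, he,
      inner_smul_left, (Submodule.mem_orthogonal_singleton_iff_inner_right).1 v.2]
    simp
  set H : ℝ → ℝ → ℝ≥0∞ := fun t ρ => g (t / √(t ^ 2 + ρ ^ 2)) * χ √(t ^ 2 + ρ ^ 2) with hH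
  have hHm : Measurable (Function.uncurry H) := by
    refine Measurable.mul (hg.comp ?_) (hχm.comp ?_)
    · fun_prop
    · fun_prop
  have hin : ∀ t : ℝ, ∫⁻ v : (Submodule.span ℝ {e})ᗮ,
      Φ (t • e + (v : E)) * g (inner ℝ e (t • e + (v : E)) / ‖t • e + (v : E)‖) *
        χ ‖t • e + (v : E)‖
      = C * ∫⁻ ρ in Ioi (0 : ℝ), ENNReal.ofReal (ρ ^ (p + d)) * H t ρ := by
    intro t
    have e1 : ∀ v : (Submodule.span ℝ {e})ᗮ,
        Φ (t • e + (v : E)) * g (inner ℝ e (t • e + (v : E)) / ‖t • e + (v : E)‖) *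
        χ ‖t • e + (v : E)‖ = Φ v * H t ‖v‖ := by
      intro v
      rw [hinner, hnorm, hinv, mul_assoc]
    rw [lintegral_congr e1, lintegral_homogeneous_polar (μ := volume)
      (Φ := fun v : (Submodule.span ℝ {e})ᗮ => Φ (v : E)) (hΦ.comp measurable_subtype_coe) p
      (fun r hr x => by exact hom r hr x) (F := H t) (hHm.comp measurable_prodMk_left), ← hC, hfr, hd']
    simp
  rw [lintegral_congr hin, lintegral_const_mul _ (by
    refine Measurable.lintegral_prod_right' (f := fun q : ℝ × ℝ => ENNReal.ofReal
      (q.2 ^ (p + d)) * H q.1 q.2) ?_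
    exact Measurable.mul (by fun_prop) hHm),
    lintegral_half_plane (H := fun t ρ => ENNReal.ofReal (ρ ^ (p + d)) * H t ρ) (by
      exact Measurable.mul (by fun_prop) hHm)] at key
  have h4 : ∀ ψ ∈ Ioo 0 Real.pi, ∫⁻ R in Ioi (0 : ℝ), ENNReal.ofReal R *
      (ENNReal.ofReal ((R * Real.sin ψ) ^ (p + d)) * H (R * Real.cos ψ) (R * Real.sin ψ))
      = radialMass (p + (d + 2 - 1)) * (ENNReal.ofReal (Real.sin ψ ^ (p + d)) *
        g (Real.cos ψ)) := by
    intro ψ hψ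
    have hs : 0 < Real.sin ψ := Real.sin_pos_of_pos_of_lt_pi hψ.1 hψ.2
    rw [radialMass, ← lintegral_mul_const _ (by
      exact Measurable.mul (by fun_prop) measurable_unitIndicator)]
    refine setLIntegral_congr_fun measurableSet_Ioi fun R hR => ?_
    have hR' : 0 < R := hR
    have e1 : (R * Real.cos ψ) ^ 2 + (R * Real.sin ψ) ^ 2 = R ^ 2 := by
      rw [mul_pow, mul_pow, ← mul_add, Real.cos_sq_add_sin_sq, mul_one]
    simp only [hH, e1, Real.sqrt_sq hR'.le, mul_div_cancel_left₀ _ hR'.ne']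
    rw [← hχ, show p + (d + 2 - 1) = 1 + (p + d) by omega,
      show ∀ a b g x : ℝ≥0∞, a * (b * (g * x)) = (a * b) * g * x by intros; ring,
      show ∀ a b g x : ℝ≥0∞, a * x * (b * g) = (a * b) * g * x by intros; ring,
      ← ENNReal.ofReal_mul (by positivity), ← ENNReal.ofReal_mul (by positivity)]
    congr 3
    ring
  rw [setLIntegral_congr_fun measurableSet_Ioo h4,
    lintegral_const_mul' _ _ (radialMass_ne_top _)] at key
  refine (ENNReal.mul_left_inj (radialMass_ne_zero (p + (d + 2 - 1))) (radialMass_ne_top _)).1 ?_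
  rw [radialMass] at key ⊢
  rw [← hχ, ← key, hd', show p + (d + 2) - 2 = p + d by omega]
  ring

/-- Substituting `t = cos ψ` in the angular form uses up one factor `sin ψ`, which lowers the
exponent of `sin ψ = (1 - t²)^{1/2}` from `p + dim E - 2` to `p + dim E - 3`. -/
theorem exists_lintegral_slice (hd : 2 ≤ Module.finrank ℝ E) {e : E} (he : ‖e‖ = 1) (p : ℕ)
    {Φ : E → ℝ≥0∞} (hΦ : Measurable Φ)
    (hom : ∀ r : ℝ, 0 < r → ∀ x, Φ (r • x) = ENNReal.ofReal (r ^ p) * Φ x)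
    (hinv : ∀ (t : ℝ) (x : E), Φ (t • e + x) = Φ x) :
    ∃ C : ℝ≥0∞, ∀ g : ℝ → ℝ≥0∞, Measurable g →
      ∫⁻ w, Φ (w : E) * g (inner ℝ e (w : E)) ∂(volume : Measure E).toSphere
        = C * ∫⁻ t in Ioo (-1 : ℝ) 1,
          ENNReal.ofReal ((1 - t ^ 2) ^ (((p : ℝ) + Module.finrank ℝ E - 3) / 2)) * g t := by
  obtain ⟨C, hC⟩ := exists_lintegral_slice_angle hd he p hΦ hom hinv
  refine ⟨C, fun g hg => ?_⟩
  have hpi := Real.pi_pos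
  have himg : Real.cos '' Ioo 0 Real.pi = Ioo (-1) 1 := by
    ext t
    simp only [mem_image, mem_Ioo]
    constructor
    · rintro ⟨ψ, ⟨h1, h2⟩, rfl⟩
      constructor
      · rw [← Real.cos_pi]
        exact Real.cos_lt_cos_of_nonneg_of_le_pi (by linarith) le_rfl (by linarith)
      · rw [← Real.cos_zero]
        exact Real.cos_lt_cos_of_nonneg_of_le_pi le_rfl (by linarith) (by linarith)
    · rintro ⟨h1, h2⟩
      exact ⟨Real.arccos t, ⟨Real.arccos_pos.2 h2, Real.arccos_lt_pi.2 h1⟩,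
        Real.cos_arccos h1.le h2.le⟩
  rw [hC g hg, ← himg,
    lintegral_image_eq_lintegral_abs_deriv_mul measurableSet_Ioo
      (f' := fun ψ => -Real.sin ψ) (fun ψ _ => (Real.hasDerivAt_cos ψ).hasDerivWithinAt)
      (Real.injOn_cos.mono Ioo_subset_Icc_self)]
  congr 1
  refine setLIntegral_congr_fun measurableSet_Ioo fun ψ hψ => ?_
  have hs : 0 < Real.sin ψ := Real.sin_pos_of_pos_of_lt_pi hψ.1 hψ.2
  rw [← mul_assoc, ← ENNReal.ofReal_mul (abs_nonneg _), abs_neg, abs_of_pos hs]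
  congr 2
  rw [← Real.sin_sq, ← Real.rpow_natCast _ 2, ← Real.rpow_mul hs.le, mul_comm (Real.sin ψ),
    ← Real.rpow_add_one hs.ne', ← Real.rpow_natCast, Nat.cast_sub (by omega)]
  congr 1
  push_cast
  ring

end Slice

/-! ### Moments of `|y|²` and of the Riesz kernel on the sphere -/

/-- The Beta integral on `(-1, 1)`. -/
theorem lintegral_beta {a b : ℝ} (ha : 0 < a) (hb : 0 < b) :
    ∫⁻ t in Ioo (-1 : ℝ) 1, ENNReal.ofReal ((1 - t) ^ (a - 1) * (1 + t) ^ (b - 1))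
      = ENNReal.ofReal (2 ^ (a + b - 1) * ProbabilityTheory.beta b a) := by
  -- The value is read off from the total mass 1 of the Beta distribution, after the substitution `x
  -- = (1 + t)/2`.
  have h := ProbabilityTheory.lintegral_betaPDF_eq_one hb ha
  have hβ := ProbabilityTheory.beta_pos hb ha
  rw [ProbabilityTheory.lintegral_betaPDF] at h
  have himg : (fun t : ℝ => (1 + t) / 2) '' Ioo (-1) 1 = Ioo 0 1 := by
    ext x
    simp only [mem_image, mem_Ioo]
    constructor
    · rintro ⟨t, ⟨h1, h2⟩, rfl⟩
      constructor <;> linarith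
    · rintro ⟨h1, h2⟩
      exact ⟨2 * x - 1, ⟨by linarith, by linarith⟩, by ring⟩
  rw [← himg, lintegral_image_eq_lintegral_abs_deriv_mul measurableSet_Ioo
      (f' := fun _ => 1 / 2) (fun t _ => by
        have := (((hasDerivAt_id t).const_add 1).div_const 2).hasDerivWithinAt
          (s := Ioo (-1 : ℝ) 1)
        simpa using this)
      (fun x _ y _ h => by simpa using h)] at h
  have hpos : 0 < (2 : ℝ) ^ (a + b - 1) * ProbabilityTheory.beta b a := by positivity
  have e : ∀ t ∈ Ioo (-1 : ℝ) 1, ENNReal.ofReal |(1 / 2 : ℝ)| *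
      ENNReal.ofReal (1 / ProbabilityTheory.beta b a * ((1 + t) / 2) ^ (b - 1) *
        (1 - (1 + t) / 2) ^ (a - 1))
      = ENNReal.ofReal ((2 ^ (a + b - 1) * ProbabilityTheory.beta b a)⁻¹) *
        ENNReal.ofReal ((1 - t) ^ (a - 1) * (1 + t) ^ (b - 1)) := by
    intro t ht
    have h1 : 0 ≤ 1 - t := by linarith [ht.2]
    have h2 : 0 ≤ 1 + t := by linarith [ht.1]
    rw [← ENNReal.ofReal_mul (abs_nonneg _), ← ENNReal.ofReal_mul (by positivity)]
    congr 1
    rw [show 1 - (1 + t) / 2 = (1 - t) / 2 by ring, Real.div_rpow h1 two_pos.le,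
      Real.div_rpow h2 two_pos.le, abs_of_pos (by norm_num),
      show a + b - 1 = (a - 1) + (b - 1) + 1 by ring, Real.rpow_add two_pos,
      Real.rpow_add two_pos, Real.rpow_one]
    have p1 : (0 : ℝ) < 2 ^ (a - 1) := by positivity
    have p2 : (0 : ℝ) < 2 ^ (b - 1) := by positivity
    field_simp
  rw [setLIntegral_congr_fun measurableSet_Ioo e, lintegral_const_mul' _ _ ENNReal.ofReal_ne_top]
    at h
  rw [ENNReal.ofReal_inv_of_pos hpos] at h
  have hne : ENNReal.ofReal (2 ^ (a + b - 1) * ProbabilityTheory.beta b a) ≠ 0 := by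
    simpa using hpos
  rw [← mul_one (ENNReal.ofReal _), ← h, ← mul_assoc,
    ENNReal.mul_inv_cancel hne ENNReal.ofReal_ne_top, one_mul]

theorem norm_fst_sq_add_norm_snd_sq {m n : ℕ} (z : Sph m n) :
    ‖(z : Ambient m n).fst‖ ^ 2 + ‖(z : Ambient m n).snd‖ ^ 2 = 1 := by
  rw [← WithLp.prod_norm_sq_eq_of_L2, norm_eq_of_mem_sphere, one_pow]

theorem norm_snd_sq {m n : ℕ} (z : Sph m n) : ‖(z : Ambient m n).snd‖ ^ 2 = (1 - f z) / 2 := by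
  have := norm_fst_sq_add_norm_snd_sq z
  rw [f]; linarith

theorem norm_fst_sq {m n : ℕ} (z : Sph m n) : ‖(z : Ambient m n).fst‖ ^ 2 = (1 + f z) / 2 := by
  have := norm_fst_sq_add_norm_snd_sq z
  rw [f]; linarith

theorem f_mem_Icc {m n : ℕ} (z : Sph m n) : f z ∈ Icc (-1 : ℝ) 1 := by
  have h1 := norm_fst_sq z
  have h2 := norm_snd_sq z
  constructor <;> nlinarith [sq_nonneg ‖(z : Ambient m n).fst‖, sq_nonneg ‖(z : Ambient m n).snd‖]

theorem sphereArea_mul {N m n : ℕ} (h : m + n = N + 1) :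
    sphereArea m * sphereArea n = 4 * Real.pi ^ (((N : ℝ) + 1) / 2) /
      (Real.Gamma (m / 2) * Real.Gamma (n / 2)) := by
  have h' : (m : ℝ) + n = N + 1 := by exact_mod_cast h
  rw [← h', add_div, Real.rpow_add Real.pi_pos, sphereArea, sphereArea]
  ring

/-- On the sphere `|y|² = (1 - f)/2`, so the push-forward under `f` makes this a Beta integral. It
serves to determine the constant in the slicing formula. -/
theorem lintegral_norm_snd_pow {N m n : ℕ} (h : m + n = N + 1) (hm : 2 ≤ m) (hn : 2 ≤ n) (k : ℕ) :
    ∫⁻ w : Sph m n, ENNReal.ofReal (‖(w : Ambient m n).snd‖ ^ (2 * k)) ∂(surf m n)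
      = ENNReal.ofReal (2 * Real.pi ^ (((N : ℝ) + 1) / 2) *
        (Real.Gamma (k + n / 2) / Real.Gamma (n / 2)) / Real.Gamma (k + (N + 1) / 2)) := by
  have hm0 : (0 : ℝ) < m := by exact_mod_cast (by omega : 0 < m)
  have hn0 : (0 : ℝ) < n := by exact_mod_cast (by omega : 0 < n)
  have h' : (m : ℝ) + n = N + 1 := by exact_mod_cast h
  have hG : Measurable fun t : ℝ => ENNReal.ofReal (((1 - t) / 2) ^ k) := by fun_prop
  have e1 : ∀ w : Sph m n, ENNReal.ofReal (‖(w : Ambient m n).snd‖ ^ (2 * k))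
      = (fun t : ℝ => ENNReal.ofReal (((1 - t) / 2) ^ k)) (f w) := by
    intro w
    rw [pow_mul, norm_snd_sq]
  rw [lintegral_congr e1, (measurePreserving_f hm hn).lintegral_comp hG, hMeasure,
    lintegral_withDensity_eq_lintegral_mul _
      (continuous_weight hm hn).measurable.ennreal_ofReal hG,
    Measure.restrict_congr_set Ioo_ae_eq_Icc.symm]
  have hm1 := sphereArea_pos (show 1 ≤ m by omega)
  have hn1 := sphereArea_pos (show 1 ≤ n by omega)
  have e2 : ∀ t ∈ Ioo (-1 : ℝ) 1, ((fun t => ENNReal.ofReal (weight m n t)) *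
      fun t : ℝ => ENNReal.ofReal (((1 - t) / 2) ^ k)) t
      = ENNReal.ofReal (sphereArea m * sphereArea n / 2 ^ (((m : ℝ) + n) / 2) / 2 ^ k) *
        ENNReal.ofReal ((1 - t) ^ (((k : ℝ) + n / 2) - 1) * (1 + t) ^ ((m : ℝ) / 2 - 1)) := by
    intro t ht
    have h1 : 0 < 1 - t := by linarith [ht.2]
    have h2 : 0 < 1 + t := by linarith [ht.1]
    have hk : 0 ≤ ((1 - t) / 2) ^ k := by positivity
    rw [Pi.mul_apply, ← ENNReal.ofReal_mul' hk, ← ENNReal.ofReal_mul (by positivity)]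
    congr 1
    rw [weight, alpha, beta, div_pow, show (k : ℝ) + n / 2 - 1 = (n / 2 - 1) + k by ring,
      Real.rpow_add h1, Real.rpow_natCast]
    ring
  rw [setLIntegral_congr_fun measurableSet_Ioo e2, lintegral_const_mul' _ _ ENNReal.ofReal_ne_top,
    lintegral_beta (by positivity) (by positivity), ← ENNReal.ofReal_mul (by positivity)]
  congr 1
  have e3 : (2 : ℝ) ^ ((k : ℝ) + n / 2 + m / 2 - 1) * 2 = 2 ^ (((m : ℝ) + n) / 2) * 2 ^ k := by
    rw [← Real.rpow_natCast, ← Real.rpow_add two_pos, ← Real.rpow_add_one two_ne_zero]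
    congr 1
    ring
  have p1 : (0 : ℝ) < 2 ^ (((m : ℝ) + n) / 2) := by positivity
  have p2 : (0 : ℝ) < Real.Gamma (m / 2) := Real.Gamma_pos_of_pos (by positivity)
  have p3 : (0 : ℝ) < Real.Gamma (n / 2) := Real.Gamma_pos_of_pos (by positivity)
  rw [eq_div_of_mul_eq two_ne_zero e3, sphereArea_mul h, ProbabilityTheory.beta,
    show (m : ℝ) / 2 + (k + n / 2) = k + (N + 1) / 2 by rw [← h']; ring]
  field_simp
  ring

/-- The pole `(a, 0)` of the sphere. -/
def pole {m : ℕ} (n : ℕ) (a : EuclideanSpace ℝ (Fin m)) : Ambient m n := WithLp.toLp 2 (a, 0)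

theorem norm_pole {m n : ℕ} {a : EuclideanSpace ℝ (Fin m)} (ha : ‖a‖ = 1) : ‖pole n a‖ = 1 := by
  rw [pole, WithLp.prod_norm_eq_of_L2]
  simp [ha]

theorem inner_pole {m n : ℕ} (a : EuclideanSpace ℝ (Fin m)) (z : Ambient m n) :
    inner ℝ (pole n a) z = inner ℝ a z.fst := by
  simp [pole, WithLp.prod_inner_apply]

/-- Slicing the sphere orthogonally to a pole, with the weight `|y|^{2k}`. -/
theorem lintegral_snd_pow_mul {N m n : ℕ} (h : m + n = N + 1) (hm : 2 ≤ m) (hn : 2 ≤ n) (k : ℕ)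
    {a : EuclideanSpace ℝ (Fin m)} (ha : ‖a‖ = 1) {g : ℝ → ℝ≥0∞} (hg : Measurable g) :
    ∫⁻ w : Sph m n, ENNReal.ofReal (‖(w : Ambient m n).snd‖ ^ (2 * k)) *
        g (inner ℝ (pole n a) (w : Ambient m n)) ∂(surf m n)
      = ENNReal.ofReal (2 * Real.pi ^ ((N : ℝ) / 2) *
        (Real.Gamma (k + n / 2) / Real.Gamma (n / 2)) / Real.Gamma (k + N / 2)) *
        ∫⁻ t in Ioo (-1 : ℝ) 1, ENNReal.ofReal ((1 - t ^ 2) ^ ((k : ℝ) + N / 2 - 1)) * g t := by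
  have hN0 : (0 : ℝ) < N := by exact_mod_cast (by omega : 0 < N)
  have hn0 : (0 : ℝ) < n := by exact_mod_cast (by omega : 0 < n)
  have hfin : Module.finrank ℝ (Ambient m n) = N + 1 := (finrank_ambient m n).trans h
  obtain ⟨C, hC⟩ := exists_lintegral_slice (E := Ambient m n) (by omega) (norm_pole (n := n) ha)
    (2 * k) (Φ := fun z => ENNReal.ofReal (‖z.snd‖ ^ (2 * k))) (by fun_prop)
    (fun r hr x => by
      rw [WithLp.smul_snd, norm_smul, mul_pow, Real.norm_of_nonneg hr.le,
        ENNReal.ofReal_mul (by positivity)])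
    (fun t x => by simp [pole])
  have hexp : ((2 * k : ℕ) + (Module.finrank ℝ (Ambient m n) : ℝ) - 3) / 2
      = (k : ℝ) + N / 2 - 1 := by
    rw [hfin]; push_cast; ring
  rw [hexp] at hC
  -- With `g = 1` the left side is a known moment and the right side is `C` times a symmetric Beta
  -- integral, so `C` is determined.
  have h1 := hC 1 measurable_one
  simp only [Pi.one_apply, mul_one] at h1
  have hb : ∫⁻ t in Ioo (-1 : ℝ) 1, ENNReal.ofReal ((1 - t ^ 2) ^ ((k : ℝ) + N / 2 - 1))
      = ENNReal.ofReal (2 ^ ((k : ℝ) + N / 2 + (k + N / 2) - 1) *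
        ProbabilityTheory.beta (k + N / 2) (k + N / 2)) := by
    rw [← lintegral_beta (by positivity) (by positivity)]
    refine setLIntegral_congr_fun measurableSet_Ioo fun t ht => ?_
    rw [← Real.mul_rpow (by linarith [ht.2]) (by linarith [ht.1])]
    congr 2
    ring
  have hsurf : (volume : Measure (Ambient m n)).toSphere = surf m n := rfl
  rw [hsurf, lintegral_norm_snd_pow h hm hn, hb] at h1
  have p1 : 0 < Real.Gamma (k + N / 2) := Real.Gamma_pos_of_pos (by positivity)
  have p2 : 0 < Real.Gamma (k + N / 2 + (k + N / 2)) := Real.Gamma_pos_of_pos (by positivity)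
  have p3 : 0 < Real.Gamma (n / 2) := Real.Gamma_pos_of_pos (by positivity)
  have p4 : 0 < Real.Gamma (k + n / 2) := Real.Gamma_pos_of_pos (by positivity)
  have p5 : 0 < Real.Gamma (k + (N + 1) / 2) := Real.Gamma_pos_of_pos (by positivity)
  have p6 : (0 : ℝ) < 2 ^ ((k : ℝ) + N / 2 + (k + N / 2) - 1) := by positivity
  have hB : 0 < 2 ^ ((k : ℝ) + N / 2 + (k + N / 2) - 1) *
        ProbabilityTheory.beta (k + N / 2) (k + N / 2) := by
    rw [ProbabilityTheory.beta]; positivity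
  have hCval : C = ENNReal.ofReal (2 * Real.pi ^ ((N : ℝ) / 2) *
        (Real.Gamma (k + n / 2) / Real.Gamma (n / 2)) / Real.Gamma (k + N / 2)) := by
    refine (ENNReal.mul_left_inj (c := ENNReal.ofReal (2 ^ ((k : ℝ) + N / 2 + (k + N / 2) - 1) *
      ProbabilityTheory.beta (k + N / 2) (k + N / 2))) (by simpa using hB)
      ENNReal.ofReal_ne_top).1 ?_
    rw [← h1, ← ENNReal.ofReal_mul (by positivity)]
    congr 1
    -- Legendre's duplication formula reconciles `Γ(k + (N+1)/2)` with the `Γ(2k + N)` of the Beta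
    -- function.
    have hdup := Real.Gamma_mul_Gamma_add_half (k + N / 2)
    rw [show (k : ℝ) + N / 2 + 1 / 2 = k + (N + 1) / 2 by ring,
      show 2 * ((k : ℝ) + N / 2) = k + N / 2 + (k + N / 2) by ring] at hdup
    rw [ProbabilityTheory.beta, add_div (N : ℝ), Real.rpow_add Real.pi_pos, ← add_div,
      ← Real.sqrt_eq_rpow]
    have e2 : (2 : ℝ) ^ ((k : ℝ) + N / 2 + (k + N / 2) - 1) *
        2 ^ (1 - ((k : ℝ) + N / 2 + (k + N / 2))) = 1 := by
      rw [← Real.rpow_add two_pos]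
      simp
    have hpi := Real.pi_pos
    clear hC h1 hb hB
    generalize Real.Gamma (k + N / 2) = G1 at *
    generalize Real.Gamma (k + N / 2 + (k + N / 2)) = G2 at *
    generalize Real.Gamma (k + (N + 1) / 2) = G3 at *
    generalize (2 : ℝ) ^ ((k : ℝ) + N / 2 + (k + N / 2) - 1) = T at *
    field_simp
    linear_combination (-T) * hdup - G2 * √Real.pi * e2
  have h2 := hC g hg
  rw [← hCval, ← h2]
  rfl

/-- Here `2 - 2⟨pole, w⟩` is the squared distance to the pole. In the sliced integral the kernel
only shifts the exponent of `1 - t`, which leaves a Beta integral. Convergence at `t = 1` is the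
condition `p < k + N/2`: the weight `|y|^{2k}` vanishes at the pole, so `k ≥ 1` admits kernels that
are not integrable themselves. -/
theorem lintegral_riesz_kernel {N m n : ℕ} (h : m + n = N + 1) (hm : 2 ≤ m) (hn : 2 ≤ n) (k : ℕ)
    {a : EuclideanSpace ℝ (Fin m)} (ha : ‖a‖ = 1) {p : ℝ} (hp : p < k + N / 2) :
    ∫⁻ w : Sph m n, ENNReal.ofReal (‖(w : Ambient m n).snd‖ ^ (2 * k)) *
        ENNReal.ofReal ((2 - 2 * inner ℝ (pole n a) (w : Ambient m n)) ^ (-p)) ∂(surf m n)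
      = ENNReal.ofReal (2 * Real.pi ^ ((N : ℝ) / 2) *
        (Real.Gamma (k + n / 2) / Real.Gamma (n / 2)) * 2 ^ (2 * k + N - 1 - 2 * p) *
        Real.Gamma (k + N / 2 - p) / Real.Gamma (2 * k + N - p)) := by
  have hN0 : (0 : ℝ) < N := by exact_mod_cast (by omega : 0 < N)
  have hn0 : (0 : ℝ) < n := by exact_mod_cast (by omega : 0 < n)
  have p1 : 0 < Real.Gamma (k + N / 2) := Real.Gamma_pos_of_pos (by positivity)
  have p3 : 0 < Real.Gamma (n / 2) := Real.Gamma_pos_of_pos (by positivity)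
  have p4 : 0 < Real.Gamma (k + n / 2) := Real.Gamma_pos_of_pos (by positivity)
  rw [lintegral_snd_pow_mul h hm hn k ha (g := fun t => ENNReal.ofReal ((2 - 2 * t) ^ (-p)))
    (by fun_prop)]
  have e : ∀ t ∈ Ioo (-1 : ℝ) 1, ENNReal.ofReal ((1 - t ^ 2) ^ ((k : ℝ) + N / 2 - 1)) *
      ENNReal.ofReal ((2 - 2 * t) ^ (-p)) = ENNReal.ofReal (2 ^ (-p)) *
      ENNReal.ofReal ((1 - t) ^ (((k : ℝ) + N / 2 - p) - 1) * (1 + t) ^ ((k : ℝ) + N / 2 - 1)) := by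
    intro t ht
    have h1 : 0 < 1 - t := by linarith [ht.2]
    have h2 : 0 < 1 + t := by linarith [ht.1]
    rw [show 1 - t ^ 2 = (1 - t) * (1 + t) by ring, show 2 - 2 * t = 2 * (1 - t) by ring,
      ← ENNReal.ofReal_mul (by positivity), ← ENNReal.ofReal_mul (by positivity),
      Real.mul_rpow h1.le h2.le, Real.mul_rpow two_pos.le h1.le,
      show (k : ℝ) + N / 2 - p - 1 = (k + N / 2 - 1) + -p by ring, Real.rpow_add h1]
    congr 1
    ring
  rw [setLIntegral_congr_fun measurableSet_Ioo e, lintegral_const_mul' _ _ ENNReal.ofReal_ne_top,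
    lintegral_beta (by linarith) (by positivity), ← ENNReal.ofReal_mul (by positivity),
    ← ENNReal.ofReal_mul (by positivity)]
  congr 1
  rw [ProbabilityTheory.beta, show (k : ℝ) + N / 2 + (k + N / 2 - p) = 2 * k + N - p by ring,
    show (2 * k + N - 1 - 2 * p : ℝ) = -p + (k + N / 2 - p + (k + N / 2) - 1) by ring,
    Real.rpow_add two_pos]
  field_simp

/-! ### Isometries of the sphere and the orbits of `O(m) × O(n)` -/

section Isometries

theorem exists_isometry_apply_eq {E : Type*} [NormedAddCommGroup E] [InnerProductSpace ℝ E]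
    {x y : E} (h : ‖x‖ = ‖y‖) : ∃ R : E ≃ₗᵢ[ℝ] E, R x = y :=
  ⟨_, Submodule.reflection_sub h⟩

variable {m n : ℕ}

/-- The restriction of a linear isometry to the sphere. -/
def sphMap (R : Ambient m n ≃ₗᵢ[ℝ] Ambient m n) (z : Sph m n) : Sph m n := ⟨R z, by simp⟩

theorem coe_sphMap (R : Ambient m n ≃ₗᵢ[ℝ] Ambient m n) (z : Sph m n) :
    (sphMap R z : Ambient m n) = R z := rfl

theorem continuous_sphMap (R : Ambient m n ≃ₗᵢ[ℝ] Ambient m n) : Continuous (sphMap R) :=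
  (R.continuous.comp continuous_subtype_val).subtype_mk _

/-- Linear isometries preserve the surface measure. -/
theorem measurePreserving_sphMap (R : Ambient m n ≃ₗᵢ[ℝ] Ambient m n) :
    MeasurePreserving (sphMap R) (surf m n) (surf m n) := by
  have hmeas := (continuous_sphMap R).measurable
  refine ⟨hmeas, ?_⟩
  ext s hs
  have hs' := hmeas hs
  rw [Measure.map_apply hmeas hs, surf, Measure.toSphere_apply' _ hs,
    Measure.toSphere_apply' _ hs']
  congr 1
  have hpre : R ⁻¹' (Ioo (0 : ℝ) 1 • ((↑) '' s : Set (Ambient m n)))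
      = Ioo (0 : ℝ) 1 • ((↑) '' (sphMap R ⁻¹' s) : Set (Ambient m n)) := by
    ext x
    simp only [mem_preimage, Set.mem_smul, mem_image]
    constructor
    · rintro ⟨r, hr, _, ⟨z, hz, rfl⟩, h⟩
      have hmem : R.symm z ∈ Metric.sphere (0 : Ambient m n) 1 := by simp
      have hact : sphMap R ⟨_, hmem⟩ = z := by ext1; simp [sphMap]
      refine ⟨r, hr, _, ⟨⟨_, hmem⟩, by rwa [hact], rfl⟩, ?_⟩
      apply R.injective
      simpa using h
    · rintro ⟨r, hr, _, ⟨z, hz, rfl⟩, rfl⟩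
      exact ⟨r, hr, _, ⟨sphMap R z, hz, rfl⟩, by simp [sphMap]⟩
  rw [← hpre]
  exact (R.measurePreserving).measure_preimage_equiv (f := R.toMeasurableEquiv) _

theorem act_eq_sphMap (A : OrthGroup m) (B : OrthGroup n) :
    act A B = sphMap (blockIsometry A B) := rfl

theorem blockIsometry_fst (A : OrthGroup m) (B : OrthGroup n) (z : Ambient m n) :
    (blockIsometry A B z).fst = A z.fst := rfl

theorem blockIsometry_snd (A : OrthGroup m) (B : OrthGroup n) (z : Ambient m n) :
    (blockIsometry A B z).snd = B z.snd := rfl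

theorem ambient_ext {z w : Ambient m n} (h1 : z.fst = w.fst) (h2 : z.snd = w.snd) : z = w := by
  apply WithLp.ofLp_injective
  exact Prod.ext h1 h2

theorem f_act (A : OrthGroup m) (B : OrthGroup n) (z : Sph m n) : f (act A B z) = f z := by
  rw [act_eq_sphMap, f, f, coe_sphMap, blockIsometry_fst, blockIsometry_snd]
  simp

/-- `O(m) × O(n)` acts transitively on the level sets of `f`. -/
theorem exists_act_eq {z w : Sph m n} (h : f z = f w) : ∃ A B, act A B z = w := by
  have h1 : ‖(z : Ambient m n).fst‖ = ‖(w : Ambient m n).fst‖ := by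
    rw [← sq_eq_sq₀ (norm_nonneg _) (norm_nonneg _), norm_fst_sq, norm_fst_sq, h]
  have h2 : ‖(z : Ambient m n).snd‖ = ‖(w : Ambient m n).snd‖ := by
    rw [← sq_eq_sq₀ (norm_nonneg _) (norm_nonneg _), norm_snd_sq, norm_snd_sq, h]
  obtain ⟨A, hA⟩ := exists_isometry_apply_eq h1
  obtain ⟨B, hB⟩ := exists_isometry_apply_eq h2
  exact ⟨A, B, Subtype.ext (ambient_ext hA hB)⟩

/-- A point of the quarter circle through the two poles. -/
def arcPoint (a : EuclideanSpace ℝ (Fin m)) (b : EuclideanSpace ℝ (Fin n)) (c s : ℝ) :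
    Ambient m n := WithLp.toLp 2 (c • a, s • b)

theorem arcPoint_mem {a : EuclideanSpace ℝ (Fin m)} {b : EuclideanSpace ℝ (Fin n)} (ha : ‖a‖ = 1)
    (hb : ‖b‖ = 1) {c s : ℝ} (h : c ^ 2 + s ^ 2 = 1) :
    arcPoint a b c s ∈ Metric.sphere (0 : Ambient m n) 1 := by
  rw [mem_sphere_zero_iff_norm, WithLp.prod_norm_eq_of_L2]
  simp [arcPoint, norm_smul, ha, hb, h]

theorem f_arcPoint {a : EuclideanSpace ℝ (Fin m)} {b : EuclideanSpace ℝ (Fin n)} (ha : ‖a‖ = 1)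
    (hb : ‖b‖ = 1) {c s : ℝ} (h : arcPoint a b c s ∈ Metric.sphere (0 : Ambient m n) 1) :
    f ⟨arcPoint a b c s, h⟩ = c ^ 2 - s ^ 2 := by
  simp [f, arcPoint, norm_smul, ha, hb]

theorem exists_norm_eq_one {k : ℕ} (hk : 1 ≤ k) : ∃ a : EuclideanSpace ℝ (Fin k), ‖a‖ = 1 :=
  ⟨EuclideanSpace.single ⟨0, hk⟩ 1, by simp⟩

theorem sq_sqrt_half_add {t : ℝ} (ht : t ∈ Icc (-1 : ℝ) 1) :
    √((1 + t) / 2) ^ 2 = (1 + t) / 2 ∧ √((1 - t) / 2) ^ 2 = (1 - t) / 2 :=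
  ⟨Real.sq_sqrt (by linarith [ht.1]), Real.sq_sqrt (by linarith [ht.2])⟩

theorem f_surjOn (hm : 1 ≤ m) (hn : 1 ≤ n) {t : ℝ} (ht : t ∈ Icc (-1 : ℝ) 1) :
    ∃ z : Sph m n, f z = t := by
  obtain ⟨a, ha⟩ := exists_norm_eq_one hm
  obtain ⟨b, hb⟩ := exists_norm_eq_one hn
  obtain ⟨h1, h2⟩ := sq_sqrt_half_add ht
  refine ⟨⟨arcPoint a b √((1 + t) / 2) √((1 - t) / 2), arcPoint_mem ha hb ?_⟩, ?_⟩
  · rw [h1, h2]; ring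
  · rw [f_arcPoint ha hb, h1, h2]; ring

/-- A continuous function that is constant on the orbits is a continuous function of `f`. -/
theorem exists_continuous_comp_f (hm : 1 ≤ m) (hn : 1 ≤ n) {T : Ambient m n → ℝ}
    (hT : Continuous T) (hinv : ∀ A B, ∀ z : Sph m n, T (act A B z) = T z) :
    ∃ w : ℝ → ℝ, Continuous w ∧ ∀ z : Sph m n, T z = w (f z) := by
  obtain ⟨a, ha⟩ := exists_norm_eq_one hm
  obtain ⟨b, hb⟩ := exists_norm_eq_one hn
  -- The quarter circle from `(0, b)` to `(a, 0)` meets every orbit, and this parametrization of it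
  -- is a continuous section of `f`. Square roots of negative numbers being 0, it is continuous on
  -- all of `ℝ`.
  refine ⟨fun t => T (arcPoint a b √((1 + t) / 2) √((1 - t) / 2)), ?_, fun z => ?_⟩
  · refine hT.comp ?_
    unfold arcPoint
    fun_prop
  · obtain ⟨h1, h2⟩ := sq_sqrt_half_add (f_mem_Icc z)
    have hmem : arcPoint a b √((1 + f z) / 2) √((1 - f z) / 2)
        ∈ Metric.sphere (0 : Ambient m n) 1 := arcPoint_mem ha hb (by rw [h1, h2]; ring)
    obtain ⟨A, B, hAB⟩ := exists_act_eq (z := z) (w := ⟨_, hmem⟩) (by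
      rw [f_arcPoint ha hb, h1, h2]; ring)
    rw [← hinv A B z, hAB]

end Isometries

/-! ### Invariant functions are functions of `f`; the isometry `j` -/

section Range

variable {m n : ℕ}

instance : CompactSpace (Sph m n) := isCompact_iff_compactSpace.1 (isCompact_sphere _ _)

/-- The product of the coordinates `z_{p 0}, …, z_{p (d - 1)}` in an orthonormal basis. -/
def coordProd {d : ℕ} (p : Fin d → Fin (Module.finrank ℝ (Ambient m n))) (z : Ambient m n) : ℝ :=
  ∏ i, inner ℝ (stdOrthonormalBasis ℝ (Ambient m n) (p i)) z

theorem continuous_coordProd {d : ℕ} (p : Fin d → Fin (Module.finrank ℝ (Ambient m n))) :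
    Continuous (coordProd p) := by
  unfold coordProd
  fun_prop

/-- This exhibits the kernel `⟨z, w⟩^d` as a Gram kernel, which is what makes a sum of squares of
moments appear later. Monomials are indexed by words, with repetitions, so that no multinomial
coefficients occur. -/
theorem inner_pow_eq_sum (d : ℕ) (z w : Ambient m n) :
    (inner ℝ z w) ^ d = ∑ p : Fin d → Fin (Module.finrank ℝ (Ambient m n)),
      coordProd p z * coordProd p w := by
  rw [← (stdOrthonormalBasis ℝ (Ambient m n)).sum_inner_mul_inner z w, Finset.sum_pow']
  simp only [Fintype.piFinset_univ, coordProd, ← Finset.prod_mul_distrib]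
  refine Finset.sum_congr rfl fun p _ => Finset.prod_congr rfl fun i _ => ?_
  rw [real_inner_comm z]

/-- The coordinates separate points, so by Stone–Weierstrass the algebra they generate is dense in
the continuous functions, and these are dense in `L²`. -/
theorem eq_zero_of_forall_coordProd (v : Lp ℝ 2 (surf m n))
    (hv : ∀ (d : ℕ) (p : Fin d → Fin (Module.finrank ℝ (Ambient m n))),
      ∫ z : Sph m n, coordProd p z * v z ∂(surf m n) = 0) : v = 0 := by
  set L : C(Sph m n, ℝ) →L[ℝ] ℝ :=
    (innerSL ℝ v).comp (ContinuousMap.toLp (E := ℝ) 2 (surf m n) ℝ) with hL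
  have hLapp : ∀ g : C(Sph m n, ℝ), L g = ∫ z, g z * v z ∂(surf m n) := by
    intro g
    simp only [hL, ContinuousLinearMap.comp_apply, innerSL_apply_apply, L2.inner_def]
    refine integral_congr_ae ?_
    filter_upwards [ContinuousMap.coeFn_toLp (p := 2) (𝕜 := ℝ) (surf m n) g] with z hz
    rw [hz]
    simp
  set coords : Set C(Sph m n, ℝ) := Set.range fun i : Fin (Module.finrank ℝ (Ambient m n)) =>
    (⟨fun z => inner ℝ (stdOrthonormalBasis ℝ (Ambient m n) i) (z : Ambient m n), by fun_prop⟩ :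
      C(Sph m n, ℝ)) with hcoords
  have hmon : ∀ g ∈ Submonoid.closure coords, ∃ (d : ℕ)
      (p : Fin d → Fin (Module.finrank ℝ (Ambient m n))), ∀ z : Sph m n, g z = coordProd p z := by
    intro g hg
    induction hg using Submonoid.closure_induction_left with
    | one => exact ⟨0, Fin.elim0, fun z => by simp [coordProd]⟩
    | mul_left x hx y hy ih =>
      obtain ⟨i, rfl⟩ := hx
      obtain ⟨d, p, hp⟩ := ih
      refine ⟨d + 1, Fin.cons i p, fun z => ?_⟩
      simp only [ContinuousMap.mul_apply, hp z, coordProd, Fin.prod_univ_succ, Fin.cons_zero,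
        Fin.cons_succ]
      rfl
  have hsep : (Algebra.adjoin ℝ coords).SeparatesPoints := by
    intro z w hzw
    by_contra hcon
    push Not at hcon
    apply hzw
    refine Subtype.ext ?_
    refine (stdOrthonormalBasis ℝ (Ambient m n)).repr.injective ?_
    ext i
    rw [OrthonormalBasis.repr_apply_apply, OrthonormalBasis.repr_apply_apply]
    exact hcon _ ⟨_, Algebra.subset_adjoin ⟨i, rfl⟩, rfl⟩
  have hdense := ContinuousMap.subalgebra_topologicalClosure_eq_top_of_separatesPoints _ hsep
  have hker : ∀ g ∈ Algebra.adjoin ℝ coords, L g = 0 := by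
    intro g hg
    have hg' : g ∈ Submodule.span ℝ (Submonoid.closure coords : Set C(Sph m n, ℝ)) := by
      rw [← Algebra.adjoin_eq_span]; exact hg
    have hle : Submodule.span ℝ (Submonoid.closure coords : Set C(Sph m n, ℝ))
        ≤ LinearMap.ker L.toLinearMap := by
      refine Submodule.span_le.2 fun x hx => ?_
      obtain ⟨d, p, hp⟩ := hmon x hx
      change L x = 0
      rw [hLapp, ← hv d p]
      simp only [hp]
    exact hle hg'
  have hzero : ∀ g, L g = 0 := by
    intro g
    have hclosed : IsClosed {g | L g = 0} := isClosed_eq L.continuous continuous_const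
    have : g ∈ closure (Algebra.adjoin ℝ coords : Set C(Sph m n, ℝ)) := by
      rw [← Subalgebra.topologicalClosure_coe, hdense]; trivial
    exact closure_minimal (s := (Algebra.adjoin ℝ coords : Set C(Sph m n, ℝ))) hker hclosed this
  have hd := ContinuousMap.toLp_denseRange ℝ (surf m n) ℝ (p := 2) (by simp)
  have hall : ∀ x : Lp ℝ 2 (surf m n), inner ℝ v x = 0 := by
    intro x
    have hclosed : IsClosed {x : Lp ℝ 2 (surf m n) | inner ℝ v x = 0} :=
      isClosed_eq (by fun_prop) continuous_const
    refine hd.induction_on (p := fun x => inner ℝ v x = 0) x hclosed fun g => ?_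
    exact hzero g
  exact inner_self_eq_zero.1 (hall v)

/-- Composition with `f`, as an isometry of `L²_h` into `L²(𝕊^N)`. -/
def compF (hm : 2 ≤ m) (hn : 2 ≤ n) : Lp ℝ 2 (hMeasure m n) →ₗᵢ[ℝ] Lp ℝ 2 (surf m n) :=
  Lp.compMeasurePreservingₗᵢ ℝ f (measurePreserving_f hm hn)

theorem coeFn_compF (hm : 2 ≤ m) (hn : 2 ≤ n) (w : Lp ℝ 2 (hMeasure m n)) :
    compF hm hn w =ᵐ[surf m n] fun z => w (f z) :=
  Lp.coeFn_compMeasurePreserving w (measurePreserving_f hm hn)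

theorem compF_mem_L2G (hm : 2 ≤ m) (hn : 2 ≤ n) (w : Lp ℝ 2 (hMeasure m n)) :
    compF hm hn w ∈ L2G m n := by
  intro A B
  have h := coeFn_compF hm hn w
  filter_upwards [h, (measurePreserving_act A B).quasiMeasurePreserving.ae h] with z h1 h2
  rw [h1, h2, f_act]

/-- With `c p` the moments of `v` of degree `d`, the polynomial `T = ∑ c p · coordProd p` is `∫ ⟨·,
z⟩^d v(z) dz`. It inherits the invariance of `v`, so it is a continuous function of `f` on the
sphere and orthogonal to `v`; but its pairing with `v` is `∑ (c p)²`. -/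
theorem eq_zero_of_mem_L2G_of_orthogonal (hm : 1 ≤ m) (hn : 1 ≤ n) {v : Lp ℝ 2 (surf m n)}
    (hv : v ∈ L2G m n)
    (hort : ∀ w : ℝ → ℝ, Continuous w → ∫ z, w (f z) * v z ∂(surf m n) = 0) : v = 0 := by
  have hint : ∀ {d : ℕ} (p : Fin d → Fin (Module.finrank ℝ (Ambient m n))),
      Integrable (fun z : Sph m n => coordProd p z * v z) (surf m n) := by
    intro d p
    have h1 : MemLp (fun z : Sph m n => coordProd p (z : Ambient m n)) 2 (surf m n) := by
      have hc : Continuous fun z : Sph m n => coordProd p (z : Ambient m n) :=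
        (continuous_coordProd p).comp continuous_subtype_val
      obtain ⟨K, hK⟩ := (isCompact_univ (X := Sph m n)).exists_bound_of_continuousOn hc.continuousOn
      exact MemLp.of_bound hc.aestronglyMeasurable K (Eventually.of_forall fun z => hK z trivial)
    exact h1.integrable_mul (Lp.memLp v)
  refine eq_zero_of_forall_coordProd v fun d => ?_
  set c : (Fin d → Fin (Module.finrank ℝ (Ambient m n))) → ℝ :=
    fun p => ∫ z : Sph m n, coordProd p z * v z ∂(surf m n) with hc
  set T : Ambient m n → ℝ := fun x => ∑ p, coordProd p x * c p with hT
  have hTint : ∀ x : Ambient m n,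
      T x = ∫ z : Sph m n, (inner ℝ x (z : Ambient m n)) ^ d * v z ∂(surf m n) := by
    intro x
    simp only [hT, hc, ← integral_const_mul]
    rw [← integral_finsetSum _ fun p _ => (hint p).const_mul _]
    simp only [inner_pow_eq_sum, Finset.sum_mul, mul_assoc]
  have hTc : Continuous T := by
    refine continuous_finsetSum _ fun p _ => (continuous_coordProd p).mul continuous_const
  -- The substitution `w ↦ (A, B) w` preserves the measure and `v`, and moves the isometry into both
  -- slots of the inner product, where it cancels.
  have hTinv : ∀ A B, ∀ z : Sph m n, T (act A B z) = T z := by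
    intro A B z
    rw [hTint, hTint]
    have hme : MeasurableEmbedding (act A B : Sph m n → Sph m n) := by
      have hcont : Continuous (act A B : Sph m n → Sph m n) := continuous_sphMap _
      refine (hcont.isClosedEmbedding fun x y hxy => ?_).measurableEmbedding
      exact Subtype.ext ((blockIsometry A B).injective (congrArg Subtype.val hxy))
    rw [← (measurePreserving_act A B).integral_comp hme]
    refine integral_congr_ae ?_
    filter_upwards [hv A B] with w hw
    simp only [hw]
    congr 2
    exact (blockIsometry A B).inner_map_map z w
  obtain ⟨w, hwc, hw⟩ := exists_continuous_comp_f hm hn hTc hTinv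
  have h1 : ∫ z : Sph m n, T z * v z ∂(surf m n) = 0 := by
    simp only [hw]
    exact hort w hwc
  have h2 : ∑ p, c p * c p = 0 := by
    rw [← h1]
    simp only [hT, Finset.sum_mul]
    rw [integral_finsetSum _ fun p _ => ?_]
    · refine Finset.sum_congr rfl fun p _ => ?_
      rw [hc, ← integral_const_mul]
      refine integral_congr_ae (Eventually.of_forall fun z => ?_)
      simp only
      ring
    · refine ((hint p).const_mul (c p)).congr (Eventually.of_forall fun z => ?_)
      simp only
      ring
  intro p
  have := (Finset.sum_eq_zero_iff_of_nonneg fun p _ => mul_self_nonneg (c p)).1 h2 p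
    (Finset.mem_univ p)
  exact mul_self_eq_zero.1 this

/-- The range of composition with `f` is `L²(𝕊^N)^G`. -/
theorem range_compF (hm : 2 ≤ m) (hn : 2 ≤ n) :
    LinearMap.range (compF hm hn : Lp ℝ 2 (hMeasure m n) →ₗᵢ[ℝ] Lp ℝ 2 (surf m n)).toLinearMap
      = L2G m n := by
  set U := LinearMap.range (compF hm hn).toLinearMap with hU
  have hle : U ≤ L2G m n := by
    rintro _ ⟨w, rfl⟩
    exact compF_mem_L2G hm hn w
  refine le_antisymm hle fun u hu => ?_
  have hcomp : IsComplete (U : Set (Lp ℝ 2 (surf m n))) := by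
    rw [hU, LinearMap.coe_range]
    exact (compF hm hn).isometry.isUniformInducing.isComplete_range
  have : CompleteSpace U := hcomp.completeSpace_coe
  have h1 : U.starProjection u ∈ U := Submodule.starProjection_apply_mem _ _
  have h2 : u - U.starProjection u ∈ Uᗮ := Submodule.sub_starProjection_mem_orthogonal u
  -- The range is complete, hence has an orthogonal projection; the remainder of `u` is invariant
  -- and orthogonal to the range, so it vanishes.
  have h3 := eq_zero_of_mem_L2G_of_orthogonal (by omega) (by omega) ((L2G m n).sub_mem hu (hle h1)) fun w hw => by
    have hwm : MemLp w 2 (hMeasure m n) := memLp_of_continuousOn hm hn hw.continuousOn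
    have h0 := h2 _ ⟨hwm.toLp w, rfl⟩
    rw [L2.inner_def] at h0
    rw [← h0]
    refine integral_congr_ae ?_
    filter_upwards [coeFn_compF hm hn (hwm.toLp w),
      (measurePreserving_f hm hn).quasiMeasurePreserving.ae hwm.coeFn_toLp] with z h2 h3
    have h4 : ((compF hm hn).toLinearMap (hwm.toLp w) : Sph m n → ℝ) z = w (f z) := h2.trans h3
    rw [h4]
    simp [mul_comm]
  rw [sub_eq_zero.1 h3]
  exact h1

/-- The isometry `u = w ∘ f ↦ w`. -/
def jMap (hm : 2 ≤ m) (hn : 2 ≤ n) : L2G m n ≃ₗᵢ[ℝ] Lp ℝ 2 (hMeasure m n) :=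
  (LinearIsometryEquiv.ofEq _ _ (range_compF hm hn).symm).trans (compF hm hn).equivRange.symm

theorem compF_jMap (hm : 2 ≤ m) (hn : 2 ≤ n) (u : L2G m n) :
    compF hm hn (jMap hm hn u) = (u : Lp ℝ 2 (surf m n)) := by
  have h := (compF hm hn).equivRange.apply_symm_apply
    (LinearIsometryEquiv.ofEq _ _ (range_compF hm hn).symm u)
  exact congrArg Subtype.val h

/-- A property that holds at `f z` for almost every `z` holds almost everywhere, measurable
or not. -/
theorem ae_of_ae_comp_f (hm : 2 ≤ m) (hn : 2 ≤ n) {P : ℝ → Prop}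
    (h : ∀ᵐ z ∂(surf m n), P (f z)) : ∀ᵐ t ∂(hMeasure m n), P t := by
  rw [ae_iff] at h ⊢
  refine le_antisymm (ENNReal.le_of_forall_pos_le_add fun ε hε _ => ?_) zero_le
  -- Outer regularity encloses the bad set, a full preimage under `f`, in a small open `U`. The
  -- image of the compact complement of `U` is compact, hence measurable, and avoids every bad `t`.
  obtain ⟨U, hU, hUo, hUlt⟩ := Set.exists_isOpen_lt_of_lt {z : Sph m n | ¬ P (f z)} (ε : ℝ≥0∞) (by
    rw [h]; exact_mod_cast hε)
  have hfc : Continuous (f : Sph m n → ℝ) := by unfold f; fun_prop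
  have hK : IsCompact (f '' Uᶜ) := (hUo.isClosed_compl.isCompact).image hfc
  calc hMeasure m n {t | ¬ P t} ≤ hMeasure m n (f '' Uᶜ)ᶜ := by
        refine measure_mono fun t ht => ?_
        rintro ⟨z, hz, rfl⟩
        exact hz (hU ht)
    _ = surf m n (f ⁻¹' (f '' Uᶜ)ᶜ) :=
        ((measurePreserving_f hm hn).measure_preimage hK.measurableSet.compl.nullMeasurableSet).symm
    _ ≤ surf m n U := by
        refine measure_mono fun z hz => ?_
        by_contra hzU
        exact hz ⟨z, hzU, rfl⟩
    _ ≤ 0 + ε := by rw [zero_add]; exact hUlt.le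

/-- No measurability is asked of `w`. The forward direction therefore contains the uniqueness of `w`
among all functions, and rests on `ae_of_ae_comp_f`; the backward direction contains existence. -/
theorem ae_eq_comp_f_iff (hm : 2 ≤ m) (hn : 2 ≤ n) (u : L2G m n) (w : ℝ → ℝ) :
    ((u : Lp ℝ 2 (surf m n)) =ᵐ[surf m n] fun z => w (f z)) ↔ jMap hm hn u =ᵐ[hMeasure m n] w := by
  have h0 := coeFn_compF hm hn (jMap hm hn u)
  rw [compF_jMap] at h0
  constructor
  · intro h
    refine ae_of_ae_comp_f hm hn ?_
    filter_upwards [h0, h] with z h1 h2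
    rw [← h1, h2]
  · intro h
    filter_upwards [h0, (measurePreserving_f hm hn).quasiMeasurePreserving.ae h] with z h1 h2
    rw [h1, h2]

end Range

/-! ### Rising factorials and a Saalschütz summation -/

/-- The rising factorial `x (x + 1) ⋯ (x + k - 1)`. -/
def rising (x : ℝ) (k : ℕ) : ℝ := ∏ j ∈ Finset.range k, (x + j)

theorem rising_zero (x : ℝ) : rising x 0 = 1 := by simp [rising]

theorem rising_succ (x : ℝ) (k : ℕ) : rising x (k + 1) = rising x k * (x + k) :=
  Finset.prod_range_succ _ _

theorem rising_succ' (x : ℝ) (k : ℕ) : rising x (k + 1) = x * rising (x + 1) k := by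
  rw [rising, Finset.prod_range_succ', mul_comm, rising]
  congr 1
  · simp
  · exact Finset.prod_congr rfl fun j _ => by push_cast; ring

theorem rising_pos {x : ℝ} (hx : 0 < x) (k : ℕ) : 0 < rising x k :=
  Finset.prod_pos fun _ _ => by positivity

theorem Gamma_add_nat {x : ℝ} (hx : ∀ k : ℕ, x ≠ -k) (k : ℕ) :
    Real.Gamma (x + k) = rising x k * Real.Gamma x := by
  induction k with
  | zero => simp [rising_zero]
  | succ k ih =>
    have : x + k ≠ 0 := fun h => hx k (by linarith)
    rw [Nat.cast_succ, ← add_assoc, Real.Gamma_add_one this, ih, rising_succ]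
    ring

/-- The case of the Pfaff-Saalschütz summation that gives the spectrum of the fractional
Laplacian. -/
theorem sum_saalschutz {c s : ℝ} (hc : 0 < c) (hs : 0 < s) (hcs : 1 / 2 < c + s) (i : ℕ) :
    ∑ k ∈ Finset.range (i + 1), (-1) ^ k * (i.choose k : ℝ) * rising (c + s - 1 / 2 + i) k *
      rising (-s) k * 4 ^ k / rising c (2 * k) = rising (c + 2 * s) (2 * i) / rising c (2 * i) := by
  induction i with
  | zero => simp [rising_zero]
  | succ i ih =>
    have hA : 0 < c + s - 1 / 2 + i := by
      have : (0 : ℝ) ≤ i := i.cast_nonneg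
      linarith
    obtain ⟨A, hAdef⟩ : ∃ A, A = c + s - 1 / 2 + i := ⟨_, rfl⟩
    -- `ρ` is the quotient of the right-hand sides for `i` and `i + 1`, so the induction step says
    -- that `ρ` times the new sum equals the old sum.
    obtain ⟨ρ, hρ⟩ : ∃ ρ, ρ = (c + 2 * i) * (c + 2 * i + 1) /
        ((c + 2 * s + 2 * i) * (c + 2 * s + 2 * i + 1)) := ⟨_, rfl⟩
    have hi : (0 : ℝ) ≤ i := i.cast_nonneg
    have hρ0 : ρ ≠ 0 := by rw [hρ]; positivity
    -- A telescoping certificate for that difference of sums. Its boundary values vanish: at `k = 0`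
    -- by the factor `k`, at `k = i + 2` by the binomial coefficient.
    set U : ℕ → ℝ := fun k => (ρ - 1) / (4 * s) * ((-1) ^ k * ((i + 1).choose k : ℝ) * rising A k *
      rising (-s) k * 4 ^ k / rising c (2 * k)) * (k * (c + 2 * k - 1) * (c + 2 * k - 2)) /
      ((i + 1) * A) with hU
    have hstep : ∀ k ∈ Finset.range (i + 2), ρ * ((-1) ^ k * ((i + 1).choose k : ℝ) *
        rising (c + s - 1 / 2 + (i + 1 : ℕ)) k * rising (-s) k * 4 ^ k / rising c (2 * k)) -
        (-1) ^ k * (i.choose k : ℝ) * rising A k * rising (-s) k * 4 ^ k / rising c (2 * k)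
        = U (k + 1) - U k := by
      intro k hk
      have hki : k ≤ i + 1 := by have := Finset.mem_range.1 hk; omega
      obtain ⟨b, hb⟩ : ∃ b : ℝ, b = ((i + 1).choose k : ℝ) := ⟨_, rfl⟩
      have e1 : (i.choose k : ℝ) = b * (i + 1 - k) / (i + 1) := by
        rw [eq_div_iff (by positivity), hb]
        have := Nat.choose_mul_succ_eq i k
        have h2 : ((i + 1 - k : ℕ) : ℝ) = i + 1 - k := by
          rw [Nat.cast_sub hki]; push_cast; ring
        rw [← h2]
        exact_mod_cast this
      have e2 : ((i + 1).choose (k + 1) : ℝ) = b * (i + 1 - k) / (k + 1) := by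
        rw [eq_div_iff (by positivity), hb]
        have := Nat.choose_succ_right_eq (i + 1) k
        have h2 : ((i + 1 - k : ℕ) : ℝ) = i + 1 - k := by
          rw [Nat.cast_sub hki]; push_cast; ring
        rw [← h2]
        exact_mod_cast this
      have e3 : rising (c + s - 1 / 2 + (i + 1 : ℕ)) k = rising A k * (A + k) / A := by
        rw [eq_div_iff (by rw [hAdef]; exact hA.ne'), ← rising_succ, rising_succ', hAdef, mul_comm]
        congr 2
        push_cast
        ring
      have e4 : rising c (2 * (k + 1)) = rising c (2 * k) * (c + 2 * k) * (c + 2 * k + 1) := by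
        rw [show 2 * (k + 1) = 2 * k + 1 + 1 by ring, rising_succ, rising_succ]
        push_cast
        ring
      have hz := rising_pos hc (2 * k)
      simp only [hU, e1, e2, e3, e4, rising_succ, ← hb]
      generalize rising c (2 * k) = z at *
      generalize rising A k = x
      generalize rising (-s) k = y
      have hA' : A ≠ 0 := by rw [hAdef]; exact hA.ne'
      have hk0 : (0 : ℝ) ≤ k := k.cast_nonneg
      have n1 : c + 2 * (k : ℝ) ≠ 0 := by positivity
      have n2 : c + 2 * (k : ℝ) + 1 ≠ 0 := by positivity
      have n3 : (i : ℝ) + 1 ≠ 0 := by positivity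
      have n4 : (k : ℝ) + 1 ≠ 0 := by positivity
      -- The telescoping relation with the common hypergeometric factor divided out: a rational
      -- identity in `c`, `s`, `i`, `k`.
      have main : ρ * (i + 1) * (A + k) - A * (i + 1 - k)
          = -((ρ - 1) / s) * (A + k) * (k - s) * (i + 1 - k)
            - (ρ - 1) / (4 * s) * k * (c + 2 * k - 1) * (c + 2 * k - 2) := by
        rw [hρ, hAdef]
        have n5 : c + 2 * s + 2 * (i : ℝ) ≠ 0 := by positivity
        have n6 : c + 2 * s + 2 * (i : ℝ) + 1 ≠ 0 := by positivity
        field_simp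
        ring
      have hz' := hz.ne'
      push_cast
      rw [pow_succ (-1 : ℝ), pow_succ (4 : ℝ)]
      have l1 : ρ * ((-1) ^ k * b * (x * (A + k) / A) * y * 4 ^ k / z) -
          (-1) ^ k * (b * (i + 1 - k) / (i + 1)) * x * y * 4 ^ k / z
          = ((-1) ^ k * b * x * y * 4 ^ k / z / ((i + 1) * A)) *
            (ρ * (i + 1) * (A + k) - A * (i + 1 - k)) := by
        field_simp
      rw [l1, main]
      field_simp
      ring
    have hsum := Finset.sum_congr rfl hstep
    rw [Finset.sum_range_sub, Finset.sum_sub_distrib, ← Finset.mul_sum] at hsum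
    have hU0 : U 0 = 0 := by simp [hU]
    have hU1 : U (i + 2) = 0 := by simp [hU]
    rw [hU0, hU1, sub_zero, Finset.sum_range_succ (fun k => (-1) ^ k * (i.choose k : ℝ) * rising A k *
      rising (-s) k * 4 ^ k / rising c (2 * k)), hAdef, ih,
      Nat.choose_eq_zero_of_lt (show i < i + 1 by omega), sub_eq_zero] at hsum
    simp only [Nat.cast_zero, mul_zero, zero_mul, zero_div, add_zero] at hsum
    rw [show i + 1 + 1 = i + 2 by ring]
    refine mul_left_cancel₀ hρ0 (hsum.trans ?_)
    rw [show 2 * (i + 1) = 2 * i + 1 + 1 by ring]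
    simp only [rising_succ]
    have h1 := rising_pos hc (2 * i)
    push_cast
    rw [hρ]
    field_simp
    ring

/-! ### The Jacobi polynomials as a Hilbert basis of `L²_h` -/

section Spectral

variable {m n : ℕ}

theorem alpha_nonneg (hn : 2 ≤ n) : 0 ≤ alpha n := by
  have hn' : (2 : ℝ) ≤ n := by exact_mod_cast hn
  unfold alpha; linarith

theorem beta_nonneg (hm : 2 ≤ m) : 0 ≤ beta m := by
  have hm' : (2 : ℝ) ≤ m := by exact_mod_cast hm
  unfold beta; linarith

theorem weight_nonneg (hm : 2 ≤ m) (hn : 2 ≤ n) {t : ℝ} (ht : t ∈ Icc (-1 : ℝ) 1) :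
    0 ≤ weight m n t := by
  have h1 : 0 ≤ 1 - t := by linarith [ht.2]
  have h2 : 0 ≤ 1 + t := by linarith [ht.1]
  have := sphereArea_pos (show 1 ≤ m by omega)
  have := sphereArea_pos (show 1 ≤ n by omega)
  unfold weight
  positivity

theorem integral_hMeasure (hm : 2 ≤ m) (hn : 2 ≤ n) (g : ℝ → ℝ) :
    ∫ t, g t ∂(hMeasure m n) = ∫ t in (-1 : ℝ)..1, weight m n t * g t := by
  rw [hMeasure, integral_withDensity_eq_integral_toReal_smul
    (continuous_weight hm hn).measurable.ennreal_ofReal (Eventually.of_forall fun _ => by simp),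
    intervalIntegral.integral_of_le (by norm_num), integral_Icc_eq_integral_Ioc]
  refine setIntegral_congr_fun measurableSet_Ioc fun t ht => ?_
  rw [ENNReal.toReal_ofReal (weight_nonneg hm hn ⟨ht.1.le, ht.2⟩), smul_eq_mul]

theorem integral_comp_f (hm : 2 ≤ m) (hn : 2 ≤ n) {g : ℝ → ℝ}
    (hg : AEStronglyMeasurable g (hMeasure m n)) :
    ∫ z, g (f z) ∂(surf m n) = ∫ t, g t ∂(hMeasure m n) := by
  have hmap := (measurePreserving_f hm hn).map_eq
  have h := integral_map (μ := surf m n) measurable_f.aemeasurable (f := g) (by rwa [hmap])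
  rw [hmap] at h
  exact h.symm

theorem continuous_pJac (i : ℕ) : Continuous (pJac m n i) :=
  (Polynomial.continuous _).div_const _

/-- The Jacobi polynomials `P_i` as used for `L²_h`. -/
abbrev jac (m n i : ℕ) : ℝ[X] := jacobi (alpha n) (beta m) i

theorem integrable_hMeasure_of_continuous (hm : 2 ≤ m) (hn : 2 ≤ n) {g : ℝ → ℝ}
    (hg : Continuous g) : Integrable g (hMeasure m n) := by
  have := isFiniteMeasure_hMeasure hm hn
  exact (memLp_of_continuousOn hm hn hg.continuousOn).integrable (by norm_num)

/-- Orthogonality of the Jacobi polynomials. -/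
theorem integral_jac_mul_jac (hm : 2 ≤ m) (hn : 2 ≤ n) {i j : ℕ} (hij : i ≠ j) :
    ∫ t, (jac m n i).eval t * (jac m n j).eval t ∂(hMeasure m n) = 0 := by
  have ha := alpha_nonneg hn
  have hb := beta_nonneg hm
  set P := jac m n i with hP
  set Q := jac m n j with hQ
  have hPe := jacobi_equation (alpha n) (beta m) (by linarith) (by linarith) i
  rw [show jacobi (alpha n) (beta m) i = P from rfl] at hPe
  have hQe := jacobi_equation (alpha n) (beta m) (by linarith) (by linarith) j
  rw [show jacobi (alpha n) (beta m) j = Q from rfl] at hQe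
  set C := sphereArea m * sphereArea n / 2 ^ (((m : ℝ) + n) / 2) with hC
  -- Lagrange's identity: the derivative of the weighted Wronskian `F` is the difference of the two
  -- Jacobi eigenvalues times the integrand, and `F` vanishes at both endpoints because the
  -- exponents `α + 1`, `β + 1` are positive.
  set F : ℝ → ℝ := fun t => C * (1 - t) ^ (alpha n + 1) * (1 + t) ^ (beta m + 1) *
    (P.derivative.eval t * Q.eval t - P.eval t * Q.derivative.eval t) with hF
  have hFc : Continuous F := by
    refine ((continuous_const.mul ((Real.continuous_rpow_const (by linarith)).comp
      (continuous_const.sub continuous_id))).mul ((Real.continuous_rpow_const (by linarith)).comp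
      (continuous_const.add continuous_id))).mul ?_
    fun_prop
  have hderiv : ∀ t ∈ Ioo (-1 : ℝ) 1, HasDerivAt F
      ((j * (j + alpha n + beta m + 1) - i * (i + alpha n + beta m + 1)) *
        (weight m n t * (P.eval t * Q.eval t))) t := by
    intro t ht
    have h1 : 0 < 1 - t := by linarith [ht.2]
    have h2 : 0 < 1 + t := by linarith [ht.1]
    have d1 : HasDerivAt (fun t : ℝ => (1 - t) ^ (alpha n + 1))
        (-1 * (alpha n + 1) * (1 - t) ^ (alpha n + 1 - 1)) t :=
      ((hasDerivAt_id t).const_sub 1).rpow_const (Or.inl h1.ne')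
    have d2 : HasDerivAt (fun t : ℝ => (1 + t) ^ (beta m + 1))
        (1 * (beta m + 1) * (1 + t) ^ (beta m + 1 - 1)) t :=
      ((hasDerivAt_id t).const_add 1).rpow_const (Or.inl h2.ne')
    have d3 := ((P.derivative.hasDerivAt t).mul (Q.hasDerivAt t)).sub
      ((P.hasDerivAt t).mul (Q.derivative.hasDerivAt t))
    have d4 := ((d1.const_mul C).mul d2).mul d3
    refine d4.congr_deriv ?_
    have e1 := hPe t
    have e2 := hQe t
    simp only [Pi.mul_apply, Pi.sub_apply, add_sub_cancel_right, weight, Real.rpow_add_one h1.ne',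
      Real.rpow_add_one h2.ne', ← hC]
    linear_combination (C * (1 - t) ^ alpha n * (1 + t) ^ beta m) *
      (e1 * Q.eval t - e2 * P.eval t)
  have hint : IntervalIntegrable (fun t => (j * (j + alpha n + beta m + 1) -
      i * (i + alpha n + beta m + 1)) * (weight m n t * (P.eval t * Q.eval t))) volume (-1) 1 := by
    refine Continuous.intervalIntegrable ?_ _ _
    have := continuous_weight hm hn
    fun_prop
  have key := intervalIntegral.integral_eq_sub_of_hasDerivAt_of_le (by norm_num) hFc.continuousOn
    hderiv hint
  have hF1 : F 1 = 0 := by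
    simp only [hF, sub_self, Real.zero_rpow (by linarith : alpha n + 1 ≠ 0)]
    ring
  have hF2 : F (-1) = 0 := by
    simp only [hF, add_neg_cancel, Real.zero_rpow (by linarith : beta m + 1 ≠ 0)]
    ring
  rw [hF1, hF2, sub_zero, intervalIntegral.integral_const_mul] at key
  rw [integral_hMeasure hm hn]
  refine (mul_eq_zero.1 key).resolve_left ?_
  have hij' : (j : ℝ) - i ≠ 0 := sub_ne_zero.2 (by exact_mod_cast hij.symm)
  have : (j : ℝ) * (j + alpha n + beta m + 1) - i * (i + alpha n + beta m + 1)
      = (j - i) * (j + i + alpha n + beta m + 1) := by ring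
  rw [this]
  have hi : (0 : ℝ) ≤ i := i.cast_nonneg
  have hj : (0 : ℝ) ≤ j := j.cast_nonneg
  exact mul_ne_zero hij' (by positivity)

instance : (surf m n).IsOpenPosMeasure := by unfold surf; infer_instance

/-- If the integral vanished, `P ∘ f` would be zero almost everywhere on the sphere, hence
everywhere, since nonempty open sets have positive surface measure. As `f` is onto `[-1, 1]`, `P`
would have infinitely many roots. -/
theorem integral_sq_eval_pos (hm : 2 ≤ m) (hn : 2 ≤ n) {P : ℝ[X]} (hP : P ≠ 0) :
    0 < ∫ t, P.eval t ^ 2 ∂(hMeasure m n) := by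
  have hint := integrable_hMeasure_of_continuous hm hn (g := fun t => P.eval t ^ 2) (by fun_prop)
  refine lt_of_le_of_ne (integral_nonneg fun t => sq_nonneg _) fun h0 => hP ?_
  rw [eq_comm, integral_eq_zero_iff_of_nonneg (fun t => sq_nonneg _) hint] at h0
  have h1 := (measurePreserving_f hm hn).quasiMeasurePreserving.ae h0
  have hfc : Continuous (f : Sph m n → ℝ) := by unfold f; fun_prop
  have h2 : (fun z : Sph m n => P.eval (f z) ^ 2) = fun _ => 0 :=
    Continuous.ae_eq_iff_eq (surf m n) (by fun_prop) continuous_const |>.1 h1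
  refine Polynomial.eq_zero_of_infinite_isRoot P ?_
  refine (Icc_infinite (show (-1 : ℝ) < 1 by norm_num)).mono fun t ht => ?_
  obtain ⟨z, rfl⟩ := f_surjOn (by omega : 1 ≤ m) (by omega : 1 ≤ n) ht
  simpa using congrFun h2 z

theorem jac_ne_zero (m n i : ℕ) : jac m n i ≠ 0 := (jacobi_monic _ _ i).1.ne_zero

theorem memLp_pJac (hm : 2 ≤ m) (hn : 2 ≤ n) (i : ℕ) : MemLp (pJac m n i) 2 (hMeasure m n) :=
  memLp_of_continuousOn hm hn (continuous_pJac i).continuousOn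

/-- `p_i` as an element of `L²_h`. -/
def pLp (hm : 2 ≤ m) (hn : 2 ≤ n) (i : ℕ) : Lp ℝ 2 (hMeasure m n) := (memLp_pJac hm hn i).toLp

theorem hCoeff_eq_inner (hm : 2 ≤ m) (hn : 2 ≤ n) (w : Lp ℝ 2 (hMeasure m n)) (i : ℕ) :
    hCoeff m n w i = inner ℝ (pLp hm hn i) w := by
  rw [L2.inner_def, hCoeff]
  refine integral_congr_ae ?_
  filter_upwards [(memLp_pJac hm hn i).coeFn_toLp] with t ht
  rw [pLp, ht]
  simp

theorem inner_pLp (hm : 2 ≤ m) (hn : 2 ≤ n) (i j : ℕ) :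
    inner ℝ (pLp hm hn i) (pLp hm hn j) = ∫ t, pJac m n i t * pJac m n j t ∂(hMeasure m n) := by
  rw [L2.inner_def]
  refine integral_congr_ae ?_
  filter_upwards [(memLp_pJac hm hn i).coeFn_toLp, (memLp_pJac hm hn j).coeFn_toLp] with t ht ht'
  rw [pLp, pLp, ht, ht']
  simp [mul_comm]

theorem orthonormal_pLp (hm : 2 ≤ m) (hn : 2 ≤ n) : Orthonormal ℝ (pLp (m := m) (n := n) hm hn) := by
  classical
  rw [orthonormal_iff_ite]
  intro i j
  rw [inner_pLp]
  simp only [pJac, div_mul_div_comm, integral_div]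
  split_ifs with h
  · subst h
    have := integral_sq_eval_pos hm hn (jac_ne_zero m n i)
    rw [Real.mul_self_sqrt this.le]
    simp only [← sq]
    exact div_self this.ne'
  · rw [integral_jac_mul_jac hm hn h, zero_div]

theorem integral_mul_eq_zero_of_polynomial (hm : 2 ≤ m) (hn : 2 ≤ n) {v : ℝ → ℝ}
    (hv : MemLp v 2 (hMeasure m n)) (h : ∀ Q : ℝ[X], ∫ t, Q.eval t * v t ∂(hMeasure m n) = 0)
    {w : ℝ → ℝ} (hw : Continuous w) : ∫ t, w t * v t ∂(hMeasure m n) = 0 := by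
  have := isFiniteMeasure_hMeasure hm hn
  have hint : ∀ {g : ℝ → ℝ}, Continuous g → Integrable (fun t => g t * v t) (hMeasure m n) :=
    fun hg => (memLp_of_continuousOn hm hn hg.continuousOn).integrable_mul hv
  have hv1 : Integrable v (hMeasure m n) := hv.integrable (by norm_num)
  refine norm_le_zero_iff.1 (le_of_forall_pos_le_add fun ε hε => ?_)
  set K := ∫ t, |v t| ∂(hMeasure m n) with hK
  have hK0 : 0 ≤ K := integral_nonneg fun _ => abs_nonneg _
  -- Weierstrass approximation. The tolerance is measured against the `L¹` norm `K` of `v`; adding 1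
  -- covers `K = 0`.
  obtain ⟨Q, hQ⟩ := exists_polynomial_near_of_continuousOn (-1) 1 w hw.continuousOn (ε / (K + 1))
    (by positivity)
  have e : ∫ t, w t * v t ∂(hMeasure m n) = ∫ t, (w t - Q.eval t) * v t ∂(hMeasure m n) := by
    simp only [sub_mul]
    rw [integral_sub (hint hw) (hint Q.continuous), h Q, sub_zero]
  rw [e, zero_add]
  refine (norm_integral_le_of_norm_le (g := fun t => ε / (K + 1) * |v t|) (hv1.abs.const_mul _)
    ?_).trans ?_
  · filter_upwards [ae_mem_Icc m n] with t ht
    rw [norm_mul, Real.norm_eq_abs, Real.norm_eq_abs, abs_sub_comm]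
    exact mul_le_mul_of_nonneg_right (hQ t ht).le (abs_nonneg _)
  · rw [integral_const_mul, ← hK, div_mul_eq_mul_div, div_le_iff₀ (by positivity)]
    nlinarith

/-- The Jacobi polynomials are monic with one in each degree, so subtracting the leading coefficient
times the one of equal degree lowers the degree. -/
theorem integral_polynomial_mul_eq_zero (hm : 2 ≤ m) (hn : 2 ≤ n) {v : ℝ → ℝ}
    (hv : MemLp v 2 (hMeasure m n))
    {d₀ : ℕ} (h : ∀ i ≤ d₀, ∫ t, (jac m n i).eval t * v t ∂(hMeasure m n) = 0) {Q : ℝ[X]}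
    (hQ : Q.natDegree ≤ d₀) : ∫ t, Q.eval t * v t ∂(hMeasure m n) = 0 := by
  have hint : ∀ P : ℝ[X], Integrable (fun t => P.eval t * v t) (hMeasure m n) :=
    fun P => (memLp_of_continuousOn hm hn P.continuous.continuousOn).integrable_mul hv
  induction hd : Q.natDegree using Nat.strong_induction_on generalizing Q with
  | _ d ih =>
    obtain ⟨hmon, hdeg⟩ := jacobi_monic (alpha n) (beta m) d
    set R := Q - Polynomial.C (Q.coeff d) * jac m n d with hR
    have hR0 : ∫ t, R.eval t * v t ∂(hMeasure m n) = 0 := by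
      by_cases hRz : R = 0
      · simp [hRz]
      · suffices hlt : R.natDegree < d from ih R.natDegree hlt (by omega) rfl
        rcases Nat.eq_zero_or_pos d with h0 | h0
        · exfalso
          apply hRz
          subst h0
          rw [hR, Polynomial.eq_C_of_natDegree_eq_zero hd]
          have : jac m n 0 = 1 := by
            have := Polynomial.eq_C_of_natDegree_eq_zero hdeg
            have h1 : (jacobi (alpha n) (beta m) 0).coeff 0 = 1 := by
              have := hmon.coeff_natDegree; rwa [hdeg] at this
            rw [h1] at this
            simpa using this
          simp [this]
        · have hle : R.natDegree ≤ d := by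
            refine (Polynomial.natDegree_sub_le _ _).trans (max_le hd.le ?_)
            exact (Polynomial.natDegree_C_mul_le _ _).trans hdeg.le
          have hc : R.coeff d = 0 := by
            have h1 : (jacobi (alpha n) (beta m) d).coeff d = 1 := by
              have := hmon.coeff_natDegree; rwa [hdeg] at this
            rw [hR, Polynomial.coeff_sub, Polynomial.coeff_C_mul, h1, mul_one, sub_self]
          refine lt_of_le_of_ne hle fun heq => hRz ?_
          rw [← Polynomial.leadingCoeff_eq_zero, Polynomial.leadingCoeff, heq, hc]
    have e : ∀ t, Q.eval t * v t = R.eval t * v t + Q.coeff d * ((jac m n d).eval t * v t) := by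
      intro t
      simp only [hR, Polynomial.eval_sub, Polynomial.eval_mul, Polynomial.eval_C]
      ring
    simp only [e]
    rw [integral_add (hint R) ((hint _).const_mul _), hR0, integral_const_mul, h d (by omega), mul_zero,
      add_zero]

/-- The normalized Jacobi polynomials form a Hilbert basis of `L²_h`. -/
def jacobiBasis (hm : 2 ≤ m) (hn : 2 ≤ n) : HilbertBasis ℕ ℝ (Lp ℝ 2 (hMeasure m n)) :=
  HilbertBasis.mkOfOrthogonalEqBot (orthonormal_pLp hm hn) <| by
    rw [Submodule.eq_bot_iff]
    intro v hv
    have h1 : ∀ i, ∫ t, (jac m n i).eval t * v t ∂(hMeasure m n) = 0 := by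
      intro i
      have h := hv _ (Submodule.subset_span ⟨i, rfl⟩)
      rw [← hCoeff_eq_inner, hCoeff] at h
      have hpos := Real.sqrt_pos.2 (integral_sq_eval_pos hm hn (jac_ne_zero m n i))
      have e : ∀ t, (jac m n i).eval t * v t
          = √(∫ x, (jac m n i).eval x ^ 2 ∂(hMeasure m n)) * (v t * pJac m n i t) := by
        intro t
        rw [pJac]
        field_simp
      simp only [e]
      rw [integral_const_mul, h, mul_zero]
    have h2 : ∀ {w : ℝ → ℝ}, Continuous w → ∫ t, w t * v t ∂(hMeasure m n) = 0 := fun hw =>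
      integral_mul_eq_zero_of_polynomial hm hn (Lp.memLp v)
        (fun Q => integral_polynomial_mul_eq_zero hm hn (Lp.memLp v) (fun i _ => h1 i) le_rfl) hw
    -- Completeness is transported to the sphere: `v ∘ f` is invariant and orthogonal to every
    -- continuous function of `f`.
    have h3 : compF hm hn v = 0 := by
      refine eq_zero_of_mem_L2G_of_orthogonal (by omega) (by omega) (compF_mem_L2G hm hn v)
        fun w hw => ?_
      have hmeas : AEStronglyMeasurable (fun t => w t * v t) (hMeasure m n) :=
        hw.aestronglyMeasurable.mul (Lp.aestronglyMeasurable v)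
      rw [← h2 hw, ← integral_comp_f hm hn hmeas]
      refine integral_congr_ae ?_
      filter_upwards [coeFn_compF hm hn v] with z hz
      rw [hz]
    exact (map_eq_zero_iff _ (compF hm hn).injective).1 h3

theorem coe_jacobiBasis (hm : 2 ≤ m) (hn : 2 ≤ n) :
    (jacobiBasis (m := m) (n := n) hm hn : ℕ → Lp ℝ 2 (hMeasure m n)) = pLp hm hn :=
  HilbertBasis.coe_mkOfOrthogonalEqBot _ _

/-! ### Rotations mixing the two factors -/

section Rotation

/-- The rotation by the angle `φ`, `c = cos φ`, `s = sin φ`, in the plane of the poles `(a, 0)` and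
`(0, b)`. -/
def planeRotation {a : EuclideanSpace ℝ (Fin m)} {b : EuclideanSpace ℝ (Fin n)} (ha : ‖a‖ = 1)
    (hb : ‖b‖ = 1) {c s : ℝ} (h : c ^ 2 + s ^ 2 = 1) : Ambient m n ≃ₗᵢ[ℝ] Ambient m n :=
  LinearIsometry.toLinearIsometryEquiv
    { toFun := fun z => WithLp.toLp 2
        (z.fst + ((c - 1) * inner ℝ a z.fst - s * inner ℝ b z.snd) • a,
          z.snd + (s * inner ℝ a z.fst + (c - 1) * inner ℝ b z.snd) • b)
      map_add' := fun z w => by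
        refine ambient_ext ?_ ?_
        · simp only [WithLp.toLp_fst, WithLp.add_fst, WithLp.add_snd, inner_add_right]
          module
        · simp only [WithLp.toLp_snd, WithLp.add_fst, WithLp.add_snd, inner_add_right]
          module
      map_smul' := fun r z => by
        refine ambient_ext ?_ ?_
        · simp only [WithLp.toLp_fst, WithLp.smul_fst, WithLp.smul_snd,
            inner_smul_right, RingHom.id_apply]
          module
        · simp only [WithLp.toLp_snd, WithLp.smul_fst, WithLp.smul_snd,
            inner_smul_right, RingHom.id_apply]
          module
      norm_map' := fun z => by
        rw [← sq_eq_sq₀ (norm_nonneg _) (norm_nonneg _),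
          WithLp.prod_norm_sq_eq_of_L2, WithLp.prod_norm_sq_eq_of_L2 z]
        change ‖z.fst + ((c - 1) * inner ℝ a z.fst - s * inner ℝ b z.snd) • a‖ ^ 2 +
          ‖z.snd + (s * inner ℝ a z.fst + (c - 1) * inner ℝ b z.snd) • b‖ ^ 2 = _
        rw [norm_add_sq_real, norm_add_sq_real, norm_smul, norm_smul, ha, hb, inner_smul_right,
          inner_smul_right, real_inner_comm a, real_inner_comm b]
        simp only [mul_one, Real.norm_eq_abs, sq_abs]
        linear_combination ((inner ℝ a z.fst) ^ 2 + (inner ℝ b z.snd) ^ 2) * h } rfl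

variable {a : EuclideanSpace ℝ (Fin m)} {b : EuclideanSpace ℝ (Fin n)} (ha : ‖a‖ = 1)
    (hb : ‖b‖ = 1) {c s : ℝ} (h : c ^ 2 + s ^ 2 = 1)

theorem planeRotation_fst (z : Ambient m n) : (planeRotation ha hb h z).fst =
    z.fst + ((c - 1) * inner ℝ a z.fst - s * inner ℝ b z.snd) • a := rfl

theorem planeRotation_snd (z : Ambient m n) : (planeRotation ha hb h z).snd =
    z.snd + (s * inner ℝ a z.fst + (c - 1) * inner ℝ b z.snd) • b := rfl

theorem planeRotation_pole : planeRotation ha hb h (pole n a) = arcPoint a b c s := by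
  refine ambient_ext ?_ ?_
  · rw [planeRotation_fst]
    simp only [pole, arcPoint, WithLp.toLp_fst, WithLp.toLp_snd, inner_zero_right,
      real_inner_self_eq_norm_sq, ha]
    module
  · rw [planeRotation_snd]
    simp only [pole, arcPoint, WithLp.toLp_fst, WithLp.toLp_snd, inner_zero_right,
      real_inner_self_eq_norm_sq, ha]
    module

/-- The terms are grouped by their dependence on the angle: coefficients `sin 2φ`, `cos 2φ` and 1.
If the rotation carries the pole to a point with `f = t`, then `c² - s² = t` and `(2cs)² = 1 - t²`.
-/
theorem f_sphMap_planeRotation (z : Sph m n) : f (sphMap (planeRotation ha hb h) z) =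
    (2 * c * s) * (-2 * (inner ℝ a (z : Ambient m n).fst * inner ℝ b (z : Ambient m n).snd)) +
    ((c ^ 2 - s ^ 2) *
      (inner ℝ a (z : Ambient m n).fst ^ 2 - inner ℝ b (z : Ambient m n).snd ^ 2) +
    (f z - (inner ℝ a (z : Ambient m n).fst ^ 2 - inner ℝ b (z : Ambient m n).snd ^ 2))) := by
  rw [f, f, coe_sphMap, planeRotation_fst, planeRotation_snd, norm_add_sq_real,
    norm_add_sq_real, norm_smul, norm_smul, ha, hb, inner_smul_right, inner_smul_right,
    real_inner_comm a, real_inner_comm b]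
  simp only [mul_one, Real.norm_eq_abs, sq_abs]
  ring

end Rotation

/-! ### Zonal operators preserve polynomials in `f` -/

section Zonal

theorem measurableEmbedding_sphMap (R : Ambient m n ≃ₗᵢ[ℝ] Ambient m n) :
    MeasurableEmbedding (sphMap R) :=
  ((continuous_sphMap R).isClosedEmbedding fun _ _ hxy =>
    Subtype.ext (R.injective (congrArg Subtype.val hxy))).measurableEmbedding

theorem integral_comp_sphMap (R : Ambient m n ≃ₗᵢ[ℝ] Ambient m n) (g : Sph m n → ℝ) :
    ∫ z, g (sphMap R z) ∂(surf m n) = ∫ z, g z ∂(surf m n) :=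
  (measurePreserving_sphMap R).integral_comp (measurableEmbedding_sphMap R) g

theorem continuous_f : Continuous (f : Sph m n → ℝ) := by unfold f; fun_prop

variable {k : ℝ → ℝ} (hk : Measurable k) (hk0 : ∀ t, 0 ≤ k t) {M : ℝ} (hM : ∀ t, k t ≤ M)

include hk hk0 hM in
theorem integrable_kernel_mul (x : Ambient m n) {g : Sph m n → ℝ} (hg : Continuous g) :
    Integrable (fun w : Sph m n => k (inner ℝ x (w : Ambient m n)) * g w) (surf m n) := by
  obtain ⟨K, hK⟩ := (isCompact_univ (X := Sph m n)).exists_bound_of_continuousOn hg.continuousOn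
  have hM0 : 0 ≤ M := (hk0 0).trans (hM 0)
  have hmeas : Measurable fun w : Sph m n => k (inner ℝ x (w : Ambient m n)) :=
    hk.comp (by fun_prop)
  refine Integrable.of_bound (hmeas.aestronglyMeasurable.mul hg.aestronglyMeasurable) (M * K)
    (Eventually.of_forall fun w => ?_)
  rw [norm_mul, Real.norm_of_nonneg (hk0 _)]
  exact mul_le_mul (hM _) (hK w trivial) (norm_nonneg _) hM0

include hk hk0 hM in
/-- A zonal integral operator maps the powers of `f` to polynomials in `f` without raising the
degree. -/
theorem exists_polynomial_zonal_pow (hm : 1 ≤ m) (hn : 1 ≤ n) (d : ℕ) :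
    ∃ r : ℝ[X], r.natDegree ≤ d ∧ ∀ z : Sph m n,
      ∫ w : Sph m n, k (inner ℝ (z : Ambient m n) (w : Ambient m n)) * f w ^ d ∂(surf m n)
        = r.eval (f z) := by
  obtain ⟨a, ha⟩ := exists_norm_eq_one hm
  obtain ⟨b, hb⟩ := exists_norm_eq_one hn
  set X : Sph m n → ℝ := fun z => inner ℝ a (z : Ambient m n).fst with hX
  set Y : Sph m n → ℝ := fun z => inner ℝ b (z : Ambient m n).snd with hY
  have hXc : Continuous X := by rw [hX]; fun_prop
  have hYc : Continuous Y := by rw [hY]; fun_prop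
  set I : ℕ → ℕ → ℕ → ℝ := fun j l r => ∫ w : Sph m n, k (inner ℝ (pole n a) (w : Ambient m n)) *
    ((-2 * (X w * Y w)) ^ j * ((X w ^ 2 - Y w ^ 2) ^ l * (f w - (X w ^ 2 - Y w ^ 2)) ^ r))
    ∂(surf m n) with hI
  have hfc := continuous_f (m := m) (n := n)
  have hIint : ∀ j l r, Integrable (fun w : Sph m n => k (inner ℝ (pole n a) (w : Ambient m n)) *
    ((-2 * (X w * Y w)) ^ j * ((X w ^ 2 - Y w ^ 2) ^ l * (f w - (X w ^ 2 - Y w ^ 2)) ^ r)))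
    (surf m n) := fun j l r => integrable_kernel_mul hk hk0 hM _ (by fun_prop)
  -- An isometry of the second factor with `b ↦ -b` reverses `Y` and fixes `X`, `f` and the pole.
  have hIodd : ∀ j l r, Odd j → I j l r = 0 := by
    intro j l r hj
    obtain ⟨B, hB⟩ := exists_isometry_apply_eq (x := b) (y := -b) (norm_neg b).symm
    have hYB : ∀ w, Y (sphMap (blockIsometry (LinearIsometryEquiv.refl ℝ _) B) w) = -Y w := by
      intro w
      have : b = B (-b) := by rw [map_neg, hB, neg_neg]
      simp only [hY, coe_sphMap, blockIsometry_snd]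
      rw [this, B.inner_map_map, inner_neg_left, ← this]
    have hXB : ∀ w, X (sphMap (blockIsometry (LinearIsometryEquiv.refl ℝ _) B) w) = X w :=
      fun w => rfl
    have hfB : ∀ w : Sph m n, f (sphMap (blockIsometry (LinearIsometryEquiv.refl ℝ _) B) w) = f w :=
      fun w => f_act _ B w
    have hPB : ∀ w : Sph m n, inner ℝ (pole n a)
        (sphMap (blockIsometry (LinearIsometryEquiv.refl ℝ _) B) w : Ambient m n)
        = inner ℝ (pole n a) (w : Ambient m n) := by
      intro w
      rw [inner_pole, inner_pole]
      rfl
    have key : I j l r = -I j l r := by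
      conv_lhs => rw [hI]
      simp only
      rw [← integral_comp_sphMap (blockIsometry (LinearIsometryEquiv.refl ℝ _) B)]
      simp only [hYB, hXB, hfB, hPB]
      rw [hI]
      simp only
      rw [← integral_neg]
      refine integral_congr_ae (Eventually.of_forall fun w => ?_)
      simp only
      rw [show -2 * (X w * -Y w) = -(-2 * (X w * Y w)) by ring, hj.neg_pow, neg_sq]
      ring
    linarith
  -- Only even powers of `2cs = √(1 - t²)` survive, so the result is a polynomial in `t`. For odd
  -- `j` the truncated `j / 2` is harmless because the coefficient is 0.
  refine ⟨∑ j ∈ Finset.range (d + 1), ∑ l ∈ Finset.range (d - j + 1),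
    Polynomial.C ((d.choose j : ℝ) * ((d - j).choose l : ℝ) * I j l (d - j - l)) *
      ((1 - Polynomial.X ^ 2) ^ (j / 2) * Polynomial.X ^ l), ?_, fun z => ?_⟩
  · refine Polynomial.natDegree_sum_le_of_forall_le _ _ fun j hj => ?_
    refine Polynomial.natDegree_sum_le_of_forall_le _ _ fun l hl => ?_
    have hj' := Finset.mem_range.1 hj
    have hl' := Finset.mem_range.1 hl
    have h2 : (1 - Polynomial.X ^ 2 : ℝ[X]).natDegree ≤ 2 := by compute_degree
    refine (Polynomial.natDegree_C_mul_le _ _).trans (Polynomial.natDegree_mul_le.trans ?_)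
    rw [Polynomial.natDegree_X_pow]
    have h3 : ((1 - Polynomial.X ^ 2 : ℝ[X]) ^ (j / 2)).natDegree ≤ j / 2 * 2 :=
      Polynomial.natDegree_pow_le.trans (Nat.mul_le_mul_left _ h2)
    omega
  · set t := f z with ht
    obtain ⟨h1, h2⟩ := sq_sqrt_half_add (f_mem_Icc z)
    set c := √((1 + f z) / 2) with hc
    set s := √((1 - f z) / 2) with hs
    have hcs : c ^ 2 + s ^ 2 = 1 := by rw [h1, h2]; ring
    have hCt : c ^ 2 - s ^ 2 = t := by rw [h1, h2]; ring
    have hS : (2 * c * s) ^ 2 = 1 - t ^ 2 := by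
      rw [mul_pow, mul_pow, h1, h2]; ring
    have hmem := arcPoint_mem ha hb hcs
    obtain ⟨A, B, hAB⟩ := exists_act_eq (z := ⟨_, hmem⟩) (w := z) (by
      rw [f_arcPoint ha hb, hCt])
    have hz : (z : Ambient m n) = blockIsometry A B (planeRotation ha hb hcs (pole n a)) := by
      rw [← hAB, planeRotation_pole]
      rfl
    -- The point `z` is a block isometry applied to the rotated pole. The block isometry leaves `f`
    -- unchanged, so only the rotation acts on `f`, and the kernel is centred at the pole.
    have e1 : ∫ w : Sph m n, k (inner ℝ (z : Ambient m n) (w : Ambient m n)) * f w ^ d ∂(surf m n)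
        = ∫ w : Sph m n, k (inner ℝ (pole n a) (w : Ambient m n)) *
          f (sphMap (planeRotation ha hb hcs) w) ^ d ∂(surf m n) := by
      rw [← integral_comp_sphMap (blockIsometry A B), ← integral_comp_sphMap (planeRotation ha hb hcs)]
      refine integral_congr_ae (Eventually.of_forall fun w => ?_)
      simp only
      rw [← act_eq_sphMap, f_act, act_eq_sphMap, coe_sphMap, coe_sphMap, hz,
        LinearIsometryEquiv.inner_map_map, LinearIsometryEquiv.inner_map_map]
    have e2 : ∀ w : Sph m n, k (inner ℝ (pole n a) (w : Ambient m n)) *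
        f (sphMap (planeRotation ha hb hcs) w) ^ d
        = ∑ j ∈ Finset.range (d + 1), ∑ l ∈ Finset.range (d - j + 1),
          ((d.choose j : ℝ) * ((d - j).choose l : ℝ) * ((2 * c * s) ^ j * t ^ l)) *
          (k (inner ℝ (pole n a) (w : Ambient m n)) *
            ((-2 * (X w * Y w)) ^ j * ((X w ^ 2 - Y w ^ 2) ^ l *
              (f w - (X w ^ 2 - Y w ^ 2)) ^ (d - j - l)))) := by
      intro w
      rw [f_sphMap_planeRotation, hCt, add_pow, Finset.mul_sum]
      refine Finset.sum_congr rfl fun j _ => ?_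
      rw [add_pow, Finset.mul_sum, Finset.sum_mul, Finset.mul_sum]
      refine Finset.sum_congr rfl fun l _ => ?_
      rw [mul_pow (2 * c * s), mul_pow t]
      ring
    rw [e1]
    simp only [e2]
    rw [integral_finsetSum _ fun j _ => integrable_finsetSum _ fun l _ =>
      (hIint j l (d - j - l)).const_mul _, Polynomial.eval_finsetSum]
    refine Finset.sum_congr rfl fun j _ => ?_
    rw [integral_finsetSum _ fun l _ => (hIint j l (d - j - l)).const_mul _,
      Polynomial.eval_finsetSum]
    refine Finset.sum_congr rfl fun l _ => ?_
    rw [integral_const_mul]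
    change _ * I j l (d - j - l) = _
    simp only [Polynomial.eval_mul, Polynomial.eval_C, Polynomial.eval_pow, Polynomial.eval_sub,
      Polynomial.eval_one, Polynomial.eval_X]
    rcases Nat.even_or_odd j with hj | hj
    · obtain ⟨i, rfl⟩ := hj
      rw [← hS, ← pow_mul, show 2 * ((i + i) / 2) = i + i by omega]
      ring
    · rw [hIodd _ _ _ hj]
      ring

include hk hk0 hM in
theorem exists_polynomial_zonal (hm : 1 ≤ m) (hn : 1 ≤ n) (q : ℝ[X]) :
    ∃ r : ℝ[X], r.natDegree ≤ q.natDegree ∧ ∀ z : Sph m n,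
      ∫ w : Sph m n, k (inner ℝ (z : Ambient m n) (w : Ambient m n)) * q.eval (f w) ∂(surf m n)
        = r.eval (f z) := by
  choose r hr1 hr2 using exists_polynomial_zonal_pow (m := m) (n := n) hk hk0 hM hm hn
  have hfc := continuous_f (m := m) (n := n)
  refine ⟨∑ i ∈ Finset.range (q.natDegree + 1), Polynomial.C (q.coeff i) * r i, ?_, fun z => ?_⟩
  · refine Polynomial.natDegree_sum_le_of_forall_le _ _ fun i hi => ?_
    have := Finset.mem_range.1 hi
    exact (Polynomial.natDegree_C_mul_le _ _).trans ((hr1 i).trans (by omega))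
  · rw [Polynomial.eval_finsetSum]
    simp only [Polynomial.eval_mul, Polynomial.eval_C, ← hr2, ← integral_const_mul]
    rw [← integral_finsetSum _ fun i _ => Integrable.const_mul
      (integrable_kernel_mul hk hk0 hM _ (by fun_prop)) _]
    refine integral_congr_ae (Eventually.of_forall fun w => ?_)
    simp only
    rw [Polynomial.eval_eq_sum_range, Finset.mul_sum]
    refine Finset.sum_congr rfl fun i _ => ?_
    ring

end Zonal

theorem integral_mul_jac_eq_zero (hm : 2 ≤ m) (hn : 2 ≤ n) {i : ℕ} {Q : ℝ[X]}
    (hQ : Q.natDegree < i) : ∫ t, Q.eval t * (jac m n i).eval t ∂(hMeasure m n) = 0 :=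
  integral_polynomial_mul_eq_zero hm hn
    (memLp_of_continuousOn hm hn (jac m n i).continuous.continuousOn)
    (fun _ hj => integral_jac_mul_jac hm hn (hj.trans_lt hQ).ne) le_rfl

theorem eq_zero_of_integral_jac_mul (hm : 2 ≤ m) (hn : 2 ≤ n) {Q : ℝ[X]}
    (h : ∀ i ≤ Q.natDegree, ∫ t, (jac m n i).eval t * Q.eval t ∂(hMeasure m n) = 0) : Q = 0 := by
  by_contra h0
  have h1 := integral_polynomial_mul_eq_zero hm hn
    (memLp_of_continuousOn hm hn Q.continuous.continuousOn) h le_rfl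
  simp only [← sq] at h1
  exact (integral_sq_eval_pos hm hn h0).ne' h1

theorem jac_eval_one_pos (hm : 2 ≤ m) (hn : 2 ≤ n) (i : ℕ) : 0 < (jac m n i).eval 1 := by
  have ha := alpha_nonneg hn
  have hb := beta_nonneg hm
  rw [jac, jacobi, Polynomial.eval_finsetSum, Finset.sum_range_succ', Finset.sum_eq_zero]
  · simp only [Polynomial.eval_C, pow_zero, mul_one,
      Nat.choose_zero_right, Nat.cast_one, one_mul, Nat.sub_zero, zero_add]
    exact mul_pos (by positivity) (Finset.prod_pos fun j _ => by positivity)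
  · intro k _
    simp

/-! ### Diagonalization of bounded zonal kernels -/

section Kernel

variable {k : ℝ → ℝ} (hk : Measurable k) (hk0 : ∀ t, 0 ≤ k t) {M : ℝ} (hM : ∀ t, k t ≤ M)

include hk in
theorem measurable_zonal_kernel :
    Measurable fun q : Sph m n × Sph m n => k (inner ℝ (q.1 : Ambient m n) (q.2 : Ambient m n)) :=
  hk.comp (by fun_prop)

include hk hk0 hM in
theorem integrable_prod_kernel_mul {g : Sph m n × Sph m n → ℝ} (hg : Continuous g) :
    Integrable (fun q : Sph m n × Sph m n =>
      k (inner ℝ (q.1 : Ambient m n) (q.2 : Ambient m n)) * g q) ((surf m n).prod (surf m n)) := by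
  obtain ⟨K, hK⟩ := (isCompact_univ (X := Sph m n × Sph m n)).exists_bound_of_continuousOn
    hg.continuousOn
  have hM0 : 0 ≤ M := (hk0 0).trans (hM 0)
  refine Integrable.of_bound ((measurable_zonal_kernel hk).aestronglyMeasurable.mul
    hg.aestronglyMeasurable) (M * K) (Eventually.of_forall fun w => ?_)
  rw [norm_mul, Real.norm_of_nonneg (hk0 _)]
  exact mul_le_mul (hM _) (hK w trivial) (norm_nonneg _) hM0

include hk hk0 hM in
theorem integral_zonal_symm (hm : 2 ≤ m) (hn : 2 ≤ n) {P Q r q : ℝ[X]}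
    (hr : ∀ z : Sph m n, ∫ w : Sph m n, k (inner ℝ (z : Ambient m n) (w : Ambient m n)) *
      Q.eval (f w) ∂(surf m n) = r.eval (f z))
    (hq : ∀ z : Sph m n, ∫ w : Sph m n, k (inner ℝ (z : Ambient m n) (w : Ambient m n)) *
      P.eval (f w) ∂(surf m n) = q.eval (f z)) :
    ∫ t, P.eval t * r.eval t ∂(hMeasure m n) = ∫ t, Q.eval t * q.eval t ∂(hMeasure m n) := by
  have hfc := continuous_f (m := m) (n := n)
  have hc : ∀ P Q : ℝ[X], AEStronglyMeasurable (fun t => P.eval t * Q.eval t) (hMeasure m n) :=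
    fun P Q => (by fun_prop : Continuous _).aestronglyMeasurable
  rw [← integral_comp_f hm hn (hc P r), ← integral_comp_f hm hn (hc Q q)]
  simp only [← hr, ← hq, ← integral_const_mul]
  rw [integral_integral_swap]
  · refine integral_congr_ae (Eventually.of_forall fun z => ?_)
    refine integral_congr_ae (Eventually.of_forall fun w => ?_)
    simp only
    rw [real_inner_comm]
    ring
  · have := integrable_prod_kernel_mul (m := m) (n := n) hk hk0 hM
      (g := fun q => P.eval (f q.1) * Q.eval (f q.2)) (by fun_prop)
    refine this.congr (Eventually.of_forall fun q => ?_)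
    simp only [Function.uncurry]
    ring

include hk hk0 hM in
/-- The Jacobi polynomials in `f` are eigenfunctions of every zonal integral operator. -/
theorem exists_eigenvalue_zonal (hm : 2 ≤ m) (hn : 2 ≤ n) (i : ℕ) :
    ∃ μ : ℝ, ∀ z : Sph m n, ∫ w : Sph m n, k (inner ℝ (z : Ambient m n) (w : Ambient m n)) *
      (jac m n i).eval (f w) ∂(surf m n) = μ * (jac m n i).eval (f z) := by
  choose r hrd hr using fun q : ℝ[X] =>
    exists_polynomial_zonal (m := m) (n := n) hk hk0 hM (by omega) (by omega) q
  obtain ⟨hmon, hdeg⟩ := jacobi_monic (alpha n) (beta m) i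
  -- By symmetry the operator can be moved onto `P_j`, whose image has degree at most `j < i` and is
  -- orthogonal to `P_i`.
  have hji : ∀ j, j ≠ i → j ≤ i →
      ∫ t, (jac m n j).eval t * (r (jac m n i)).eval t ∂(hMeasure m n) = 0 := by
    intro j hji hj
    rw [integral_zonal_symm hk hk0 hM hm hn (hr (jac m n i)) (hr (jac m n j))]
    simp only [mul_comm (Polynomial.eval _ (jac m n i))]
    refine integral_mul_jac_eq_zero hm hn ((hrd _).trans_lt ?_)
    rw [(jacobi_monic _ _ j).2]
    omega
  -- The leading coefficient is the only candidate for the eigenvalue, `P_i` being monic; the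
  -- remainder has degree below `i` and is orthogonal to every `P_j` with `j < i`.
  set μ := (r (jac m n i)).coeff i with hμ
  have hle : (r (jac m n i) - Polynomial.C μ * jac m n i).natDegree ≤ i :=
    (Polynomial.natDegree_sub_le _ _).trans (max_le ((hrd _).trans hdeg.le)
      ((Polynomial.natDegree_C_mul_le _ _).trans hdeg.le))
  have hci : (r (jac m n i) - Polynomial.C μ * jac m n i).coeff i = 0 := by
    have h1 : (jac m n i).coeff i = 1 := by
      have := hmon.coeff_natDegree; rwa [hdeg] at this
    rw [Polynomial.coeff_sub, Polynomial.coeff_C_mul, h1, hμ]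
    ring
  have hint : ∀ P Q : ℝ[X], Integrable (fun t => P.eval t * Q.eval t) (hMeasure m n) :=
    fun P Q => integrable_hMeasure_of_continuous hm hn (by fun_prop)
  have h0 : r (jac m n i) - Polynomial.C μ * jac m n i = 0 := by
    by_contra hne
    have hlt : (r (jac m n i) - Polynomial.C μ * jac m n i).natDegree < i := by
      refine lt_of_le_of_ne hle fun heq => hne ?_
      rw [← Polynomial.leadingCoeff_eq_zero, Polynomial.leadingCoeff, heq, hci]
    refine hne (eq_zero_of_integral_jac_mul hm hn fun j hj => ?_)
    have e : ∀ t, (jac m n j).eval t * (r (jac m n i) - Polynomial.C μ * jac m n i).eval t =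
        (jac m n j).eval t * (r (jac m n i)).eval t -
          μ * ((jac m n j).eval t * (jac m n i).eval t) := by
      intro t
      simp only [Polynomial.eval_sub, Polynomial.eval_mul, Polynomial.eval_C]
      ring
    simp only [e]
    rw [integral_sub (hint _ _) ((hint _ _).const_mul _), hji j (by omega) (by omega),
      integral_const_mul, integral_jac_mul_jac hm hn (by omega), mul_zero, sub_zero]
  refine ⟨μ, fun z => ?_⟩
  rw [hr, sub_eq_zero.1 h0, Polynomial.eval_mul, Polynomial.eval_C]

/-- The measure `k(⟨z, ζ⟩) dz dζ` on the product of the sphere with itself. -/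
def kernelMeasure (m n : ℕ) (k : ℝ → ℝ) : Measure (Sph m n × Sph m n) :=
  ((surf m n).prod (surf m n)).withDensity fun q =>
    ENNReal.ofReal (k (inner ℝ (q.1 : Ambient m n) (q.2 : Ambient m n)))

include hk in
theorem lintegral_kernelMeasure {g : Sph m n × Sph m n → ℝ≥0∞} 
    (hg : AEMeasurable g (kernelMeasure m n k)) :
    ∫⁻ q, g q ∂(kernelMeasure m n k) = ∫⁻ q : Sph m n × Sph m n,
      ENNReal.ofReal (k (inner ℝ (q.1 : Ambient m n) (q.2 : Ambient m n))) * g q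
        ∂((surf m n).prod (surf m n)) :=
  lintegral_withDensity_eq_lintegral_mul₀'
    (measurable_zonal_kernel hk).ennreal_ofReal.aemeasurable hg

include hk hk0 in
theorem integral_kernelMeasure (g : Sph m n × Sph m n → ℝ) :
    ∫ q, g q ∂(kernelMeasure m n k) = ∫ q : Sph m n × Sph m n,
      k (inner ℝ (q.1 : Ambient m n) (q.2 : Ambient m n)) * g q ∂((surf m n).prod (surf m n)) := by
  rw [kernelMeasure, integral_withDensity_eq_integral_toReal_smul
    (measurable_zonal_kernel hk).ennreal_ofReal (by simp)]
  simp only [ENNReal.toReal_ofReal (hk0 _), smul_eq_mul]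

-- A normalized kernel makes `kernelMeasure` a coupling of the surface measure with itself. Hence
-- `w(f(z))` and `w(f(ζ))` both lie in its `L²` for every `w` in `L²_h`, and their difference is a
-- bounded linear function of `w`.
include hk in
theorem measurePreserving_fst_kernelMeasure
    (h1 : ∀ z : Sph m n, ∫⁻ w : Sph m n,
      ENNReal.ofReal (k (inner ℝ (z : Ambient m n) (w : Ambient m n))) ∂(surf m n) = 1) :
    MeasurePreserving Prod.fst (kernelMeasure m n k) (surf m n) := by
  refine ⟨measurable_fst, ?_⟩
  ext s hs
  rw [Measure.map_apply measurable_fst hs, kernelMeasure,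
    withDensity_apply _ (measurable_fst hs), ← prod_univ, ← Measure.prod_restrict,
    lintegral_prod _ (measurable_zonal_kernel hk).ennreal_ofReal.aemeasurable]
  simp only [Measure.restrict_univ, h1, setLIntegral_one]

include hk in
theorem measurePreserving_snd_kernelMeasure
    (h1 : ∀ z : Sph m n, ∫⁻ w : Sph m n,
      ENNReal.ofReal (k (inner ℝ (z : Ambient m n) (w : Ambient m n))) ∂(surf m n) = 1) :
    MeasurePreserving Prod.snd (kernelMeasure m n k) (surf m n) := by
  refine ⟨measurable_snd, ?_⟩
  ext s hs
  rw [Measure.map_apply measurable_snd hs, kernelMeasure,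
    withDensity_apply _ (measurable_snd hs), ← univ_prod, ← Measure.prod_restrict,
    lintegral_prod_symm _ (measurable_zonal_kernel hk).ennreal_ofReal.aemeasurable]
  have h2 : ∀ w : Sph m n, ∫⁻ z : Sph m n,
      ENNReal.ofReal (k (inner ℝ (z : Ambient m n) (w : Ambient m n))) ∂(surf m n) = 1 := by
    intro w
    rw [← h1 w]
    exact lintegral_congr fun z => by rw [real_inner_comm]
  simp only [Measure.restrict_univ, h2, setLIntegral_one]

/-- The map `w ↦ w(f(z)) - w(f(ζ))` from `L²_h` to `L²` of a normalized kernel measure. -/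
def differenceMap (hm : 2 ≤ m) (hn : 2 ≤ n)
    (h1 : ∀ z : Sph m n, ∫⁻ w : Sph m n,
      ENNReal.ofReal (k (inner ℝ (z : Ambient m n) (w : Ambient m n))) ∂(surf m n) = 1) :
    Lp ℝ 2 (hMeasure m n) →L[ℝ] Lp ℝ 2 (kernelMeasure m n k) :=
  (Lp.compMeasurePreservingₗᵢ ℝ _ ((measurePreserving_f hm hn).comp
      (measurePreserving_fst_kernelMeasure hk h1))).toContinuousLinearMap -
    (Lp.compMeasurePreservingₗᵢ ℝ _ ((measurePreserving_f hm hn).comp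
      (measurePreserving_snd_kernelMeasure hk h1))).toContinuousLinearMap

theorem coeFn_differenceMap (hm : 2 ≤ m) (hn : 2 ≤ n)
    (h1 : ∀ z : Sph m n, ∫⁻ w : Sph m n,
      ENNReal.ofReal (k (inner ℝ (z : Ambient m n) (w : Ambient m n))) ∂(surf m n) = 1)
    (w : Lp ℝ 2 (hMeasure m n)) :
    differenceMap hk hm hn h1 w =ᵐ[kernelMeasure m n k] fun q => w (f q.1) - w (f q.2) := by
  rw [differenceMap, sub_apply]
  filter_upwards [Lp.coeFn_sub (Lp.compMeasurePreserving _ ((measurePreserving_f hm hn).comp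
      (measurePreserving_fst_kernelMeasure hk h1)) w)
      (Lp.compMeasurePreserving _ ((measurePreserving_f hm hn).comp
      (measurePreserving_snd_kernelMeasure hk h1)) w),
    Lp.coeFn_compMeasurePreserving w ((measurePreserving_f hm hn).comp
      (measurePreserving_fst_kernelMeasure hk h1)),
    Lp.coeFn_compMeasurePreserving w ((measurePreserving_f hm hn).comp
      (measurePreserving_snd_kernelMeasure hk h1))] with q e1 e2 e3
  refine e1.trans ?_
  rw [Pi.sub_apply, e2, e3]
  rfl

theorem lintegral_sq_eq_norm_sq {α : Type*} [MeasurableSpace α] {μ : Measure α} (g : Lp ℝ 2 μ) :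
    ∫⁻ x, ENNReal.ofReal (g x ^ 2) ∂μ = ENNReal.ofReal (‖g‖ ^ 2) := by
  rw [← real_inner_self_eq_norm_sq, L2.inner_def, ofReal_integral_eq_lintegral_ofReal
    (L2.integrable_inner g g) (Eventually.of_forall fun x => real_inner_self_nonneg)]
  exact lintegral_congr fun x => by rw [real_inner_self_eq_norm_sq, Real.norm_eq_abs, sq_abs]

theorem ofReal_norm_sq_differenceMap (hm : 2 ≤ m) (hn : 2 ≤ n)
    (h1 : ∀ z : Sph m n, ∫⁻ w : Sph m n,
      ENNReal.ofReal (k (inner ℝ (z : Ambient m n) (w : Ambient m n))) ∂(surf m n) = 1)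
    (w : Lp ℝ 2 (hMeasure m n)) :
    ENNReal.ofReal (‖differenceMap hk hm hn h1 w‖ ^ 2) = ∫⁻ z : Sph m n, ∫⁻ ζ : Sph m n,
      ENNReal.ofReal (k (inner ℝ (z : Ambient m n) (ζ : Ambient m n))) *
        ENNReal.ofReal (|w (f z) - w (f ζ)| ^ 2) ∂(surf m n) ∂(surf m n) := by
  have hwm : Measurable w := (Lp.stronglyMeasurable w).measurable
  have hm1 : Measurable fun q : Sph m n × Sph m n =>
      ENNReal.ofReal (|w (f q.1) - w (f q.2)| ^ 2) := by
    have := measurable_f (m := m) (n := n)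
    simp only [sq_abs]
    exact (((hwm.comp (this.comp measurable_fst)).sub
      (hwm.comp (this.comp measurable_snd))).pow_const 2).ennreal_ofReal
  rw [← lintegral_sq_eq_norm_sq, ← lintegral_prod (fun q : Sph m n × Sph m n =>
    ENNReal.ofReal (k (inner ℝ (q.1 : Ambient m n) (q.2 : Ambient m n))) *
        ENNReal.ofReal (|w (f q.1) - w (f q.2)| ^ 2))
    ((measurable_zonal_kernel hk).ennreal_ofReal.mul hm1).aemeasurable,
    ← lintegral_kernelMeasure hk hm1.aemeasurable]
  refine lintegral_congr_ae ?_
  filter_upwards [coeFn_differenceMap hk hm hn h1 w] with q hq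
  rw [hq, sq_abs]

-- The product of the two differences has four terms. The diagonal ones reduce to orthonormality
-- through the marginals of the coupling; the cross terms carry the factor `μ` by the eigenvalue
-- equation.
include hk0 hM in
theorem inner_differenceMap_pLp (hm : 2 ≤ m) (hn : 2 ≤ n)
    (h1 : ∀ z : Sph m n, ∫⁻ w : Sph m n,
      ENNReal.ofReal (k (inner ℝ (z : Ambient m n) (w : Ambient m n))) ∂(surf m n) = 1)
    {i : ℕ} {μ : ℝ} (hμ : ∀ z : Sph m n, ∫ w : Sph m n,
      k (inner ℝ (z : Ambient m n) (w : Ambient m n)) * (jac m n i).eval (f w) ∂(surf m n)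
        = μ * (jac m n i).eval (f z)) (j : ℕ) :
    inner ℝ (differenceMap hk hm hn h1 (pLp hm hn j)) (differenceMap hk hm hn h1 (pLp hm hn i))
      = if j = i then 2 * (1 - μ) else 0 := by
  have hμ' : ∀ z : Sph m n, ∫ w : Sph m n,
      k (inner ℝ (z : Ambient m n) (w : Ambient m n)) * pJac m n i (f w) ∂(surf m n)
        = μ * pJac m n i (f z) := by
    intro z
    simp only [pJac, ← mul_div_assoc, integral_div]
    rw [hμ z]
  have hfst := (measurePreserving_f hm hn).comp (measurePreserving_fst_kernelMeasure hk h1)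
  have hsnd := (measurePreserving_f hm hn).comp (measurePreserving_snd_kernelMeasure hk h1)
  have hpl : ∀ l, AEStronglyMeasurable (pJac m n l) (hMeasure m n) := fun l =>
    (continuous_pJac l).aestronglyMeasurable
  have hfc := continuous_f (m := m) (n := n)
  have hpc : ∀ l, Continuous (pJac m n l) := continuous_pJac
  have horth : ∫ t, pJac m n j t * pJac m n i t ∂(hMeasure m n) = if j = i then 1 else 0 := by
    rw [← inner_pLp hm hn, orthonormal_iff_ite.1 (orthonormal_pLp hm hn)]
  have hI : ∀ {g : Sph m n × Sph m n → ℝ}, Continuous g → Integrable g (kernelMeasure m n k) := by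
    intro g hg
    rw [kernelMeasure, integrable_withDensity_iff_integrable_smul'
      (measurable_zonal_kernel hk).ennreal_ofReal (by simp)]
    simp only [ENNReal.toReal_ofReal (hk0 _), smul_eq_mul]
    exact integrable_prod_kernel_mul hk hk0 hM hg
  have d1 : ∫ q, pJac m n j (f q.1) * pJac m n i (f q.1) ∂(kernelMeasure m n k)
      = if j = i then 1 else 0 := by
    rw [← horth, ← hfst.map_eq, integral_map hfst.aemeasurable]
    · rfl
    · rw [hfst.map_eq]; exact (hpl j).mul (hpl i)
  have d2 : ∫ q, pJac m n j (f q.2) * pJac m n i (f q.2) ∂(kernelMeasure m n k)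
      = if j = i then 1 else 0 := by
    rw [← horth, ← hsnd.map_eq, integral_map hsnd.aemeasurable]
    · rfl
    · rw [hsnd.map_eq]; exact (hpl j).mul (hpl i)
  have hcf : ∫ z : Sph m n, pJac m n j (f z) * (μ * pJac m n i (f z)) ∂(surf m n)
      = μ * if j = i then 1 else 0 := by
    rw [integral_comp_f (g := fun t => pJac m n j t * (μ * pJac m n i t)) hm hn
      ((hpl j).mul ((hpl i).const_mul μ)), ← horth, ← integral_const_mul]
    exact integral_congr_ae (Eventually.of_forall fun t => by simp only; ring)
  have c1 : ∫ q, pJac m n j (f q.1) * pJac m n i (f q.2) ∂(kernelMeasure m n k)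
      = μ * if j = i then 1 else 0 := by
    rw [integral_kernelMeasure hk hk0, integral_prod _
      (integrable_prod_kernel_mul hk hk0 hM (by fun_prop)), ← hcf]
    refine integral_congr_ae (Eventually.of_forall fun z => ?_)
    simp only [← hμ' z, ← integral_const_mul]
    exact integral_congr_ae (Eventually.of_forall fun t => by simp only; ring)
  have c2 : ∫ q, pJac m n j (f q.2) * pJac m n i (f q.1) ∂(kernelMeasure m n k)
      = μ * if j = i then 1 else 0 := by
    rw [integral_kernelMeasure hk hk0, integral_prod_symm _
      (integrable_prod_kernel_mul hk hk0 hM (by fun_prop)), ← hcf]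
    refine integral_congr_ae (Eventually.of_forall fun z => ?_)
    simp only [← hμ' z, ← integral_const_mul]
    exact integral_congr_ae (Eventually.of_forall fun t => by
      simp only; rw [real_inner_comm]; ring)
  have hco : ∀ l, differenceMap hk hm hn h1 (pLp hm hn l) =ᵐ[kernelMeasure m n k]
      fun q => pJac m n l (f q.1) - pJac m n l (f q.2) := by
    intro l
    have e := (memLp_pJac hm hn l).coeFn_toLp
    filter_upwards [coeFn_differenceMap hk hm hn h1 (pLp hm hn l),
      hfst.quasiMeasurePreserving.ae e, hsnd.quasiMeasurePreserving.ae e] with q e1 e2 e3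
    rw [e1, ← show _ = pJac m n l (f q.1) from e2, ← show _ = pJac m n l (f q.2) from e3]
    rfl
  rw [L2.inner_def]
  have e : ∫ q, inner ℝ (differenceMap hk hm hn h1 (pLp hm hn j) q)
        (differenceMap hk hm hn h1 (pLp hm hn i) q) ∂(kernelMeasure m n k)
      = ∫ q, (pJac m n j (f q.1) * pJac m n i (f q.1) + pJac m n j (f q.2) * pJac m n i (f q.2))
        - (pJac m n j (f q.1) * pJac m n i (f q.2) + pJac m n j (f q.2) * pJac m n i (f q.1))
        ∂(kernelMeasure m n k) := by
    refine integral_congr_ae ?_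
    filter_upwards [hco i, hco j] with q e1 e2
    rw [e1, e2, RCLike.inner_apply, conj_trivial]
    ring
  rw [e, integral_sub (hI (by fun_prop)) (hI (by fun_prop)),
    integral_add (hI (by fun_prop)) (hI (by fun_prop)),
    integral_add (hI (by fun_prop)) (hI (by fun_prop)), d1, d2, c1, c2]
  split_ifs <;> ring

end Kernel

/-! ### The quadratic form of a bounded zonal kernel in Jacobi coefficients -/

/-- Parseval's identity for the image of a basis that stays orthogonal. It is applied to
`differenceMap`, and with `L = id` to get Parseval for the Jacobi basis. -/
theorem hasSum_norm_sq_apply_of_orthogonal {ι E F : Type*} [NormedAddCommGroup E]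
    [InnerProductSpace ℝ E] [NormedAddCommGroup F] [InnerProductSpace ℝ F] (b : HilbertBasis ι ℝ E)
    (L : E →L[ℝ] F) (hL : ∀ i j, i ≠ j → inner ℝ (L (b i)) (L (b j)) = 0) (w : E) :
    HasSum (fun i => inner ℝ (b i) w ^ 2 * ‖L (b i)‖ ^ 2) (‖L w‖ ^ 2) := by
  have hs : HasSum (fun i => inner ℝ (b i) w • L (b i)) (L w) := by
    have := (b.hasSum_repr w).mapL L
    simpa only [map_smul, b.repr_apply_apply] using this
  have h1 : ∀ i, inner ℝ (L (b i)) (L w) = inner ℝ (b i) w * ‖L (b i)‖ ^ 2 := by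
    intro i
    have h2 := hs.mapL (innerSL ℝ (L (b i)))
    have h3 := hasSum_single (f := fun j => innerSL ℝ (L (b i)) (inner ℝ (b j) w • L (b j))) i
      fun j hj => by
        simp only [innerSL_apply_apply, inner_smul_right, hL i j hj.symm, mul_zero]
    have h4 := h2.unique h3
    simpa only [innerSL_apply_apply, inner_smul_right, real_inner_self_eq_norm_sq] using h4
  have h5 := hs.mapL (innerSL ℝ (L w))
  simp only [innerSL_apply_apply, inner_smul_right, real_inner_self_eq_norm_sq] at h5
  refine h5.congr_fun fun i => ?_
  rw [real_inner_comm (L (b i)), h1]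
  ring

/-- The difference between the eigenvalues of the zonal operator with kernel `k` on constants and
on the `i`-th Jacobi polynomial. -/
def zonalGap (m n : ℕ) (k : ℝ → ℝ) (a : EuclideanSpace ℝ (Fin m)) (i : ℕ) : ℝ :=
  ∫ ζ : Sph m n, k (inner ℝ (pole n a) (ζ : Ambient m n)) *
    (1 - (jac m n i).eval (f ζ) / (jac m n i).eval 1) ∂(surf m n)

/-- The pole `(a, 0)` as a point of the sphere. -/
def spherePole (n : ℕ) {a : EuclideanSpace ℝ (Fin m)} (ha : ‖a‖ = 1) : Sph m n :=
  ⟨pole n a, by rw [mem_sphere_zero_iff_norm, norm_pole ha]⟩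

theorem f_spherePole {a : EuclideanSpace ℝ (Fin m)} (ha : ‖a‖ = 1) : f (spherePole n ha) = 1 := by
  simp [f, spherePole, pole, ha]

theorem lintegral_zonal_eq {k : ℝ → ℝ≥0∞} (z w : Sph m n) :
    ∫⁻ ζ : Sph m n, k (inner ℝ (z : Ambient m n) (ζ : Ambient m n)) ∂(surf m n)
      = ∫⁻ ζ : Sph m n, k (inner ℝ (w : Ambient m n) (ζ : Ambient m n)) ∂(surf m n) := by
  obtain ⟨R, hR⟩ := exists_isometry_apply_eq (x := (w : Ambient m n)) (y := (z : Ambient m n))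
    (by rw [norm_eq_of_mem_sphere, norm_eq_of_mem_sphere])
  rw [← (measurePreserving_sphMap R).lintegral_comp_emb (measurableEmbedding_sphMap R)]
  exact lintegral_congr fun ζ => by rw [coe_sphMap, ← hR, R.inner_map_map]

section

variable {k : ℝ → ℝ} (hk : Measurable k) (hk0 : ∀ t, 0 ≤ k t) {M : ℝ} (hM : ∀ t, k t ≤ M)
  {a : EuclideanSpace ℝ (Fin m)} (ha : ‖a‖ = 1)

-- Evaluating the eigenvalue equation at the pole, where `f = 1`, gives `μ` as the integral of `k ·
-- P_i(f)/P_i(1)`; since `k` has mass 1, `1 - μ` is the gap. The gap is nonnegative because twice it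
-- is a squared norm.
include hk hk0 hM ha in
theorem lintegral_kernel_eq_tsum_of_normalized (hm : 2 ≤ m) (hn : 2 ≤ n)
    (h1 : ∀ z : Sph m n, ∫⁻ w : Sph m n,
      ENNReal.ofReal (k (inner ℝ (z : Ambient m n) (w : Ambient m n))) ∂(surf m n) = 1)
    (w : Lp ℝ 2 (hMeasure m n)) :
    ∫⁻ z : Sph m n, ∫⁻ ζ : Sph m n,
      ENNReal.ofReal (k (inner ℝ (z : Ambient m n) (ζ : Ambient m n))) *
        ENNReal.ofReal (|w (f z) - w (f ζ)| ^ 2) ∂(surf m n) ∂(surf m n)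
      = ∑' i, ENNReal.ofReal (hCoeff m n w i ^ 2) * ENNReal.ofReal (2 * zonalGap m n k a i) ∧
    ∀ i, 0 ≤ zonalGap m n k a i := by
  choose μ hμ using exists_eigenvalue_zonal (m := m) (n := n) hk hk0 hM hm hn
  have hin := fun i => inner_differenceMap_pLp hk hk0 hM hm hn h1 (hμ i)
  have hsum := hasSum_norm_sq_apply_of_orthogonal (jacobiBasis hm hn) (differenceMap hk hm hn h1)
    (fun i j hij => by rw [coe_jacobiBasis, hin, if_neg hij]) w
  have hgap : ∀ i, ‖differenceMap hk hm hn h1 (pLp hm hn i)‖ ^ 2 = 2 * zonalGap m n k a i := by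
    intro i
    have hP := (jac_eval_one_pos hm hn i).ne'
    have hfc := continuous_f (m := m) (n := n)
    rw [← real_inner_self_eq_norm_sq, hin, if_pos rfl, zonalGap]
    have e1 : ∫ ζ : Sph m n, k (inner ℝ (pole n a) (ζ : Ambient m n)) * 1 ∂(surf m n) = 1 := by
      have := h1 (spherePole n ha)
      simp only [mul_one]
      rw [integral_eq_lintegral_of_nonneg_ae (Eventually.of_forall fun _ => hk0 _)
        (hk.comp (by fun_prop)).aestronglyMeasurable]
      exact (congrArg ENNReal.toReal this).trans ENNReal.toReal_one
    have e2 := hμ i (spherePole n ha)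
    rw [f_spherePole, show ((spherePole n ha : Sph m n) : Ambient m n) = pole n a from rfl] at e2
    simp only [mul_sub]
    rw [integral_sub (integrable_kernel_mul hk hk0 hM _ (by fun_prop))
      (integrable_kernel_mul hk hk0 hM _ (by fun_prop)), e1]
    simp only [← mul_div_assoc, integral_div]
    rw [e2, mul_div_cancel_right₀ _ hP]
    ring
  refine ⟨?_, fun i => by nlinarith [hgap i, sq_nonneg ‖differenceMap hk hm hn h1 (pLp hm hn i)‖]⟩
  rw [← ofReal_norm_sq_differenceMap hk hm hn h1, ← hsum.tsum_eq, ENNReal.ofReal_tsum_of_nonneg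
    (fun i => by positivity) hsum.summable]
  refine tsum_congr fun i => ?_
  rw [coe_jacobiBasis, hgap, ← hCoeff_eq_inner, ENNReal.ofReal_mul (sq_nonneg _)]

-- The mass `κ` of the kernel does not depend on the centre, and both sides scale linearly in `k`,
-- so `k` can be divided by `κ`. If `κ = 0`, the kernel vanishes almost everywhere around each
-- centre and both sides are 0.
include hk hk0 hM ha in
theorem lintegral_kernel_eq_tsum (hm : 2 ≤ m) (hn : 2 ≤ n) (w : Lp ℝ 2 (hMeasure m n)) :
    ∫⁻ z : Sph m n, ∫⁻ ζ : Sph m n,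
      ENNReal.ofReal (k (inner ℝ (z : Ambient m n) (ζ : Ambient m n))) *
        ENNReal.ofReal (|w (f z) - w (f ζ)| ^ 2) ∂(surf m n) ∂(surf m n)
      = ∑' i, ENNReal.ofReal (hCoeff m n w i ^ 2) * ENNReal.ofReal (2 * zonalGap m n k a i) ∧
    ∀ i, 0 ≤ zonalGap m n k a i := by
  set κ : ℝ≥0∞ := ∫⁻ ζ : Sph m n, ENNReal.ofReal (k (inner ℝ (pole n a) (ζ : Ambient m n)))
    ∂(surf m n) with hκ
  have hκz : ∀ z : Sph m n, ∫⁻ ζ : Sph m n,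
      ENNReal.ofReal (k (inner ℝ (z : Ambient m n) (ζ : Ambient m n))) ∂(surf m n) = κ :=
    fun z => lintegral_zonal_eq (k := fun t => ENNReal.ofReal (k t)) z (spherePole n ha)
  have hmz : ∀ z : Ambient m n, Measurable fun ζ : Sph m n =>
      ENNReal.ofReal (k (inner ℝ z (ζ : Ambient m n))) := fun z =>
    (hk.comp (by fun_prop)).ennreal_ofReal
  have hκt : κ ≠ ⊤ := by
    refine ((lintegral_mono fun ζ => ENNReal.ofReal_le_ofReal (hM _)).trans_lt ?_).ne
    rw [lintegral_const]
    exact ENNReal.mul_lt_top ENNReal.ofReal_lt_top (measure_lt_top _ _)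
  by_cases hκ0 : κ = 0
  · have h0 : ∀ z : Sph m n, ∀ᵐ ζ : Sph m n ∂(surf m n),
        k (inner ℝ (z : Ambient m n) (ζ : Ambient m n)) = 0 := by
      intro z
      have := (lintegral_eq_zero_iff (hmz z)).1 ((hκz z).trans hκ0)
      filter_upwards [this] with ζ hζ
      exact le_antisymm (ENNReal.ofReal_eq_zero.1 hζ) (hk0 _)
    have hl : ∀ z : Sph m n, ∫⁻ ζ : Sph m n,
        ENNReal.ofReal (k (inner ℝ (z : Ambient m n) (ζ : Ambient m n))) *
        ENNReal.ofReal (|w (f z) - w (f ζ)| ^ 2) ∂(surf m n) = 0 := by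
      intro z
      rw [← lintegral_zero (μ := surf m n)]
      refine lintegral_congr_ae ?_
      filter_upwards [h0 z] with ζ hζ
      rw [hζ, ENNReal.ofReal_zero, zero_mul]
    have hr : ∀ i, zonalGap m n k a i = 0 := by
      intro i
      refine integral_eq_zero_of_ae ?_
      filter_upwards [h0 (spherePole n ha)] with ζ hζ
      rw [show k (inner ℝ (pole n a) (ζ : Ambient m n)) = 0 from hζ, zero_mul, Pi.zero_apply]
    refine ⟨?_, fun i => (hr i).ge⟩
    simp only [hl, hr, lintegral_zero, mul_zero, ENNReal.ofReal_zero, tsum_zero]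
  · have hc : 0 < κ.toReal := ENNReal.toReal_pos hκ0 hκt
    set c := κ.toReal with hcdef
    have hscale : ∀ t, k t = c * (k t / c) := fun t => by field_simp
    have hof : ∀ t, ENNReal.ofReal (k t) = ENNReal.ofReal c * ENNReal.ofReal (k t / c) := by
      intro t
      rw [← ENNReal.ofReal_mul hc.le, ← hscale]
    have h1 : ∀ z : Sph m n, ∫⁻ ζ : Sph m n,
        ENNReal.ofReal (k (inner ℝ (z : Ambient m n) (ζ : Ambient m n)) / c) ∂(surf m n) = 1 := by
      intro z
      have h2 := hκz z
      simp only [hof] at h2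
      rw [lintegral_const_mul' _ _ ENNReal.ofReal_ne_top, hcdef, ENNReal.ofReal_toReal hκt] at h2
      have h3 : κ * _ = κ * 1 := h2.trans (mul_one κ).symm
      exact (ENNReal.mul_right_inj hκ0 hκt).1 h3
    obtain ⟨key, key0⟩ := lintegral_kernel_eq_tsum_of_normalized (m := m) (n := n) (k := fun t => k t / c)
      (hk.div_const c) (fun t => div_nonneg (hk0 t) hc.le) (M := M / c)
      (fun t => div_le_div_of_nonneg_right (hM t) hc.le) ha hm hn h1 w
    have hg : ∀ i, zonalGap m n k a i = c * zonalGap m n (fun t => k t / c) a i := by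
      intro i
      rw [zonalGap, zonalGap, ← integral_const_mul]
      refine integral_congr_ae (Eventually.of_forall fun ζ => ?_)
      simp only
      rw [← mul_assoc, ← hscale]
    have hl : ∀ i, ENNReal.ofReal (2 * zonalGap m n k a i) =
        ENNReal.ofReal c * ENNReal.ofReal (2 * zonalGap m n (fun t => k t / c) a i) := by
      intro i
      rw [hg, ← ENNReal.ofReal_mul hc.le]
      congr 1
      ring
    refine ⟨?_, fun i => by rw [hg]; exact mul_nonneg hc.le (key0 i)⟩
    simp only [hof, hl, mul_assoc, lintegral_const_mul' _ _ ENNReal.ofReal_ne_top]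
    rw [key, ← ENNReal.tsum_mul_left]
    exact tsum_congr fun i => by ring

end

/-! ### The spectral gaps of the Riesz kernel -/

/-- The Jacobi polynomial, normalized at `1`, as a terminating hypergeometric series. -/
theorem jac_eval_div_eval_one {N : ℕ} (h : m + n = N + 1) (hm : 2 ≤ m) (hn : 2 ≤ n) (i : ℕ)
    (t : ℝ) : (jac m n i).eval t / (jac m n i).eval 1 = ∑ k ∈ Finset.range (i + 1),
      ((-1) ^ k * (i.choose k : ℝ) * rising (((N : ℝ) - 1) / 2 + i) k / rising (n / 2) k) *
        ((1 - t) / 2) ^ k := by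
  have h' : (m : ℝ) + n = N + 1 := by exact_mod_cast h
  have hm' : (2 : ℝ) ≤ m := by exact_mod_cast hm
  have hn' : (2 : ℝ) ≤ n := by exact_mod_cast hn
  have hi : (0 : ℝ) ≤ i := i.cast_nonneg
  have h0 : (jac m n i).eval 1 = 2 ^ i *
      ∏ j ∈ Finset.range i, ((alpha n + j + 1) / (alpha n + beta m + i + j + 1)) := by
    rw [jac, jacobi, Polynomial.eval_finsetSum, Finset.sum_range_succ', Finset.sum_eq_zero]
    · simp
    · intro k _
      simp
  have hpos := jac_eval_one_pos hm hn i
  rw [div_eq_iff hpos.ne', Finset.sum_mul, h0]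
  conv_lhs => rw [jac, jacobi, Polynomial.eval_finsetSum]
  refine Finset.sum_congr rfl fun k hk => ?_
  have hki : k ≤ i := Nat.lt_succ_iff.1 (Finset.mem_range.1 hk)
  simp only [Polynomial.eval_mul, Polynomial.eval_C, Polynomial.eval_pow, Polynomial.eval_sub,
    Polynomial.eval_X, Polynomial.eval_one]
  have hR1 : 0 < rising ((n : ℝ) / 2) k := rising_pos (by linarith) k
  have hR2 : 0 < rising (((N : ℝ) - 1) / 2 + i) k := rising_pos (by linarith) k
  -- The parameters come from `α + 1 = n/2` and `α + β + 1 = (N - 1)/2`.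
  have hp : ∏ j ∈ Finset.range k, ((alpha n + j + 1) / (alpha n + beta m + i + j + 1))
      = rising (n / 2) k / rising (((N : ℝ) - 1) / 2 + i) k := by
    rw [Finset.prod_div_distrib, rising, rising]
    congr 1
    · exact Finset.prod_congr rfl fun j _ => by rw [alpha]; ring
    · exact Finset.prod_congr rfl fun j _ => by rw [alpha, beta]; linarith
  rw [← Finset.prod_range_mul_prod_Ico _ hki, hp,
    show (2 : ℝ) ^ i = 2 ^ (i - k) * 2 ^ k by rw [← pow_add, Nat.sub_add_cancel hki],
    show t - 1 = -1 * (1 - t) by ring, mul_pow, div_pow]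
  generalize rising (((N : ℝ) - 1) / 2 + i) k = R at *
  field_simp

/-- The Riesz kernel `|z - ζ|^{-2p}` as a function of `⟨z, ζ⟩`. -/
def rieszKernel (p t : ℝ) : ℝ := |2 - 2 * t| ^ (-p)

theorem measurable_rieszKernel (p : ℝ) : Measurable (rieszKernel p) :=
  (by fun_prop : Measurable fun t : ℝ => |2 - 2 * t|).pow_const _

theorem rieszKernel_nonneg (p t : ℝ) : 0 ≤ rieszKernel p t := Real.rpow_nonneg (abs_nonneg _) _

theorem dist_sq_eq (z ζ : Sph m n) :
    dist z ζ ^ 2 = 2 - 2 * inner ℝ (z : Ambient m n) (ζ : Ambient m n) := by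
  rw [Subtype.dist_eq, dist_eq_norm, norm_sub_sq_real, norm_eq_of_mem_sphere,
    norm_eq_of_mem_sphere]
  ring

/-- The diagonal needs no exception: the power law for negative exponents holds at base 0 with `0⁻¹
= 0`, the same convention as in the quotient defining the energy. -/
theorem rieszKernel_inner (p : ℝ) (z ζ : Sph m n) :
    rieszKernel p (inner ℝ (z : Ambient m n) (ζ : Ambient m n)) = (dist z ζ ^ (2 * p))⁻¹ := by
  rw [rieszKernel, ← dist_sq_eq, abs_of_nonneg (sq_nonneg _), Real.rpow_neg (sq_nonneg _),
    Real.rpow_mul dist_nonneg, Real.rpow_two]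

theorem lintegral_rieszKernel {N : ℕ} (h : m + n = N + 1) (hm : 2 ≤ m) (hn : 2 ≤ n) (k : ℕ)
    {a : EuclideanSpace ℝ (Fin m)} (ha : ‖a‖ = 1) {p : ℝ} (hp : p < k + N / 2) :
    ∫⁻ w : Sph m n, ENNReal.ofReal (rieszKernel p (inner ℝ (pole n a) (w : Ambient m n)) *
        ((1 - f w) / 2) ^ k) ∂(surf m n)
      = ENNReal.ofReal (2 * Real.pi ^ ((N : ℝ) / 2) *
        (Real.Gamma (k + n / 2) / Real.Gamma (n / 2)) * 2 ^ (2 * k + N - 1 - 2 * p) *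
        Real.Gamma (k + N / 2 - p) / Real.Gamma (2 * k + N - p)) := by
  rw [← lintegral_riesz_kernel h hm hn k ha hp]
  refine lintegral_congr fun w => ?_
  have h2 : 0 ≤ 2 - 2 * inner ℝ (pole n a) (w : Ambient m n) := by
    have := dist_sq_eq (spherePole n ha) w
    rw [show ((spherePole n ha : Sph m n) : Ambient m n) = pole n a from rfl] at this
    rw [← this]
    positivity
  rw [← norm_snd_sq, ← pow_mul, rieszKernel, abs_of_nonneg h2,
    ENNReal.ofReal_mul (Real.rpow_nonneg h2 _), mul_comm]

theorem integrable_rieszKernel_mul {N : ℕ} (h : m + n = N + 1) (hm : 2 ≤ m) (hn : 2 ≤ n) (k : ℕ)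
    {a : EuclideanSpace ℝ (Fin m)} (ha : ‖a‖ = 1) {p : ℝ} (hp : p < k + N / 2) :
    Integrable (fun w : Sph m n => rieszKernel p (inner ℝ (pole n a) (w : Ambient m n)) *
        ((1 - f w) / 2) ^ k) (surf m n) := by
  have hfc := continuous_f (m := m) (n := n)
  refine ⟨((measurable_rieszKernel p).comp (by fun_prop)).aestronglyMeasurable.mul
    (by fun_prop : Continuous _).aestronglyMeasurable, ?_⟩
  rw [hasFiniteIntegral_iff_ofReal, lintegral_rieszKernel h hm hn k ha hp]
  · exact ENNReal.ofReal_lt_top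
  · exact Eventually.of_forall fun w => mul_nonneg (rieszKernel_nonneg _ _)
      (pow_nonneg (by linarith [(f_mem_Icc w).2]) _)

theorem integral_rieszKernel_mul {N : ℕ} (h : m + n = N + 1) (hm : 2 ≤ m) (hn : 2 ≤ n) (k : ℕ)
    {a : EuclideanSpace ℝ (Fin m)} (ha : ‖a‖ = 1) {p : ℝ} (hp : p < k + N / 2) :
    ∫ w : Sph m n, rieszKernel p (inner ℝ (pole n a) (w : Ambient m n)) *
        ((1 - f w) / 2) ^ k ∂(surf m n)
      = 2 * Real.pi ^ ((N : ℝ) / 2) *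
        (Real.Gamma (k + n / 2) / Real.Gamma (n / 2)) * 2 ^ (2 * k + N - 1 - 2 * p) *
        Real.Gamma (k + N / 2 - p) / Real.Gamma (2 * k + N - p) := by
  have hfc := continuous_f (m := m) (n := n)
  have hN0 : (0 : ℝ) < N := by exact_mod_cast (by omega : 0 < N)
  have hn0 : (0 : ℝ) < n := by exact_mod_cast (by omega : 0 < n)
  have hk0 : (0 : ℝ) ≤ k := k.cast_nonneg
  rw [integral_eq_lintegral_of_nonneg_ae, lintegral_rieszKernel h hm hn k ha hp,
    ENNReal.toReal_ofReal]
  · have p1 : 0 < Real.Gamma (k + N / 2 - p) := Real.Gamma_pos_of_pos (by linarith)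
    have p2 : 0 < Real.Gamma (2 * k + N - p) := Real.Gamma_pos_of_pos (by linarith)
    have p3 : 0 < Real.Gamma (n / 2) := Real.Gamma_pos_of_pos (by positivity)
    have p4 : 0 < Real.Gamma (k + n / 2) := Real.Gamma_pos_of_pos (by positivity)
    have := Real.pi_pos
    positivity
  · exact Eventually.of_forall fun w => mul_nonneg (rieszKernel_nonneg _ _)
      (pow_nonneg (by linarith [(f_mem_Icc w).2]) _)
  · exact ((measurable_rieszKernel p).comp (by fun_prop)).aestronglyMeasurable.mul
      (by fun_prop : Continuous _).aestronglyMeasurable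

/-- The constant term cancels, so the difference is divisible by `(1 - t)/2`, that is by `|y|²` on
the sphere. This is why the gap converges for `p < 1 + N/2`, although the kernel need not be
integrable. -/
theorem one_sub_jac_eval_div {N : ℕ} (h : m + n = N + 1) (hm : 2 ≤ m) (hn : 2 ≤ n) (i : ℕ)
    (t : ℝ) : 1 - (jac m n i).eval t / (jac m n i).eval 1 = -∑ k ∈ Finset.range i,
      ((-1) ^ (k + 1) * (i.choose (k + 1) : ℝ) * rising (((N : ℝ) - 1) / 2 + i) (k + 1) /
        rising (n / 2) (k + 1)) * ((1 - t) / 2) ^ (k + 1) := by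
  rw [jac_eval_div_eval_one h hm hn, Finset.sum_range_succ']
  simp [rising_zero]

/-- The spectral gaps of the truncated Riesz kernels converge to those of the Riesz kernel. -/
theorem tendsto_zonalGap_min {N : ℕ} (h : m + n = N + 1) (hm : 2 ≤ m) (hn : 2 ≤ n)
    {a : EuclideanSpace ℝ (Fin m)} (ha : ‖a‖ = 1) {p : ℝ} (hp : p < 1 + N / 2) (i : ℕ) :
    Tendsto (fun M : ℕ => zonalGap m n (fun t => min (rieszKernel p t) M) a i) atTop
      (𝓝 (zonalGap m n (rieszKernel p) a i)) := by
  have hfc := continuous_f (m := m) (n := n)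
  set c : ℕ → ℝ := fun k => ((-1) ^ (k + 1) * (i.choose (k + 1) : ℝ) *
    rising (((N : ℝ) - 1) / 2 + i) (k + 1) / rising (n / 2) (k + 1)) with hc
  -- A multiple of the kernel times `(1 - f)/2` dominates all truncated integrands, because `0 ≤ (1
  -- - f)/2 ≤ 1` bounds higher powers by the first.
  have hint := integrable_rieszKernel_mul h hm hn 1 ha (p := p) (by exact_mod_cast hp)
  refine tendsto_integral_of_dominated_convergence
    (fun w : Sph m n => (∑ k ∈ Finset.range i, |c k|) *
      (rieszKernel p (inner ℝ (pole n a) (w : Ambient m n)) * ((1 - f w) / 2) ^ 1))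
    (fun M => ?_) (hint.const_mul _) (fun M => Eventually.of_forall fun w => ?_)
    (Eventually.of_forall fun w => ?_)
  · exact (((measurable_rieszKernel p).min measurable_const).comp
      (by fun_prop)).aestronglyMeasurable.mul (by fun_prop : Continuous _).aestronglyMeasurable
  · have h0 : 0 ≤ (1 - f w) / 2 := by linarith [(f_mem_Icc w).2]
    have h1 : (1 - f w) / 2 ≤ 1 := by linarith [(f_mem_Icc w).1]
    have hK := rieszKernel_nonneg p (inner ℝ (pole n a) (w : Ambient m n))
    have hb : |1 - (jac m n i).eval (f w) / (jac m n i).eval 1|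
        ≤ (∑ k ∈ Finset.range i, |c k|) * ((1 - f w) / 2) ^ 1 := by
      rw [one_sub_jac_eval_div h hm hn, abs_neg, Finset.sum_mul]
      refine (Finset.abs_sum_le_sum_abs _ _).trans (Finset.sum_le_sum fun k _ => ?_)
      rw [abs_mul, abs_of_nonneg (pow_nonneg h0 _)]
      exact mul_le_mul_of_nonneg_left (pow_le_pow_of_le_one h0 h1 (by omega)) (abs_nonneg _)
    rw [norm_mul, Real.norm_eq_abs, Real.norm_eq_abs,
      abs_of_nonneg (le_min hK M.cast_nonneg), mul_left_comm]
    exact mul_le_mul (min_le_left _ _) hb (abs_nonneg _) hK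
  · refine Tendsto.mul_const _ ?_
    refine tendsto_const_nhds.congr' ?_
    filter_upwards [eventually_ge_atTop ⌈rieszKernel p (inner ℝ (pole n a) (w : Ambient m n))⌉₊]
      with M hM
    rw [min_eq_left ((Nat.le_ceil _).trans (by exact_mod_cast hM))]

/-- The hypergeometric expansion writes the gap as a finite combination of kernel moments. After
multiplication by `c_{N,s}` these are the terms with index at least 1 of `sum_saalschutz` for `c =
N/2 - s`, times `A_{N,s}`; the zeroth-order term `A_{N,s}` of the norm supplies the term of index 0.
-/
theorem zonalGap_rieszKernel {N : ℕ} (h : m + n = N + 1) (hm : 2 ≤ m) (hn : 2 ≤ n)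
    {a : EuclideanSpace ℝ (Fin m)} (ha : ‖a‖ = 1) {s : ℝ} (hs0 : 0 < s) (hs1 : s < 1) (i : ℕ) :
    cConst N s * zonalGap m n (rieszKernel (N / 2 + s)) a i + aConst N s
      = symbol N s (eigenval N i) := by
  have h' : (m : ℝ) + n = N + 1 := by exact_mod_cast h
  have hm' : (2 : ℝ) ≤ m := by exact_mod_cast hm
  have hn' : (2 : ℝ) ≤ n := by exact_mod_cast hn
  have hi : (0 : ℝ) ≤ i := i.cast_nonneg
  have hN : (3 : ℝ) ≤ N := by linarith
  have hsne : ∀ k : ℕ, -s ≠ -(k : ℝ) := by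
    intro k hk
    rcases k with _ | k
    · simp only [Nat.cast_zero] at hk; linarith
    · push_cast at hk; linarith [k.cast_nonneg (α := ℝ)]
  have hcpos : 0 < (N : ℝ) / 2 - s := by linarith
  have hne : ∀ {x : ℝ}, 0 < x → ∀ k : ℕ, x ≠ -k := fun hx k hk => by
    linarith [k.cast_nonneg (α := ℝ)]
  have hG2 : Real.Gamma (2 - s) = (1 - s) * Real.Gamma (1 - s) := by
    rw [← Real.Gamma_add_one (by linarith)]; congr 1; ring
  have hG1 : Real.Gamma (1 - s) = -s * Real.Gamma (-s) := by
    rw [← Real.Gamma_add_one (by linarith)]; congr 1; ring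
  have hGs : Real.Gamma (-s) ≠ 0 := by
    intro h0
    rw [h0, mul_zero] at hG1
    exact (Real.Gamma_pos_of_pos (by linarith : 0 < 1 - s)).ne' hG1
  have hGc : 0 < Real.Gamma ((N : ℝ) / 2 - s) := Real.Gamma_pos_of_pos hcpos
  have hGn : 0 < Real.Gamma ((n : ℝ) / 2) := Real.Gamma_pos_of_pos (by linarith)
  have hπ : Real.pi ^ (-(N : ℝ) / 2) * Real.pi ^ ((N : ℝ) / 2) = 1 := by
    rw [← Real.rpow_add Real.pi_pos]; simp [neg_div]
  -- The normalization of `c_{N,s}` is tuned for this: `s (1 - s)/Γ(2 - s) = -1/Γ(-s)` cancels the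
  -- `Γ(-s)` of the moment, and `4^s` and `π^{-N/2}` cancel the remaining powers.
  have hterm : ∀ k : ℕ, cConst N s * (2 * Real.pi ^ ((N : ℝ) / 2) *
        (Real.Gamma ((k + 1 : ℕ) + n / 2) / Real.Gamma (n / 2)) *
        2 ^ (2 * ((k + 1 : ℕ) : ℝ) + N - 1 - 2 * (N / 2 + s)) *
        Real.Gamma ((k + 1 : ℕ) + N / 2 - (N / 2 + s)) /
          Real.Gamma (2 * (k + 1 : ℕ) + N - (N / 2 + s)))
      = -(aConst N s * (rising (n / 2) (k + 1) * rising (-s) (k + 1) * 4 ^ (k + 1) /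
          rising (N / 2 - s) (2 * (k + 1)))) := by
    intro k
    have e1 : Real.Gamma ((k + 1 : ℕ) + n / 2) = rising (n / 2) (k + 1) * Real.Gamma (n / 2) := by
      rw [add_comm, Gamma_add_nat (hne (by linarith))]
    have e2 : Real.Gamma ((k + 1 : ℕ) + N / 2 - (N / 2 + s))
        = rising (-s) (k + 1) * Real.Gamma (-s) := by
      rw [← Gamma_add_nat hsne]; congr 1; ring
    have e3 : Real.Gamma (2 * (k + 1 : ℕ) + N - (N / 2 + s))
        = rising (N / 2 - s) (2 * (k + 1)) * Real.Gamma (N / 2 - s) := by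
      rw [← Gamma_add_nat (hne hcpos)]; congr 1; push_cast; ring
    have e4 : (4 : ℝ) ^ s * (2 * 2 ^ (2 * ((k + 1 : ℕ) : ℝ) + N - 1 - 2 * (N / 2 + s)))
        = 4 ^ (k + 1) := by
      have : (2 : ℝ) * 2 ^ (2 * ((k + 1 : ℕ) : ℝ) + N - 1 - 2 * (N / 2 + s))
          = 2 ^ (2 * (((k + 1 : ℕ) : ℝ) - s)) := by
        rw [← Real.rpow_one_add' (by norm_num)]
        · congr 1; ring
        · have : (0 : ℝ) ≤ k := k.cast_nonneg
          push_cast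
          nlinarith
      rw [this, Real.rpow_mul (by norm_num), Real.rpow_two, show (2 : ℝ) ^ 2 = 4 by norm_num,
        ← Real.rpow_add (by norm_num), add_sub_cancel, Real.rpow_natCast]
    have hr := rising_pos hcpos (2 * (k + 1))
    rw [e1, e2, e3, cConst, aConst, hG2, hG1, ← e4]
    have h1s : 1 - s ≠ 0 := by linarith
    generalize Real.pi ^ (-(N : ℝ) / 2) = A at *
    generalize Real.pi ^ ((N : ℝ) / 2) = B at *
    generalize (2 : ℝ) ^ (2 * ((k + 1 : ℕ) : ℝ) + N - 1 - 2 * (N / 2 + s)) = D at *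
    generalize (4 : ℝ) ^ s = F at *
    generalize rising ((N : ℝ) / 2 - s) (2 * (k + 1)) = R at *
    generalize Real.Gamma ((N : ℝ) / 2 - s) = G at *
    have hA : A ≠ 0 := left_ne_zero_of_mul_eq_one hπ
    obtain rfl : B = A⁻¹ := eq_inv_of_mul_eq_one_right hπ
    field_simp
  have hgap : zonalGap m n (rieszKernel (N / 2 + s)) a i = -∑ k ∈ Finset.range i,
      ((-1) ^ (k + 1) * (i.choose (k + 1) : ℝ) * rising (((N : ℝ) - 1) / 2 + i) (k + 1) /
        rising (n / 2) (k + 1)) * (2 * Real.pi ^ ((N : ℝ) / 2) *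
        (Real.Gamma ((k + 1 : ℕ) + n / 2) / Real.Gamma (n / 2)) *
        2 ^ (2 * ((k + 1 : ℕ) : ℝ) + N - 1 - 2 * (N / 2 + s)) *
        Real.Gamma ((k + 1 : ℕ) + N / 2 - (N / 2 + s)) /
          Real.Gamma (2 * (k + 1 : ℕ) + N - (N / 2 + s))) := by
    have hp : ∀ k : ℕ, (N : ℝ) / 2 + s < (k + 1 : ℕ) + N / 2 := by
      intro k
      push_cast
      linarith [k.cast_nonneg (α := ℝ)]
    rw [zonalGap]
    simp only [one_sub_jac_eval_div h hm hn, mul_neg, Finset.mul_sum]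
    rw [integral_neg, integral_finsetSum]
    · congr 1
      refine Finset.sum_congr rfl fun k _ => ?_
      rw [← integral_rieszKernel_mul h hm hn (k + 1) ha (hp k), ← integral_const_mul]
      exact integral_congr_ae (Eventually.of_forall fun w => by simp only; ring)
    · intro k _
      refine ((integrable_rieszKernel_mul h hm hn (k + 1) ha (hp k)).const_mul
        ((-1) ^ (k + 1) * (i.choose (k + 1) : ℝ) * rising (((N : ℝ) - 1) / 2 + i) (k + 1) /
        rising (n / 2) (k + 1))).congr (Eventually.of_forall fun w => ?_)
      simp only
      ring
  have hsum := sum_saalschutz hcpos hs0 (by linarith) i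
  rw [Finset.sum_range_succ'] at hsum
  have hsymb : symbol N s (eigenval N i) = aConst N s *
      (rising (N / 2 - s + 2 * s) (2 * i) / rising (N / 2 - s) (2 * i)) := by
    -- `λ_i` is the sphere eigenvalue `ℓ(ℓ + N - 1)` for `ℓ = 2i`, so the radicand is a perfect
    -- square.
    have hsq : √(eigenval N i + (((N : ℝ) - 1) / 2) ^ 2) = 2 * i + (N - 1) / 2 := by
      rw [Real.sqrt_eq_iff_mul_self_eq_of_pos (by linarith), eigenval]
      ring
    rw [symbol, hsq, aConst,
      show (1 : ℝ) / 2 + s + (2 * i + (N - 1) / 2) = (N / 2 - s + 2 * s) + (2 * i : ℕ) by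
        push_cast; ring,
      show (1 : ℝ) / 2 - s + (2 * i + (N - 1) / 2) = (N / 2 - s) + (2 * i : ℕ) by
        push_cast; ring,
      Gamma_add_nat (hne (by linarith)), Gamma_add_nat (hne hcpos),
      show (N : ℝ) / 2 - s + 2 * s = N / 2 + s by ring, mul_comm, div_mul_div_comm]
    ring
  rw [hsymb, ← hsum, hgap, mul_neg, Finset.mul_sum, ← Finset.sum_neg_distrib,
    mul_add (aConst N s), Finset.mul_sum _ _ (aConst N s)]
  congr 1
  · refine Finset.sum_congr rfl fun k _ => ?_
    have hr := rising_pos (show 0 < (n : ℝ) / 2 by linarith) (k + 1)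
    have hx : (N : ℝ) / 2 - s + s - 1 / 2 + i = (N - 1) / 2 + i := by ring
    rw [mul_left_comm, hterm k, hx]
    field_simp
  · simp [rising_zero]

/-! ### From truncated kernels to the singular kernel; equality of energies -/

theorem hCoeff_pLp (hm : 2 ≤ m) (hn : 2 ≤ n) (i j : ℕ) :
    hCoeff m n (pLp hm hn i) j = if j = i then 1 else 0 := by
  rw [hCoeff_eq_inner hm hn, orthonormal_iff_ite.1 (orthonormal_pLp hm hn)]

/-- Writing the gap as the energy of `p_i` makes its monotonicity in the kernel evident; in the
defining integral the integrand has no obvious sign. -/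
theorem lintegral_kernel_pLp {k : ℝ → ℝ} (hk : Measurable k) (hk0 : ∀ t, 0 ≤ k t) {M : ℝ}
    (hM : ∀ t, k t ≤ M) {a : EuclideanSpace ℝ (Fin m)} (ha : ‖a‖ = 1) (hm : 2 ≤ m) (hn : 2 ≤ n)
    (i : ℕ) :
    ∫⁻ z : Sph m n, ∫⁻ ζ : Sph m n,
      ENNReal.ofReal (k (inner ℝ (z : Ambient m n) (ζ : Ambient m n))) *
        ENNReal.ofReal (|pLp hm hn i (f z) - pLp hm hn i (f ζ)| ^ 2) ∂(surf m n) ∂(surf m n)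
      = ENNReal.ofReal (2 * zonalGap m n k a i) := by
  rw [(lintegral_kernel_eq_tsum hk hk0 hM ha hm hn (pLp hm hn i)).1, tsum_eq_single i]
  · simp [hCoeff_pLp]
  · intro j hj
    simp [hCoeff_pLp, hj]

theorem measurable_kernel_energy {k : ℝ → ℝ} (hk : Measurable k) (w : Lp ℝ 2 (hMeasure m n)) :
    Measurable fun q : Sph m n × Sph m n =>
      ENNReal.ofReal (k (inner ℝ (q.1 : Ambient m n) (q.2 : Ambient m n))) *
        ENNReal.ofReal (|w (f q.1) - w (f q.2)| ^ 2) := by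
  have hwm : Measurable w := (Lp.stronglyMeasurable w).measurable
  have hf := measurable_f (m := m) (n := n)
  simp only [sq_abs]
  exact (measurable_zonal_kernel hk).ennreal_ofReal.mul (((hwm.comp (hf.comp measurable_fst)).sub
    (hwm.comp (hf.comp measurable_snd))).pow_const 2).ennreal_ofReal

/-- The identity holds for the bounded kernels `min (rieszKernel p) M`. As `M` grows, monotone
convergence applies to the double integral and to the series, so no finiteness of the energy is
assumed. -/
theorem lintegral_rieszKernel_eq_tsum {N : ℕ} (h : m + n = N + 1) (hm : 2 ≤ m) (hn : 2 ≤ n)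
    {a : EuclideanSpace ℝ (Fin m)} (ha : ‖a‖ = 1) {p : ℝ} (hp : p < 1 + N / 2)
    (w : Lp ℝ 2 (hMeasure m n)) :
    ∫⁻ z : Sph m n, ∫⁻ ζ : Sph m n,
      ENNReal.ofReal (rieszKernel p (inner ℝ (z : Ambient m n) (ζ : Ambient m n))) *
        ENNReal.ofReal (|w (f z) - w (f ζ)| ^ 2) ∂(surf m n) ∂(surf m n)
      = ∑' i, ENNReal.ofReal (hCoeff m n w i ^ 2) *
        ENNReal.ofReal (2 * zonalGap m n (rieszKernel p) a i) := by
  set k : ℕ → ℝ → ℝ := fun M t => min (rieszKernel p t) M with hk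
  have hkm : ∀ M, Measurable (k M) := fun M => (measurable_rieszKernel p).min measurable_const
  have hk0 : ∀ M t, 0 ≤ k M t := fun M t => le_min (rieszKernel_nonneg p t) M.cast_nonneg
  have hkM : ∀ M t, k M t ≤ M := fun M t => min_le_right _ _
  have hkmono : ∀ t, Monotone fun M => k M t := fun t M M' hMM' =>
    min_le_min_left _ (by exact_mod_cast hMM')
  have hklim : ∀ t, Tendsto (fun M => k M t) atTop (𝓝 (rieszKernel p t)) := by
    intro t
    refine tendsto_const_nhds.congr' ?_
    filter_upwards [eventually_ge_atTop ⌈rieszKernel p t⌉₊] with M hM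
    exact (min_eq_left ((Nat.le_ceil _).trans (by exact_mod_cast hM))).symm
  have key := fun M (w : Lp ℝ 2 (hMeasure m n)) =>
    (lintegral_kernel_eq_tsum (hkm M) (hk0 M) (hkM M) ha hm hn w).1
  have hgmono : ∀ i, Monotone fun M => ENNReal.ofReal (2 * zonalGap m n (k M) a i) := by
    intro i M M' hMM'
    simp only
    rw [← lintegral_kernel_pLp (hkm M) (hk0 M) (hkM M) ha hm hn,
      ← lintegral_kernel_pLp (hkm M') (hk0 M') (hkM M') ha hm hn]
    refine lintegral_mono fun z => lintegral_mono fun ζ => mul_le_mul_left ?_ _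
    exact ENNReal.ofReal_le_ofReal (hkmono _ hMM')
  have hR : Tendsto (fun M => ∑' i, ENNReal.ofReal (hCoeff m n w i ^ 2) *
      ENNReal.ofReal (2 * zonalGap m n (k M) a i)) atTop (𝓝 (∑' i,
        ENNReal.ofReal (hCoeff m n w i ^ 2) *
          ENNReal.ofReal (2 * zonalGap m n (rieszKernel p) a i))) := by
    -- The series is read as an integral over the counting measure, to which monotone convergence
    -- applies.
    simp only [← lintegral_count]
    refine lintegral_tendsto_of_tendsto_of_monotone (fun M => (measurable_of_countable _).aemeasurable)
      (Eventually.of_forall fun i M M' hMM' => mul_le_mul_right (hgmono i hMM') _)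
      (Eventually.of_forall fun i => ?_)
    refine ENNReal.Tendsto.const_mul ?_ (Or.inr ENNReal.ofReal_ne_top)
    exact ENNReal.tendsto_ofReal ((tendsto_zonalGap_min h hm hn ha hp i).const_mul 2)
  have hL : Tendsto (fun M => ∫⁻ q : Sph m n × Sph m n,
      ENNReal.ofReal (k M (inner ℝ (q.1 : Ambient m n) (q.2 : Ambient m n))) *
        ENNReal.ofReal (|w (f q.1) - w (f q.2)| ^ 2) ∂((surf m n).prod (surf m n))) atTop
      (𝓝 (∫⁻ q : Sph m n × Sph m n,
      ENNReal.ofReal (rieszKernel p (inner ℝ (q.1 : Ambient m n) (q.2 : Ambient m n))) *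
        ENNReal.ofReal (|w (f q.1) - w (f q.2)| ^ 2) ∂((surf m n).prod (surf m n)))) := by
    refine lintegral_tendsto_of_tendsto_of_monotone
      (fun M => (measurable_kernel_energy (hkm M) w).aemeasurable)
      (Eventually.of_forall fun q M M' hMM' =>
        mul_le_mul_left (ENNReal.ofReal_le_ofReal (hkmono _ hMM')) _)
      (Eventually.of_forall fun q => ?_)
    exact ENNReal.Tendsto.mul_const (ENNReal.tendsto_ofReal (hklim _))
      (Or.inr ENNReal.ofReal_ne_top)
  rw [lintegral_prod _ (measurable_kernel_energy (measurable_rieszKernel p) w).aemeasurable] at hL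
  refine tendsto_nhds_unique hL (hR.congr fun M => ?_)
  rw [lintegral_prod _ (measurable_kernel_energy (hkm M) w).aemeasurable, key]

theorem zonalGap_rieszKernel_nonneg {N : ℕ} (h : m + n = N + 1) (hm : 2 ≤ m) (hn : 2 ≤ n)
    {a : EuclideanSpace ℝ (Fin m)} (ha : ‖a‖ = 1) {p : ℝ} (hp : p < 1 + N / 2) (i : ℕ) :
    0 ≤ zonalGap m n (rieszKernel p) a i :=
  ge_of_tendsto' (tendsto_zonalGap_min h hm hn ha hp i) fun M =>
    (lintegral_kernel_eq_tsum ((measurable_rieszKernel p).min measurable_const)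
      (fun t => le_min (rieszKernel_nonneg p t) M.cast_nonneg) (fun _ => min_le_right _ _)
      ha hm hn 0).2 i

theorem lintegral_sq_eq_tsum_hCoeff (hm : 2 ≤ m) (hn : 2 ≤ n) (w : Lp ℝ 2 (hMeasure m n)) :
    ∫⁻ t, ENNReal.ofReal (w t ^ 2) ∂(hMeasure m n) = ∑' i, ENNReal.ofReal (hCoeff m n w i ^ 2) := by
  have hs := hasSum_norm_sq_apply_of_orthogonal (jacobiBasis hm hn)
    (ContinuousLinearMap.id ℝ (Lp ℝ 2 (hMeasure m n)))
    (fun i j hij => (jacobiBasis hm hn).orthonormal.2 hij) w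
  simp only [ContinuousLinearMap.id_apply, (jacobiBasis hm hn).orthonormal.1, one_pow, mul_one] at hs
  rw [lintegral_sq_eq_norm_sq, ← hs.tsum_eq,
    ENNReal.ofReal_tsum_of_nonneg (fun i => sq_nonneg _) hs.summable]
  exact tsum_congr fun i => by rw [coe_jacobiBasis, hCoeff_eq_inner hm hn]

theorem cConst_nonneg (N : ℕ) {s : ℝ} (hs0 : 0 < s) (hs1 : s < 1) : 0 ≤ cConst N s := by
  have h1 : 0 < Real.Gamma (N / 2 + s) := Real.Gamma_pos_of_pos (by positivity)
  have h2 : 0 < Real.Gamma (2 - s) := Real.Gamma_pos_of_pos (by linarith)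
  have h3 : 0 < 1 - s := by linarith
  have := Real.pi_pos
  unfold cConst
  positivity

theorem aConst_pos {N : ℕ} (hN : 2 ≤ N) {s : ℝ} (hs0 : 0 < s) (hs1 : s < 1) : 0 < aConst N s := by
  have hN' : (2 : ℝ) ≤ N := by exact_mod_cast hN
  exact div_pos (Real.Gamma_pos_of_pos (by positivity)) (Real.Gamma_pos_of_pos (by linarith))

/-- The energy of `w ∘ f` on the sphere is the spectral energy of `w` on `[-1, 1]`. -/
theorem sphereEnergy_comp_f {N : ℕ} (h : m + n = N + 1) (hm : 2 ≤ m) (hn : 2 ≤ n) {s : ℝ}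
    (hs0 : 0 < s) (hs1 : s < 1) (w : Lp ℝ 2 (hMeasure m n)) :
    sphereEnergy N m n s (fun z => w (f z)) = hEnergy N m n s w := by
  obtain ⟨a, ha⟩ := exists_norm_eq_one (show 1 ≤ m by omega)
  have hp : (N : ℝ) / 2 + s < 1 + N / 2 := by linarith
  have hc := cConst_nonneg N hs0 hs1
  have hA := (aConst_pos (N := N) (by omega) hs0 hs1).le
  have e1 : ∀ z ζ : Sph m n,
      ENNReal.ofReal (|w (f z) - w (f ζ)| ^ 2 / dist z ζ ^ ((N : ℝ) + 2 * s))
        = ENNReal.ofReal (rieszKernel (N / 2 + s) (inner ℝ (z : Ambient m n) (ζ : Ambient m n))) *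
          ENNReal.ofReal (|w (f z) - w (f ζ)| ^ 2) := by
    intro z ζ
    rw [← ENNReal.ofReal_mul (rieszKernel_nonneg _ _), rieszKernel_inner,
      show 2 * ((N : ℝ) / 2 + s) = N + 2 * s by ring, div_eq_inv_mul]
  have e2 : ∫⁻ z : Sph m n, ENNReal.ofReal (w (f z) ^ 2) ∂(surf m n)
      = ∑' i, ENNReal.ofReal (hCoeff m n w i ^ 2) := by
    rw [← lintegral_sq_eq_tsum_hCoeff hm hn, ← (measurePreserving_f hm hn).lintegral_comp
      (((Lp.stronglyMeasurable w).measurable.pow_const 2).ennreal_ofReal)]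
  simp only [sphereEnergy, e1, e2]
  rw [lintegral_rieszKernel_eq_tsum h hm hn ha hp, hEnergy, ← ENNReal.tsum_mul_left,
    ← ENNReal.tsum_mul_left, ← ENNReal.tsum_add]
  refine tsum_congr fun i => ?_
  have hg := zonalGap_rieszKernel_nonneg h hm hn ha hp i
  -- The factor 2 in front of the gap cancels the 1/2 in front of `c_{N,s}`.
  rw [← zonalGap_rieszKernel h hm hn ha hs0 hs1, ENNReal.ofReal_mul (sq_nonneg _),
    ENNReal.ofReal_add (mul_nonneg hc hg) hA, mul_add, mul_left_comm,
    ← ENNReal.ofReal_mul (by positivity), mul_comm (ENNReal.ofReal (aConst N s))]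
  congr 3
  ring

/-! ### Smooth functions have finite energy -/

section Smooth

variable {E : Type*} [NormedAddCommGroup E] [InnerProductSpace ℝ E] {N : ℕ}
  [Fact (Module.finrank ℝ E = N + 1)]

/-- Smooth functions on the sphere are Lipschitz: their homogeneous extensions of degree `0` are
smooth away from the origin. -/
theorem exists_lipschitzWith_of_contMDiff_sphere {u : Metric.sphere (0 : E) 1 → ℝ}
    (hu : ContMDiff (𝓡 N) 𝓘(ℝ, ℝ) ∞ u) : ∃ K, LipschitzWith K u := by
  classical
  have : FiniteDimensional ℝ E :=
    Module.finite_of_finrank_pos (by rw [Fact.out (p := Module.finrank ℝ E = N + 1)]; omega)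
  let U : TopologicalSpace.Opens E := ⟨{0}ᶜ, isOpen_compl_singleton⟩
  have hU : ∀ x : U, ‖(x : E)‖ ≠ 0 := fun x => norm_ne_zero_iff.2 x.2
  have hmem : ∀ x : U, ‖(x : E)‖⁻¹ • (x : E) ∈ Metric.sphere (0 : E) 1 := fun x => by
    rw [mem_sphere_zero_iff_norm, norm_smul, norm_inv, norm_norm, inv_mul_cancel₀ (hU x)]
  have hsm : ContMDiff 𝓘(ℝ, E) 𝓘(ℝ, E) ∞ fun x : U => ‖(x : E)‖⁻¹ • (x : E) := by
    intro x
    refine (contMDiffAt_subtype_iff (f := fun x : E => ‖x‖⁻¹ • x)).2 (ContDiffAt.contMDiffAt ?_)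
    exact ((contDiffAt_norm ℝ x.2).inv (hU x)).smul contDiffAt_id
  have hcomp := hu.comp (hsm.codRestrict_sphere (n := N) hmem)
  -- The value at the origin is irrelevant: `F` is only used near the unit sphere.
  let F : E → ℝ := fun x => if h : x ∈ U then
    u (Set.codRestrict (fun x : U => ‖(x : E)‖⁻¹ • (x : E)) _ hmem ⟨x, h⟩) else 0
  have hF : ∀ x : U, F x = u (Set.codRestrict (fun x : U => ‖(x : E)‖⁻¹ • (x : E)) _ hmem x) :=
    fun x => dif_pos x.2
  have hFs : ∀ x ∈ U, ContDiffAt ℝ ∞ F x := by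
    intro x hx
    refine ContMDiffAt.contDiffAt ?_
    refine (contMDiffAt_subtype_iff (x := (⟨x, hx⟩ : U))).1 ?_
    exact (hcomp ⟨x, hx⟩).congr_of_eventuallyEq (Eventually.of_forall hF)
  have hSU : ∀ x ∈ Metric.sphere (0 : E) 1, x ∈ U := by
    rintro x hx (rfl : x = 0)
    simp at hx
  obtain ⟨K, hK⟩ := LocallyLipschitzOn.exists_lipschitzOnWith_of_compact (f := F)
    (isCompact_sphere (0 : E) 1) (by
      intro x hx
      obtain ⟨K, t, ht, hKt⟩ := ((hFs x (hSU x hx)).of_le (by simp)).exists_lipschitzOnWith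
      exact ⟨K, t, mem_nhdsWithin_of_mem_nhds ht, hKt⟩)
  refine ⟨K, fun z ζ => ?_⟩
  have hFu : ∀ z : Metric.sphere (0 : E) 1, F z = u z := by
    intro z
    rw [hF ⟨z, hSU z z.2⟩]
    congr 1
    ext
    simp
  rw [← hFu, ← hFu]
  exact hK z.2 ζ.2

end Smooth

theorem contDiff_eval (Q : ℝ[X]) : ContDiff ℝ ∞ fun t : ℝ => Q.eval t := by
  simpa only [Polynomial.coe_aeval_eq_eval] using Q.contDiff_aeval (𝕜 := ℝ) ∞

theorem contMDiff_polynomial_comp_f {N : ℕ} [Fact (m + n = N + 1)] (Q : ℝ[X]) :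
    ContMDiff (𝓡 N) 𝓘(ℝ, ℝ) ∞ fun z : Sph m n => Q.eval (f z) := by
  have h1 : ContDiff ℝ ∞ fun z : Ambient m n => Q.eval (‖z.fst‖ ^ 2 - ‖z.snd‖ ^ 2) := by
    have h2 : ContDiff ℝ ∞ fun z : Ambient m n => ‖z.fst‖ ^ 2 - ‖z.snd‖ ^ 2 :=
      ((WithLp.fstL 2 ℝ (EuclideanSpace ℝ (Fin m)) (EuclideanSpace ℝ (Fin n))).contDiff.norm_sq
        ℝ).sub ((WithLp.sndL 2 ℝ (EuclideanSpace ℝ (Fin m))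
          (EuclideanSpace ℝ (Fin n))).contDiff.norm_sq ℝ)
    exact (contDiff_eval Q).comp h2
  exact h1.contMDiff.comp contMDiff_coe_sphere

theorem exists_lipschitzWith_f (h : m + n ≠ 0) : ∃ K, LipschitzWith K (f : Sph m n → ℝ) := by
  obtain ⟨N, hN⟩ := Nat.exists_eq_succ_of_ne_zero h
  have : Fact (m + n = N + 1) := ⟨hN⟩
  have := contMDiff_polynomial_comp_f (m := m) (n := n) (N := N) Polynomial.X
  simp only [Polynomial.eval_X] at this
  exact exists_lipschitzWith_of_contMDiff_sphere this

/-- The Lipschitz bound removes two powers of the distance from the singularity, leaving a Riesz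
kernel with `2p = N + 2s - 2 < N`, whose integral is finite and the same around every point. -/
theorem sphereEnergy_lt_top_of_lipschitz {N : ℕ} (h : m + n = N + 1) (hm : 2 ≤ m) (hn : 2 ≤ n)
    {s : ℝ} (hs1 : s < 1) {u : Sph m n → ℝ} {K : NNReal} (hu : LipschitzWith K u) :
    sphereEnergy N m n s u < ⊤ := by
  obtain ⟨a, ha⟩ := exists_norm_eq_one (show 1 ≤ m by omega)
  set p : ℝ := N / 2 + s - 1 with hp
  have hle : ∀ z ζ : Sph m n,
      ENNReal.ofReal (|u z - u ζ| ^ 2 / dist z ζ ^ ((N : ℝ) + 2 * s)) ≤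
        ENNReal.ofReal ((K : ℝ) ^ 2) *
          ENNReal.ofReal (rieszKernel p (inner ℝ (z : Ambient m n) (ζ : Ambient m n))) := by
    intro z ζ
    rw [← ENNReal.ofReal_mul (sq_nonneg _), rieszKernel_inner]
    refine ENNReal.ofReal_le_ofReal ?_
    have h1 := hu.dist_le_mul z ζ
    rw [Real.dist_eq] at h1
    rcases eq_or_ne z ζ with rfl | hne
    · rw [sub_self, abs_zero, zero_pow two_ne_zero, zero_div]
      positivity
    · have hd : 0 < dist z ζ := dist_pos.2 hne
      rw [show (N : ℝ) + 2 * s = 2 * p + 2 by rw [hp]; ring, Real.rpow_add hd, Real.rpow_two,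
        div_le_iff₀ (by positivity)]
      have hd2 : 0 < dist z ζ ^ (2 * p) := Real.rpow_pos_of_pos hd _
      calc |u z - u ζ| ^ 2 ≤ (K * dist z ζ) ^ 2 := pow_le_pow_left₀ (abs_nonneg _) h1 2
        _ = _ := by field_simp
  have hκ : ∀ z : Sph m n, ∫⁻ ζ : Sph m n,
      ENNReal.ofReal (rieszKernel p (inner ℝ (z : Ambient m n) (ζ : Ambient m n))) ∂(surf m n)
      = ∫⁻ ζ : Sph m n,
      ENNReal.ofReal (rieszKernel p (inner ℝ (pole n a) (ζ : Ambient m n))) ∂(surf m n) :=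
    fun z => lintegral_zonal_eq (k := fun t => ENNReal.ofReal (rieszKernel p t)) z (spherePole n ha)
  have hfin : ∫⁻ ζ : Sph m n,
      ENNReal.ofReal (rieszKernel p (inner ℝ (pole n a) (ζ : Ambient m n))) ∂(surf m n) < ⊤ := by
    have := lintegral_rieszKernel h hm hn 0 ha (p := p) (by rw [hp]; push_cast; linarith)
    simp only [pow_zero, mul_one] at this
    rw [this]
    exact ENNReal.ofReal_lt_top
  obtain ⟨B, hB⟩ := (isCompact_univ (X := Sph m n)).exists_bound_of_continuousOn
    (hu.continuous.pow 2).continuousOn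
  unfold sphereEnergy
  refine ENNReal.add_lt_top.2 ⟨ENNReal.mul_lt_top ENNReal.ofReal_lt_top ?_,
    ENNReal.mul_lt_top ENNReal.ofReal_lt_top ?_⟩
  · refine (lintegral_mono fun z => lintegral_mono fun ζ => hle z ζ).trans_lt ?_
    simp only [lintegral_const_mul' _ _ ENNReal.ofReal_ne_top, hκ, lintegral_const]
    exact ENNReal.mul_lt_top ENNReal.ofReal_lt_top
      (ENNReal.mul_lt_top hfin (measure_lt_top _ _))
  · refine (lintegral_mono fun z => ENNReal.ofReal_le_ofReal
      ((le_abs_self _).trans (hB z trivial))).trans_lt ?_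
    rw [lintegral_const]
    exact ENNReal.mul_lt_top ENNReal.ofReal_lt_top (measure_lt_top _ _)

/-! ### The Sobolev closures as spaces of finite energy -/

section Closure

variable {N : ℕ} (hm : 2 ≤ m) (hn : 2 ≤ n) {s : ℝ}

/-- The partial sums of the Jacobi expansion of `w`. -/
def jacobiSum (m n : ℕ) (w : ℝ → ℝ) (k : ℕ) : ℝ[X] :=
  ∑ i ∈ Finset.range k, Polynomial.C (hCoeff m n w i /
    √(∫ x, (jac m n i).eval x ^ 2 ∂(hMeasure m n))) * jac m n i

theorem eval_jacobiSum (w : ℝ → ℝ) (k : ℕ) (t : ℝ) :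
    (jacobiSum m n w k).eval t = ∑ i ∈ Finset.range k, hCoeff m n w i * pJac m n i t := by
  rw [jacobiSum, Polynomial.eval_finsetSum]
  refine Finset.sum_congr rfl fun i _ => ?_
  rw [Polynomial.eval_mul, Polynomial.eval_C, pJac]
  ring

theorem jacobiSum_ae_eq (w : ℝ → ℝ) (k : ℕ) :
    (∑ i ∈ Finset.range k, hCoeff m n w i • pLp hm hn i : Lp ℝ 2 (hMeasure m n))
      =ᵐ[hMeasure m n] fun t => (jacobiSum m n w k).eval t := by
  simp only [eval_jacobiSum]
  induction k with
  | zero =>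
    simp only [Finset.range_zero, Finset.sum_empty]
    exact Lp.coeFn_zero ℝ 2 _
  | succ k ih =>
    simp only [Finset.sum_range_succ]
    filter_upwards [Lp.coeFn_add (∑ i ∈ Finset.range k, hCoeff m n w i • pLp hm hn i)
      (hCoeff m n w k • pLp hm hn k), Lp.coeFn_smul (hCoeff m n w k) (pLp hm hn k), ih,
      (memLp_pJac hm hn k).coeFn_toLp] with t h1 h2 h3 h4
    rw [h1, Pi.add_apply, h2, h3, Pi.smul_apply, smul_eq_mul, pLp, h4]

/-- Subtracting a partial sum erases the first `k` coefficients and leaves the others alone, so the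
energy of the remainder is a tail of the energy series. -/
theorem hEnergy_sub_jacobiSum (w : Lp ℝ 2 (hMeasure m n)) (k : ℕ) :
    hEnergy N m n s (w - ∑ i ∈ Finset.range k, hCoeff m n w i • pLp hm hn i :
      Lp ℝ 2 (hMeasure m n))
      = ∑' i, ENNReal.ofReal (hCoeff m n w (i + k) ^ 2 * symbol N s (eigenval N (i + k))) := by
  have hc : ∀ j, hCoeff m n (w - ∑ i ∈ Finset.range k, hCoeff m n w i • pLp hm hn i :
      Lp ℝ 2 (hMeasure m n)) j = if j < k then 0 else hCoeff m n w j := by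
    intro j
    rw [hCoeff_eq_inner hm hn, inner_sub_right, ← hCoeff_eq_inner, inner_sum]
    simp only [inner_smul_right, orthonormal_iff_ite.1 (orthonormal_pLp hm hn), mul_ite, mul_one,
      mul_zero, Finset.sum_ite_eq, Finset.mem_range]
    split_ifs <;> simp
  rw [hEnergy, ← ENNReal.summable.sum_add_tsum_nat_add' (k := k), Finset.sum_eq_zero, zero_add]
  · refine tsum_congr fun i => ?_
    rw [hc, if_neg (by omega)]
  · intro j hj
    rw [hc, if_pos (Finset.mem_range.1 hj)]
    simp

theorem tendsto_hEnergy_sub_jacobiSum {w : Lp ℝ 2 (hMeasure m n)}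
    (hw : hEnergy N m n s w < ⊤) :
    Tendsto (fun k => hEnergy N m n s (w - ∑ i ∈ Finset.range k, hCoeff m n w i • pLp hm hn i :
      Lp ℝ 2 (hMeasure m n))) atTop (𝓝 0) := by
  simp only [hEnergy_sub_jacobiSum]
  exact ENNReal.tendsto_sum_nat_add _ hw.ne

-- Both `v` on `[-1, 1]` and `f` are Lipschitz, so `v ∘ f` has finite energy on the sphere, and the
-- equality of energies brings this back. No decay estimate for Jacobi coefficients is needed.
include hm hn in
theorem hEnergy_lt_top_of_contDiffOn (h : m + n = N + 1) (hs0 : 0 < s) (hs1 : s < 1) {v : ℝ → ℝ}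
    (hv : ContDiffOn ℝ ∞ v (Icc (-1) 1)) : hEnergy N m n s v < ⊤ := by
  have hvL := memLp_of_continuousOn hm hn hv.continuousOn
  obtain ⟨K, hK⟩ := hv.exists_lipschitzOnWith (by simp) (convex_Icc _ _) isCompact_Icc
  obtain ⟨K', hK'⟩ := exists_lipschitzWith_f (m := m) (n := n) (by omega)
  have hvf : LipschitzWith (K * K') fun z : Sph m n => v (f z) := by
    rw [← lipschitzOnWith_univ]
    exact hK.comp hK'.lipschitzOnWith fun z _ => f_mem_Icc z
  rw [← hEnergy_congr N m n s hvL.coeFn_toLp, ← sphereEnergy_comp_f h hm hn hs0 hs1]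
  rw [sphereEnergy_congr N m n s (v := fun z => v (f z))
    ((measurePreserving_f hm hn).quasiMeasurePreserving.ae hvL.coeFn_toLp)]
  exact sphereEnergy_lt_top_of_lipschitz h hm hn hs1 hvf

/-- A limit in energy of functions of finite energy has finite energy. Conversely, the Jacobi
partial sums are polynomials and converge to `w` in energy. -/
theorem mem_Hsh_iff (h : m + n = N + 1) (hs0 : 0 < s) (hs1 : s < 1)
    (w : Lp ℝ 2 (hMeasure m n)) : w ∈ Hsh N hm hn s ↔ hEnergy N m n s w < ⊤ := by
  constructor
  · rintro ⟨v, hv, hlim⟩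
    unfold hNorm at hlim
    rw [tendsto_rpow_half_iff] at hlim
    obtain ⟨k, hk⟩ := (hlim.eventually_lt_const ENNReal.zero_lt_top).exists
    have hvL := memLp_of_continuousOn hm hn (hv k).continuousOn
    rw [hEnergy_congr N m n s (v := fun t => (w t - v k t) + v k t)
      (Eventually.of_forall fun t => (sub_add_cancel _ _).symm)]
    refine (hEnergy_add_le N hm hn s ((Lp.memLp w).sub hvL) hvL).trans_lt ?_
    exact ENNReal.add_lt_top.2 ⟨ENNReal.mul_lt_top (by simp) hk,
      ENNReal.mul_lt_top (by simp) (hEnergy_lt_top_of_contDiffOn hm hn h hs0 hs1 (hv k))⟩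
  · intro hw
    refine ⟨fun k t => (jacobiSum m n w k).eval t, fun k => (contDiff_eval _).contDiffOn, ?_⟩
    unfold hNorm
    rw [tendsto_rpow_half_iff]
    refine (tendsto_hEnergy_sub_jacobiSum hm hn hw).congr fun k => hEnergy_congr N m n s ?_
    filter_upwards [Lp.coeFn_sub w (∑ i ∈ Finset.range k, hCoeff m n w i • pLp hm hn i),
      jacobiSum_ae_eq hm hn w k] with t h1 h2
    rw [h1, Pi.sub_apply, h2]

theorem sphereEnergy_eq_hEnergy_jMap (h : m + n = N + 1) (hs0 : 0 < s) (hs1 : s < 1)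
    (u : L2G m n) :
    sphereEnergy N m n s (u : Lp ℝ 2 (surf m n)) = hEnergy N m n s (jMap hm hn u) := by
  rw [← sphereEnergy_comp_f h hm hn hs0 hs1]
  exact sphereEnergy_congr N m n s ((ae_eq_comp_f_iff hm hn u _).2 EventuallyEq.rfl)

-- For invariant `u = w ∘ f` of finite energy, the approximants are the Jacobi partial sums of `w`
-- composed with `f`. They are smooth on the sphere, and their distance to `u` is an energy on the
-- interval that tends to 0.
include hm hn in
theorem mem_Hs_iff [h : Fact (m + n = N + 1)] (hs0 : 0 < s) (hs1 : s < 1) (u : L2G m n) :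
    (u : Lp ℝ 2 (surf m n)) ∈ Hs N m n s ↔
      sphereEnergy N m n s (u : Lp ℝ 2 (surf m n)) < ⊤ := by
  constructor
  · rintro ⟨v, hv, hlim⟩
    unfold sphereNorm at hlim
    rw [tendsto_rpow_half_iff] at hlim
    obtain ⟨k, hk⟩ := (hlim.eventually_lt_const ENNReal.zero_lt_top).exists
    rw [sphereEnergy_congr N m n s
      (v := fun z => ((u : Lp ℝ 2 (surf m n)) z - v k z) + v k z)
      (Eventually.of_forall fun t => (sub_add_cancel _ _).symm)]
    refine (sphereEnergy_add_le N m n s ((Lp.stronglyMeasurable _).measurable.sub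
      (hv k).continuous.measurable)).trans_lt ?_
    obtain ⟨K, hK⟩ := exists_lipschitzWith_of_contMDiff_sphere (hv k)
    exact ENNReal.add_lt_top.2 ⟨ENNReal.mul_lt_top (by simp) hk,
      ENNReal.mul_lt_top (by simp) (sphereEnergy_lt_top_of_lipschitz h.out hm hn hs1 hK)⟩
  · intro hu
    set w := jMap hm hn u with hw
    refine ⟨fun k z => (jacobiSum m n w k).eval (f z),
      fun k => contMDiff_polynomial_comp_f _, ?_⟩
    unfold sphereNorm
    rw [tendsto_rpow_half_iff]
    rw [sphereEnergy_eq_hEnergy_jMap hm hn h.out hs0 hs1] at hu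
    refine (tendsto_hEnergy_sub_jacobiSum hm hn hu).congr fun k => ?_
    rw [← sphereEnergy_comp_f h.out hm hn hs0 hs1]
    refine sphereEnergy_congr N m n s ?_
    have hf := (measurePreserving_f hm hn).quasiMeasurePreserving
    filter_upwards [hf.ae (Lp.coeFn_sub w (∑ i ∈ Finset.range k, hCoeff m n w i • pLp hm hn i)),
      hf.ae (jacobiSum_ae_eq hm hn w k), (ae_eq_comp_f_iff hm hn u w).2 EventuallyEq.rfl]
      with z h1 h2 h3
    rw [h1, Pi.sub_apply, h2, h3]

/-- The restriction of `j` to the fractional Sobolev spaces. -/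
def jMapSobolev [h : Fact (m + n = N + 1)] (hs0 : 0 < s) (hs1 : s < 1) :
    HsG N m n s ≃ₗ[ℝ] Hsh N hm hn s where
  toFun u := ⟨jMap hm hn ⟨u, u.2.2⟩, by
    rw [mem_Hsh_iff hm hn h.out hs0 hs1, ← sphereEnergy_eq_hEnergy_jMap hm hn h.out hs0 hs1]
    exact (mem_Hs_iff hm hn hs0 hs1 ⟨u, u.2.2⟩).1 u.2.1⟩
  map_add' u v := Subtype.ext (map_add (jMap hm hn) ⟨u, u.2.2⟩ ⟨v, v.2.2⟩)
  map_smul' c u := Subtype.ext (map_smul (jMap hm hn) c ⟨u, u.2.2⟩)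
  invFun w := ⟨(jMap hm hn).symm w, by
    refine ⟨(mem_Hs_iff hm hn hs0 hs1 _).2 ?_, ((jMap hm hn).symm w).2⟩
    rw [sphereEnergy_eq_hEnergy_jMap hm hn h.out hs0 hs1, LinearIsometryEquiv.apply_symm_apply]
    exact (mem_Hsh_iff hm hn h.out hs0 hs1 _).1 w.2⟩
  left_inv u := Subtype.ext <| by
    change (((jMap hm hn).symm (jMap hm hn ⟨u, u.2.2⟩) : L2G m n) : Lp ℝ 2 (surf m n)) = u
    rw [LinearIsometryEquiv.symm_apply_apply]
  right_inv w := Subtype.ext ((jMap hm hn).apply_symm_apply _)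

end Closure

end Spectral

end SymSphere

end

theorem mainTheorem6 (N m n : ℕ) [Fact (m + n = N + 1)] (hm : 2 ≤ m) (hn : 2 ≤ n) :
    ∃ j : SymSphere.L2G m n ≃ₗᵢ[ℝ] Lp ℝ 2 (SymSphere.hMeasure m n),
      (∀ (u : SymSphere.L2G m n) (w : ℝ → ℝ),
        ((u : Lp ℝ 2 (SymSphere.surf m n)) =ᵐ[SymSphere.surf m n]
            fun z => w (SymSphere.f z)) ↔
          j u =ᵐ[SymSphere.hMeasure m n] w) ∧
      ∀ s : ℝ, 0 < s → s < 1 →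
        ∃ js : SymSphere.HsG N m n s ≃ₗ[ℝ] SymSphere.Hsh N hm hn s,
          ∀ u : SymSphere.HsG N m n s,
            (js u : Lp ℝ 2 (SymSphere.hMeasure m n)) = j ⟨u, u.2.2⟩ ∧
            SymSphere.sphereNorm N m n s (u : Lp ℝ 2 (SymSphere.surf m n)) < ⊤ ∧
            SymSphere.hNorm N m n s (js u : Lp ℝ 2 (SymSphere.hMeasure m n)) =
              SymSphere.sphereNorm N m n s (u : Lp ℝ 2 (SymSphere.surf m n)) := by
  refine ⟨SymSphere.jMap hm hn, SymSphere.ae_eq_comp_f_iff hm hn, fun s hs0 hs1 =>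
    ⟨SymSphere.jMapSobolev hm hn hs0 hs1, fun u => ⟨rfl, ?_, ?_⟩⟩⟩
  · exact ENNReal.rpow_lt_top_of_nonneg (by norm_num)
      ((SymSphere.mem_Hs_iff hm hn hs0 hs1 ⟨u, u.2.2⟩).1 u.2.1).ne
  · rw [SymSphere.sphereNorm, SymSphere.hNorm]
    exact congrArg (· ^ (1 / 2 : ℝ))
      (SymSphere.sphereEnergy_eq_hEnergy_jMap hm hn Fact.out hs0 hs1 ⟨u, u.2.2⟩).symm
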